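/- Let $K$ be an algebraically closed field, let $\Lambda$ be a finite-dimensional $K$-algebra, and let $D\Lambda=\operatorname{Hom}_K(\Lambda,K)$ with the bimodule structure $(afb)(x)=f(bxa)$. Let $T(\Lambda)=\Lambda\oplus D\Lambda$ be the trivial extension, with multiplication $(a,f)(b,g)=(ab,\,ag+fb)$. For a finite-dimensional $K$-algebra $A$, let $\mathcal K_A=\mathsf K^{\rm b}(\operatorname{proj}A)$ be the bounded homotopy category of finitely generated projective right $A$-modules. For $X,Y\in\mathcal K_A$ write $X\ge Y$ if $\operatorname{Hom}_{\mathcal K_A}(X,Y[i])=0$ for all $i>0$. An object $X$ is silting if $X\ge X$ and the smallest thick subcategory of $\mathcal K_A$ containing $X$ is $\mathcal K_A$. Let $\operatorname{2silt}A$ be the set of isomorphism classes of basic silting objects $X$ with $A\ge X\ge A[1]$, ordered by $\ge$. For an indecomposable projective $A$-module $P$ put $$\mathcal T_P^-=\{X\in\operatorname{2silt}A\mid \mu_P^-(A)\ge X\},\qquad \mathcal T_P^+=\{X\in\operatorname{2silt}A\mid X\ge \mu^+_{P[1]}(A[1])\}.$$ Here $A$ and $A[1]$ are replaced by their basic versions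 before mutating. If $B=X\oplus M$ is basic, then the left mutation is $\mu_X^-(B)=Y\oplus M$ with $Y$ the cone of a minimal left $\operatorname{add}M$-approximation $X\to M'$, and the right mutation is $\mu_X^+(B)=Y'\oplus M$ with $Y'$ the cocone of a minimal right $\operatorname{add}M$-approximation $M''\to X$. Let $\sigma$ be an anti-automorphism of $\Lambda$, i.e. a $K$-algebra isomorphism $\Lambda^{\rm op}\to\Lambda$. Then: 1. $\overline\sigma(a,f)=(\sigma(a),\,f\circ\sigma^{-1})$ defines an anti-automorphism $\overline\sigma$ of the $K$-algebra $T(\Lambda)$. 2. If $e$ is a primitive idempotent of $\Lambda$ with $\sigma(e)=e$, then $(e,0)$ is a primitive idempotent of $T(\Lambda)$ and $\overline\sigma(e,0)=(e,0)$. 3. In the situation of 2, with $P=(e,0)\,T(\Lambda)$, there is a bisection of $\operatorname{2silt}T(\Lambda)$ with respect to $P$: the set $\operatorname{2silt}T(\Lambda)$ is the disjoint union of $\mathcal T_P^-$ and $\mathcal T_P^+$, there is an order-reversing bijection (with order-reversing inverse) $\mathcal T_P^-\to\mathcal T_P^+$, and hence $|\operatorname{2silt}T(\Lambda)|=2|\mathcal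 T_P^-|=2|\mathcal T_P^+|$ as cardinals. -/

import Mathlib

open CategoryTheory Limits Pretriangulated

universe u v

noncomputable section

/-! ### The trivial extension -/

section TrivialExtension

variable (K : Type v) (L : Type u) [Field K] [Ring L] [Algebra K L]

/-- The `K`-dual `D L = Hom_K(L, K)`, with its `L`-`L`-bimodule structure
`(a • f • b) x = f (b * x * a)`. (A type synonym, so that no other action is found on it.) -/
def KDual : Type (max u v) := Module.Dual K L

namespace KDual

instance : AddCommGroup (KDual K L) := inferInstanceAs (AddCommGroup (Module.Dual K L))

instance : Module K (KDual K L) := inferInstanceAs (Module K (Module.Dual K L))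

variable {K L}

/-- An element of `D L` as a linear form. -/
def toDual : KDual K L ≃ₗ[K] Module.Dual K L := LinearEquiv.refl K _

@[ext] lemma ext {f g : KDual K L} (h : ∀ x, toDual f x = toDual g x) : f = g :=
  LinearMap.ext (f := toDual f) (g := toDual g) h

/-- The left action: `(a • f) x = f (x * a)`. -/
instance : Module L (KDual K L) where
  smul a f := toDual.symm (toDual f ∘ₗ LinearMap.mulRight K a)
  one_smul f := ext fun x => congrArg (toDual f) (mul_one x)
  mul_smul a b f := ext fun x => congrArg (toDual f) (mul_assoc x a b).symm
  smul_zero _ := rfl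
  smul_add _ _ _ := rfl
  add_smul a b f := ext fun x => (congrArg (toDual f) (mul_add x a b)).trans (map_add _ _ _)
  zero_smul f := ext fun x => (congrArg (toDual f) (mul_zero x)).trans (map_zero _)

/-- The right action: `(f • b) x = f (b * x)`. -/
instance : Module Lᵐᵒᵖ (KDual K L) where
  smul b f := toDual.symm (toDual f ∘ₗ LinearMap.mulLeft K b.unop)
  one_smul f := ext fun x => congrArg (toDual f) (one_mul x)
  mul_smul a b f := ext fun x => congrArg (toDual f) (mul_assoc b.unop a.unop x)
  smul_zero _ := rfl
  smul_add _ _ _ := rfl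
  add_smul a b f := ext fun x =>
    (congrArg (toDual f) (add_mul a.unop b.unop x)).trans (map_add _ _ _)
  zero_smul f := ext fun x => (congrArg (toDual f) (zero_mul x)).trans (map_zero _)

lemma toDual_smul (a : L) (f : KDual K L) (x : L) : toDual (a • f) x = toDual f (x * a) := rfl

lemma toDual_op_smul (b : Lᵐᵒᵖ) (f : KDual K L) (x : L) :
    toDual (b • f) x = toDual f (b.unop * x) := rfl

lemma toDual_base_smul (c : K) (f : KDual K L) (x : L) :
    toDual (c • f) x = c * toDual f x := rfl

instance : SMulCommClass L Lᵐᵒᵖ (KDual K L) where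
  smul_comm a b f := ext fun x => congrArg (toDual f) (mul_assoc b.unop x a).symm

instance : IsScalarTower K L (KDual K L) where
  smul_assoc c a f := ext fun x => by
    rw [toDual_smul, toDual_base_smul, toDual_smul, mul_smul_comm, map_smul, smul_eq_mul]

instance : IsScalarTower K Lᵐᵒᵖ (KDual K L) where
  smul_assoc c a f := ext fun x => by
    rw [toDual_op_smul, toDual_base_smul, toDual_op_smul, MulOpposite.unop_smul,
      smul_mul_assoc, map_smul, smul_eq_mul]

end KDual

/-- The trivial extension `T(L) = L ⊕ D L`, with `(a, f) * (b, g) = (a * b, a • g + f • b)`. -/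
abbrev TrivialExtension : Type (max u v) := TrivSqZeroExt L (KDual K L)

end TrivialExtension

/-- A primitive idempotent: a nonzero idempotent that is not the sum of two nonzero
orthogonal idempotents. -/
def IsPrimitiveIdempotent {A : Type u} [Ring A] (e : A) : Prop :=
  IsIdempotentElem e ∧ e ≠ 0 ∧
    ∀ a b : A, IsIdempotentElem a → IsIdempotentElem b → a * b = 0 → b * a = 0 →
      e = a + b → a = 0 ∨ b = 0

/-! ### The bounded homotopy category of finitely generated projective right modules -/

section PerfectCategory

/-- Bounded cochain complexes, as objects of the homotopy category of an additive category. -/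
def isBoundedComplex (C : Type u) [Category.{v} C] [Preadditive C] :
    ObjectProperty (HomotopyCategory C (ComplexShape.up ℤ)) :=
  fun X => ∃ a b : ℤ, ∀ i : ℤ, i < a ∨ b < i → IsZero (X.as.X i)

variable (C : Type u) [Category.{v} C] [Preadditive C]

instance [HasZeroObject C] : (isBoundedComplex C).ContainsZero where
  exists_zero := by
    obtain ⟨Z, hZ⟩ := HasZeroObject.zero (C := CochainComplex C ℤ)
    exact ⟨(HomotopyCategory.quotient _ _).obj Z, Functor.map_isZero _ hZ, 0, 0, fun i _ =>
      Functor.map_isZero (HomologicalComplex.eval C (ComplexShape.up ℤ) i) hZ⟩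

instance : (isBoundedComplex C).IsStableUnderShift ℤ where
  isStableUnderShiftBy n :=
    { le_shift X hX := by
        obtain ⟨X : CochainComplex _ _, rfl⟩ := X.quotient_obj_surjective
        obtain ⟨a, b, h⟩ := hX
        rw [ObjectProperty.prop_shift_iff, HomotopyCategory.shift_quotient_obj]
        exact ⟨a - n, b - n, fun i hi => h (i + n) (by omega)⟩ }

instance [HasZeroObject C] [HasBinaryBiproducts C] :
    (isBoundedComplex C).IsTriangulatedClosed₃ where
  ext₃' T hT h₁ h₂ := by
    obtain ⟨a₁, b₁, h₁⟩ := h₁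
    obtain ⟨a₂, b₂, h₂⟩ := h₂
    obtain ⟨f : T.obj₁.as ⟶ T.obj₂.as, hf⟩ :=
      (HomotopyCategory.quotient _ _).map_surjective T.mor₁
    refine ⟨_, ?_, ⟨Triangle.π₃.mapIso (isoTriangleOfIso₁₂ T _ hT
      (HomotopyCategory.mappingCone_triangleh_distinguished f)
        (Iso.refl _) (Iso.refl _) ?_)⟩⟩
    · refine ⟨min (a₁ - 1) a₂, max (b₁ - 1) b₂, fun i hi => ?_⟩
      refine (CochainComplex.mappingCone.isZero_X_iff f i).2 ⟨h₁ _ ?_, h₂ _ ?_⟩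
      · omega
      · omega
    · exact (Category.comp_id _).trans (hf.symm.trans (Category.id_comp _).symm)

instance [HasZeroObject C] [HasBinaryBiproducts C] : (isBoundedComplex C).IsTriangulated where
  toIsTriangulatedClosed₂ := .of_isTriangulatedClosed₃

end PerfectCategory

section Algebras

/-- Finitely generated projective right `A`-modules (right modules are `Aᵐᵒᵖ`-modules). -/
def isFGProjective (A : Type u) [Ring A] : ObjectProperty (ModuleCat.{u} Aᵐᵒᵖ) :=
  fun M => Module.Finite Aᵐᵒᵖ M ∧ Module.Projective Aᵐᵒᵖ M

/-- The category `proj A` of finitely generated projective right `A`-modules. -/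
abbrev ProjCat (A : Type u) [Ring A] := (isFGProjective A).FullSubcategory

variable (A : Type u) [Ring A]

instance : (isFGProjective A).ContainsZero where
  exists_zero := ⟨ModuleCat.of Aᵐᵒᵖ PUnit, ModuleCat.isZero_of_subsingleton _,
    inferInstanceAs (Module.Finite Aᵐᵒᵖ PUnit.{u + 1}),
    inferInstanceAs (Module.Projective Aᵐᵒᵖ PUnit.{u + 1})⟩

instance : HasBinaryBiproducts (ProjCat A) where
  has_binary_biproduct P Q := by
    have := P.property.1
    have := P.property.2
    have := Q.property.1
    have := Q.property.2
    exact HasBinaryBiproduct.mk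
      { bicone :=
          { pt := ⟨ModuleCat.of Aᵐᵒᵖ (P.obj × Q.obj), inferInstanceAs (Module.Finite _ (_ × _)),
              inferInstanceAs (Module.Projective _ (_ × _))⟩
            fst := ObjectProperty.homMk (ModuleCat.ofHom (LinearMap.fst _ _ _))
            snd := ObjectProperty.homMk (ModuleCat.ofHom (LinearMap.snd _ _ _))
            inl := ObjectProperty.homMk (ModuleCat.ofHom (LinearMap.inl _ _ _))
            inr := ObjectProperty.homMk (ModuleCat.ofHom (LinearMap.inr _ _ _)) }
        isBilimit := isBinaryBilimitOfTotal _ (by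
          refine ObjectProperty.hom_ext _ (ModuleCat.hom_ext (LinearMap.ext fun x => ?_))
          exact Prod.fst_add_snd (M := P.obj) (N := Q.obj) x) }

/-- Right multiplication turns `A` into a finitely generated projective right module. -/
lemma isFGProjective_self : isFGProjective A (ModuleCat.of Aᵐᵒᵖ A) := by
  let l : A ≃ₗ[Aᵐᵒᵖ] Aᵐᵒᵖ :=
    { MulOpposite.opAddEquiv with map_smul' := fun _ _ => rfl }
  exact ⟨Module.Finite.equiv l.symm, Module.Projective.of_equiv l.symm⟩

variable {A} in
/-- For an idempotent `e`, the right ideal `e A` is a finitely generated projective module. -/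
lemma isFGProjective_span {e : A} (he : IsIdempotentElem e) :
    isFGProjective A (ModuleCat.of Aᵐᵒᵖ (Submodule.span Aᵐᵒᵖ {e} : Submodule Aᵐᵒᵖ A)) := by
  have := (isFGProjective_self A).2
  refine ⟨Module.Finite.span_singleton Aᵐᵒᵖ e, ?_⟩
  let p : A →ₗ[Aᵐᵒᵖ] (Submodule.span Aᵐᵒᵖ {e} : Submodule Aᵐᵒᵖ A) :=
    { toFun := fun x => ⟨e * x, Submodule.mem_span_singleton.2 ⟨MulOpposite.op x, rfl⟩⟩
      map_add' := fun x y => Subtype.ext (mul_add e x y)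
      map_smul' := fun a x => Subtype.ext (mul_assoc e x a.unop).symm }
  refine Module.Projective.of_split (Submodule.subtype _) p (LinearMap.ext fun x => ?_)
  obtain ⟨a, ha⟩ := Submodule.mem_span_singleton.1 x.2
  refine Subtype.ext ?_
  change e * (x : A) = x
  rw [← ha]
  change e * (e * a.unop) = e * a.unop
  rw [← mul_assoc, he.eq]

/-- The triangulated category `K^b(proj A)`. -/
abbrev PerfCat := (isBoundedComplex (ProjCat A)).FullSubcategory

variable {A} in
/-- A finitely generated projective module as a complex concentrated in degree `0`. -/
def stalk (P : ProjCat A) : PerfCat A where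
  obj := (HomotopyCategory.quotient _ _).obj
    ((HomologicalComplex.single (ProjCat A) (ComplexShape.up ℤ) 0).obj P)
  property := ⟨0, 0, fun i hi =>
    HomologicalComplex.isZero_single_obj_X (ComplexShape.up ℤ) 0 P i (by omega)⟩

/-- The right module `A` in `K^b(proj A)`. -/
def regularObj : PerfCat A := stalk ⟨ModuleCat.of Aᵐᵒᵖ A, isFGProjective_self A⟩

variable {A} in
/-- The right module `e A` in `K^b(proj A)`, for an idempotent `e`. -/
def idempotentObj (e : A) (he : IsIdempotentElem e) : PerfCat A :=
  stalk ⟨ModuleCat.of Aᵐᵒᵖ (Submodule.span Aᵐᵒᵖ {e} : Submodule Aᵐᵒᵖ A), isFGProjective_span he⟩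

end Algebras

/-! ### Silting objects and mutation in a triangulated category -/

section Silting

/-- `T ≥ U`: `Hom(T, U[i]) = 0` for all `i > 0`. -/
def SiltingGE {C : Type u} [Category.{v} C] [HasShift C ℤ] [Preadditive C]
    (T U : C) : Prop := ∀ i : ℤ, 0 < i → ∀ f : T ⟶ U⟦i⟧, f = 0

lemma SiltingGE.of_iso {C : Type u} [Category.{v} C] [HasShift C ℤ] [Preadditive C]
    {T T' U U' : C} (a : T ≅ T') (b : U ≅ U') (h : SiltingGE T U) :
    SiltingGE T' U' := by
  intro i hi f
  have := h i hi (a.hom ≫ f ≫ b.inv⟦i⟧')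
  rwa [Preadditive.IsIso.comp_left_eq_zero, Preadditive.IsIso.comp_right_eq_zero] at this

variable {C : Type u} [Category.{v} C] [HasZeroObject C] [HasShift C ℤ] [Preadditive C]
  [∀ n : ℤ, (shiftFunctor C n).Additive] [Pretriangulated C]

/-- `T` is silting: `Hom(T, T[i]) = 0` for all `i > 0`, and the smallest thick subcategory
containing `T` is the whole category. -/
def IsSilting (T : C) : Prop :=
  SiltingGE T T ∧ (ObjectProperty.singleton T).triangEnvelope = ⊤

/-- `T` is basic: no nonzero object occurs twice as a direct summand of `T`. -/
def IsBasic (T : C) : Prop := ∀ X Y : C, Nonempty (T ≅ (X ⊞ X) ⊞ Y) → IsZero X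

/-- `add M`: the direct summands of finite direct sums of copies of `M`. -/
def addClosure (M : C) : ObjectProperty C :=
  fun X => ∃ (n : ℕ) (Y : C), Nonempty (X ⊞ Y ≅ ⨁ fun _ : Fin n => M)

/-- `B` is the basic version of `T`: it is basic and has the same additive closure. -/
def IsBasicVersion (B T : C) : Prop := IsBasic B ∧ addClosure B = addClosure T

/-- `f : X ⟶ N` is a minimal left `add M`-approximation. -/
structure IsMinLeftApprox (M : C) {X N : C} (f : X ⟶ N) : Prop where
  mem : addClosure M N
  factors : ∀ (N' : C) (g : X ⟶ N'), addClosure M N' → ∃ h : N ⟶ N', f ≫ h = g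
  minimal : ∀ h : N ⟶ N, f ≫ h = f → IsIso h

/-- `f : N ⟶ X` is a minimal right `add M`-approximation. -/
structure IsMinRightApprox (M : C) {N X : C} (f : N ⟶ X) : Prop where
  mem : addClosure M N
  factors : ∀ (N' : C) (g : N' ⟶ X), addClosure M N' → ∃ h : N' ⟶ N, h ≫ f = g
  minimal : ∀ h : N ⟶ N, h ≫ f = f → IsIso h

/-- `U` is the left mutation of `T` with respect to the summand `X`: with `T ≅ X ⊕ M` and
`Y` the cone of a minimal left `add M`-approximation of `X`, one has `U ≅ Y ⊕ M`. -/
def IsLeftMutation (T X U : C) : Prop :=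
  ∃ M : C, Nonempty (T ≅ X ⊞ M) ∧
    ∃ (N Y : C) (f : X ⟶ N) (g : N ⟶ Y) (h : Y ⟶ X⟦(1 : ℤ)⟧),
      IsMinLeftApprox M f ∧ Triangle.mk f g h ∈ distTriang C ∧ Nonempty (U ≅ Y ⊞ M)

/-- `U` is the right mutation of `T` with respect to the summand `X`: with `T ≅ X ⊕ M` and
`Y` the cocone of a minimal right `add M`-approximation of `X`, one has `U ≅ Y ⊕ M`. -/
def IsRightMutation (T X U : C) : Prop :=
  ∃ M : C, Nonempty (T ≅ X ⊞ M) ∧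
    ∃ (N Y : C) (g : Y ⟶ N) (f : N ⟶ X) (h : X ⟶ Y⟦(1 : ℤ)⟧),
      IsMinRightApprox M f ∧ Triangle.mk g f h ∈ distTriang C ∧ Nonempty (U ≅ Y ⊞ M)

variable (C) in
/-- Isomorphism classes of objects. -/
abbrev IsoClass := Quotient (isIsomorphicSetoid C)

/-- The isomorphism class of an object. -/
def isoClass (T : C) : IsoClass C := Quotient.mk _ T

/-- The relation `≥` on isomorphism classes. -/
def ClassGE : IsoClass C → IsoClass C → Prop :=
  Quotient.lift₂ SiltingGE fun _ _ _ _ ⟨a⟩ ⟨b⟩ =>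
    propext ⟨SiltingGE.of_iso a b, SiltingGE.of_iso a.symm b.symm⟩

variable (C) in
/-- `silt`: the isomorphism classes of basic silting objects. -/
def silt : Set (IsoClass C) := {c | ∃ T : C, IsSilting T ∧ IsBasic T ∧ isoClass T = c}

end Silting

/-! ### Two-term silting objects -/

section TwoTerm

variable (A : Type u) [Ring A]

/-- `2silt A`: the `T` in `silt A` with `A ≥ T ≥ A[1]`. -/
def twoSilt : Set (IsoClass (PerfCat A)) :=
  {c | c ∈ silt (PerfCat A) ∧ ClassGE (isoClass (regularObj A)) c ∧
    ClassGE c (isoClass ((regularObj A)⟦(1 : ℤ)⟧))}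

variable {A} in
/-- The `T` in `2silt A` below the left mutation of (the basic version of) `A` at `P`. -/
def twoSiltMinus (P : PerfCat A) : Set (IsoClass (PerfCat A)) :=
  {c | c ∈ twoSilt A ∧ ∃ B U : PerfCat A, IsBasicVersion B (regularObj A) ∧
    IsLeftMutation B P U ∧ ClassGE (isoClass U) c}

variable {A} in
/-- The `T` in `2silt A` above the right mutation of (the basic version of) `A[1]` at `P[1]`. -/
def twoSiltPlus (P : PerfCat A) : Set (IsoClass (PerfCat A)) :=
  {c | c ∈ twoSilt A ∧ ∃ B U : PerfCat A, IsBasicVersion B ((regularObj A)⟦(1 : ℤ)⟧) ∧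
    IsRightMutation B (P⟦(1 : ℤ)⟧) U ∧ ClassGE c (isoClass U)}

end TwoTerm

end

/-! The trivial extension enters only through its anti-automorphism. The bisection holds for every
finite-dimensional algebra `A` and `P = eA` with `e` a primitive idempotent; the bijection between
the halves needs an anti-automorphism `s` of `A` that fixes `e`.

Write a basic version of `A` as `P ⊕ M`. A two-term silting object `T` is the cone of a morphism `d
: P₁ ⟶ P₀` of projectives, with `P₀ ⟶ T` right minimal (`exists_presentation`). By the triangles
that define the mutations, `T` lies below the left mutation iff every `P ⟶ T` factors through `add
M`, and above the right mutation iff every `T ⟶ P[1]` factors through `(add M)[1]`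
(`siltingGE_cone_iff`, `siltingGE_cocone_iff`). Since `End P` is local and `d` has no invertible
component at `P`, these conditions say that `P` is not a summand of `P₀`, respectively of `P₁`
(`leftFactors_iff`, `rightFactors_iff`). As `Hom(T, T[1]) = 0`, `P` is not a summand of both
(`addClosure_or_addClosure`). As `T` generates, `P` is a summand of at least one, for otherwise `P`
would lie in the thick subcategory generated by `M` (`not_addClosure_and_addClosure`). So exactly
one of the two conditions holds.

The bijection is `T ↦ T*[1]`, where `*` is `Hom_A(-, A)`, made a duality of right modules by `s`
(`twistedDual`). Up to isomorphism `*` fixes `A`, and it fixes `P` because `s` fixes `e`. So `T ↦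
T*[1]` reverses the order, exchanges `A` with `A[1]`, and replaces `P₁ ⟶ P₀` by `P₀* ⟶ P₁*`;
accordingly it exchanges the two factorisation conditions (`rightFactors_dualObj_iff`). Its inverse
is the same construction for the inverse anti-automorphism. -/

noncomputable section

/-! ### Morphisms out of projectives in the homotopy category. -/

section Stalk

variable {A : Type u} [Ring A]

/-- The functor `stalk`. -/
def stalkFunctor (A : Type u) [Ring A] : ProjCat A ⥤ PerfCat A where
  obj := stalk
  map f := ObjectProperty.homMk ((HomotopyCategory.singleFunctor (ProjCat A) 0).map f)
  map_id _ := ObjectProperty.hom_ext _ ((HomotopyCategory.singleFunctor (ProjCat A) 0).map_id _)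
  map_comp _ _ := ObjectProperty.hom_ext _ ((HomotopyCategory.singleFunctor (ProjCat A) 0).map_comp _ _)

instance : (stalkFunctor A).Additive where
  map_add := ObjectProperty.hom_ext _ ((HomotopyCategory.singleFunctor (ProjCat A) 0).map_add)

instance : (stalkFunctor A).Full where
  map_surjective {P Q} f := by
    obtain ⟨g, hg⟩ := (HomotopyCategory.quotient _ _).map_surjective f.hom
    obtain ⟨h, rfl⟩ := (CochainComplex.singleFunctor (ProjCat A) 0).map_surjective g
    exact ⟨h, ObjectProperty.hom_ext _ hg⟩

instance : (stalkFunctor A).Faithful where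
  map_injective {P Q} f g h := by
    have h' : (HomotopyCategory.quotient _ _).map
        ((CochainComplex.singleFunctor (ProjCat A) 0).map f) =
        (HomotopyCategory.quotient _ _).map ((CochainComplex.singleFunctor (ProjCat A) 0).map g) :=
      congrArg (fun k => k.hom) h
    have H := HomotopyCategory.homotopyOfEq _ _ h'
    apply (CochainComplex.singleFunctor (ProjCat A) 0).map_injective
    apply HomologicalComplex.from_single_hom_ext
    have := H.comm 0
    rw [dNext_eq H.hom (show (ComplexShape.up ℤ).Rel 0 1 by simp),
      prevD_eq H.hom (show (ComplexShape.up ℤ).Rel (-1) 0 by simp),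
      CochainComplex.singleFunctor_obj_d, CochainComplex.singleFunctor_obj_d, zero_comp, comp_zero,
      zero_add, zero_add] at this
    exact this

variable {C : Type u} [Category.{v} C] [Preadditive C]

/-- A chain map can be changed by a homotopy so as to vanish in one more degree. -/
lemma exists_homotopic_vanishing {Q Z : CochainComplex C ℤ} (φ : Q ⟶ Z) (k : ℤ)
    (hφ : ∀ i, k < i → φ.f i = 0)
    (H : ∀ g : Q.X k ⟶ Z.X k, g ≫ Z.d k (k + 1) = 0 →
      ∃ g' : Q.X k ⟶ Z.X (k - 1), g' ≫ Z.d (k - 1) k = g) :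
    ∃ ψ : Q ⟶ Z, (HomotopyCategory.quotient C _).map ψ = (HomotopyCategory.quotient C _).map φ ∧
      ∀ i, k - 1 < i → ψ.f i = 0 := by
  obtain ⟨g, hg⟩ := H (φ.f k) (by rw [φ.comm, hφ (k + 1) (by omega), comp_zero])
  -- The homotopy is `g` in degree `k` and zero elsewhere. Its boundary is `g ≫ d = φ.f k` in degree
  -- `k` and zero above; below `k` nothing is claimed.
  let h : ∀ i j, (ComplexShape.up ℤ).Rel j i → (Q.X i ⟶ Z.X j) := fun i j hij =>
    if hi : k = i then
      (Q.XIsoOfEq hi.symm).hom ≫ g ≫ (Z.XIsoOfEq (by simp at hij; omega)).hom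
    else 0
  have hh : ∀ i j hij, k ≠ i → h i j hij = 0 := fun i j hij hi => dif_neg hi
  have hk : h k (k - 1) (by simp) = g := by simp [h]
  refine ⟨φ - Homotopy.nullHomotopicMap' h, ?_, ?_⟩
  · rw [Functor.map_sub, HomotopyCategory.eq_of_homotopy _ 0 (Homotopy.nullHomotopy' h),
      Functor.map_zero, sub_zero]
  · intro i hi
    rw [HomologicalComplex.sub_f_apply, Homotopy.nullHomotopicMap'_f
      (show (ComplexShape.up ℤ).Rel (i - 1) i from sub_add_cancel i 1)
      (show (ComplexShape.up ℤ).Rel i (i + 1) from rfl)]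
    rw [hh (i + 1) i rfl (by omega), comp_zero, zero_add]
    by_cases hik : k = i
    · subst hik
      rw [hk, hg, sub_self]
    · rw [hh i (i - 1) (sub_add_cancel i 1) hik, zero_comp, sub_zero, hφ i (by omega)]

/-- Morphisms from a bounded complex to a complex without cohomology in its range vanish. -/
lemma bounded_hom_eq_zero {Q Z : CochainComplex C ℤ} (a b : ℤ)
    (hQ : ∀ i, i < a ∨ b < i → IsZero (Q.X i))
    (H : ∀ i, a ≤ i → ∀ g : Q.X i ⟶ Z.X i, g ≫ Z.d i (i + 1) = 0 →
      ∃ g' : Q.X i ⟶ Z.X (i - 1), g' ≫ Z.d (i - 1) i = g)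
    (f : (HomotopyCategory.quotient C _).obj Q ⟶ (HomotopyCategory.quotient C _).obj Z) :
    f = 0 := by
  -- Descending induction from the top degree `b`: after `n` steps the representative vanishes above
  -- `b - n`, so `b - a + 1` steps clear the whole range.
  have key : ∀ n : ℕ, ∃ ψ : Q ⟶ Z, (HomotopyCategory.quotient C _).map ψ = f ∧
      ∀ i, b - n < i → ψ.f i = 0 := by
    intro n
    induction n with
    | zero =>
      obtain ⟨φ, rfl⟩ := (HomotopyCategory.quotient _ _).map_surjective f
      exact ⟨φ, rfl, fun i hi => (hQ i (by simp at hi; omega)).eq_of_src _ _⟩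
    | succ n ih =>
      obtain ⟨φ, rfl, hφ⟩ := ih
      by_cases hk : b - n < a
      · exact ⟨φ, rfl, fun i hi => if h : i < a then (hQ i (.inl h)).eq_of_src _ _ else
          hφ i (by omega)⟩
      · obtain ⟨ψ, h1, h2⟩ := exists_homotopic_vanishing φ (b - n) hφ (H _ (by omega))
        exact ⟨ψ, h1, fun i hi => h2 i (by push_cast at hi; omega)⟩
  obtain ⟨ψ, rfl, hψ⟩ := key (b - a + 1).toNat
  have : ψ = 0 := by
    ext i
    by_cases h : i < a
    · exact (hQ i (.inl h)).eq_of_src _ _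
    · exact hψ i (by omega)
  rw [this, Functor.map_zero]

open CochainComplex CochainComplex.HomComplex in
/-- Morphisms from a shifted stalk complex vanish iff cycles are boundaries. -/
lemma single_hom_eq_zero_iff [HasZeroObject C] (P : C) (Z : CochainComplex C ℤ) (n m k : ℤ) (hm : n + 1 = m)
    (hk : k + 1 = n) :
    (∀ f : (HomotopyCategory.quotient C (ComplexShape.up ℤ)).obj
        ((CochainComplex.singleFunctor C 0).obj P) ⟶
        (HomotopyCategory.quotient C (ComplexShape.up ℤ)).obj (Z⟦n⟧), f = 0) ↔
      ∀ g : P ⟶ Z.X n, g ≫ Z.d n m = 0 → ∃ g' : P ⟶ Z.X k, g' ≫ Z.d k n = g := by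
  constructor
  · intro H g hg
    rw [← Cocycle.fromSingleMk_mem_coboundaries_iff g (zero_add n) m hm hg k hk]
    rw [← CohomologyClass.toHom_mk_eq_zero_iff]
    exact H _
  · intro H f
    obtain ⟨x, rfl⟩ := (CohomologyClass.toHom_bijective
      ((singleFunctor C 0).obj P) Z n).2 f
    obtain ⟨x, rfl⟩ := x.mk_surjective
    obtain ⟨g, hg, rfl⟩ := Cocycle.fromSingleMk_surjective x n (zero_add n) m hm
    rw [CohomologyClass.toHom_mk_eq_zero_iff,
      Cocycle.fromSingleMk_mem_coboundaries_iff g (zero_add n) m hm hg k hk]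
    exact H g hg

/-- The complex underlying a shift in `PerfCat A`. -/
def shiftObjIso (X : PerfCat A) (n : ℤ) :
    (X⟦n⟧).obj ≅ (HomotopyCategory.quotient (ProjCat A) (ComplexShape.up ℤ)).obj
      ((show CochainComplex (ProjCat A) ℤ from X.obj.as)⟦n⟧) :=
  ((isBoundedComplex (ProjCat A)).ι.commShiftIso n).app X ≪≫
    (((HomotopyCategory.quotient (ProjCat A) (ComplexShape.up ℤ)).commShiftIso n).app
      X.obj.as).symm

lemma stalk_hom_shift_eq_zero_iff (P : ProjCat A) (X : PerfCat A) (n m k : ℤ) (hm : n + 1 = m)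
    (hk : k + 1 = n) :
    (∀ f : stalk P ⟶ X⟦n⟧, f = 0) ↔
      ∀ g : P ⟶ X.obj.as.X n, g ≫ X.obj.as.d n m = 0 →
        ∃ g' : P ⟶ X.obj.as.X k, g' ≫ X.obj.as.d k n = g := by
  rw [← single_hom_eq_zero_iff P X.obj.as n m k hm hk]
  constructor
  · intro H f
    have h1 := H (ObjectProperty.homMk (f ≫ (shiftObjIso X n).inv))
    have h2 : f ≫ (shiftObjIso X n).inv = 0 := congrArg (fun k => k.hom) h1
    rwa [Preadditive.IsIso.comp_right_eq_zero] at h2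
  · intro H f
    have h1 := H (f.hom ≫ (shiftObjIso X n).hom)
    exact ObjectProperty.hom_ext _
      ((Preadditive.IsIso.comp_right_eq_zero f.hom (shiftObjIso X n).hom).1 h1)

/-- Morphisms from a perfect complex to high shifts of complexes bounded above vanish. -/
lemma exists_forall_hom_shift_eq_zero (Q : PerfCat A) : ∃ N : ℤ, ∀ X : PerfCat A,
    (∀ (P : ProjCat A) (i : ℤ), 0 < i → ∀ f : stalk P ⟶ X⟦i⟧, f = 0) →
      ∀ n : ℤ, N ≤ n → ∀ f : Q ⟶ X⟦n⟧, f = 0 := by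
  obtain ⟨a, b, hab⟩ := Q.property
  -- `Q` lives in degrees `i ≥ a`, so `n ≥ 1 - a` makes every relevant shift `n + i` positive.
  refine ⟨1 - a, fun X hX n hn f => ObjectProperty.hom_ext _ ?_⟩
  have h0 : f.hom = 0 := by
    refine bounded_hom_eq_zero (Q := Q.obj.as) (Z := (X⟦n⟧).obj.as) a b hab ?_ f.hom
    intro i hi
    refine (stalk_hom_shift_eq_zero_iff (Q.obj.as.X i) (X⟦n⟧) i (i + 1) (i - 1) rfl
      (by omega)).1 ?_
    intro g
    have h1 := hX (Q.obj.as.X i) (n + i) (by omega) (g ≫ (shiftFunctorAdd _ n i).inv.app X)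
    rwa [Preadditive.IsIso.comp_right_eq_zero] at h1
  exact h0

lemma stalk_hom_shift_eq_zero (P Q : ProjCat A) (i : ℤ) (hi : i ≠ 0)
    (f : stalk P ⟶ (stalk Q)⟦i⟧) : f = 0 := by
  refine (stalk_hom_shift_eq_zero_iff P (stalk Q) i (i + 1) (i - 1) rfl (by omega)).2
    (fun g _ => ⟨0, ?_⟩) f
  exact (HomologicalComplex.isZero_single_obj_X _ _ _ _ hi).eq_of_tgt _ _

/-- The free right module of rank `n`. -/
def freeProj (A : Type u) [Ring A] (n : ℕ) : ProjCat A :=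
  ⟨ModuleCat.of Aᵐᵒᵖ (Fin n → Aᵐᵒᵖ), inferInstanceAs (Module.Finite _ (Fin n → Aᵐᵒᵖ)),
    inferInstanceAs (Module.Projective _ (Fin n → Aᵐᵒᵖ))⟩

/-- Existence of right approximations by projective modules. -/
lemma exists_right_approx [IsNoetherianRing Aᵐᵒᵖ] (X : PerfCat A) :
    ∃ (Q : ProjCat A) (f : stalk Q ⟶ X), ∀ (P : ProjCat A) (g : stalk P ⟶ X),
      ∃ h : stalk P ⟶ stalk Q, h ≫ f = g := by
  obtain ⟨X, hX⟩ := X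
  obtain ⟨X : CochainComplex _ _, rfl⟩ := X.quotient_obj_surjective
  have hfin : Module.Finite Aᵐᵒᵖ (X.X 0).obj := (X.X 0).property.1
  -- A morphism from a projective in degree zero is represented by a map into the cycles `Z`. These
  -- are finitely generated by noetherianity, and maps from projectives lift along a free cover of
  -- `Z`.
  let Z := LinearMap.ker (X.d 0 1).hom.hom
  obtain ⟨n, s, hs⟩ := Module.Finite.exists_fin' Aᵐᵒᵖ Z
  let q : freeProj A n ⟶ X.X 0 := ObjectProperty.homMk (ModuleCat.ofHom (Z.subtype ∘ₗ s))
  have hq : q ≫ X.d 0 1 = 0 := by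
    refine ObjectProperty.hom_ext _ (ModuleCat.hom_ext (LinearMap.ext fun x => ?_))
    exact (s x).2
  let F : (HomologicalComplex.single (ProjCat A) (ComplexShape.up ℤ) 0).obj (freeProj A n) ⟶ X :=
    HomologicalComplex.mkHomFromSingle q (fun k hk => by
      obtain rfl : k = 1 := by simpa using hk.symm
      exact hq)
  refine ⟨freeProj A n, ObjectProperty.homMk ((HomotopyCategory.quotient _ _).map F),
    fun P g => ?_⟩
  obtain ⟨φ, hφ⟩ := (HomotopyCategory.quotient _ _).map_surjective g.hom
  let p : P ⟶ X.X 0 := (HomologicalComplex.singleObjXSelf (ComplexShape.up ℤ) 0 P).inv ≫ φ.f 0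
  have hp : p ≫ X.d 0 1 = 0 := by
    have := φ.comm 0 1
    simp only [p, Category.assoc]
    rw [this, HomologicalComplex.single_obj_d, zero_comp, comp_zero]
  have hproj : Module.Projective Aᵐᵒᵖ P.obj := P.property.2
  obtain ⟨t, ht⟩ := Module.projective_lifting_property s
    (LinearMap.codRestrict Z p.hom.hom (fun x => by
      exact LinearMap.congr_fun (congrArg (fun k => k.hom.hom) hp) x)) hs
  let t' : P ⟶ freeProj A n := ObjectProperty.homMk (ModuleCat.ofHom t)
  have ht' : t' ≫ q = p := by
    refine ObjectProperty.hom_ext _ (ModuleCat.hom_ext (LinearMap.ext fun x => ?_))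
    exact congrArg Subtype.val (LinearMap.congr_fun ht x)
  refine ⟨(stalkFunctor A).map t', ObjectProperty.hom_ext _ ?_⟩
  refine Eq.trans ?_ hφ
  refine ((HomotopyCategory.quotient _ _).map_comp
    ((CochainComplex.singleFunctor (ProjCat A) 0).map t') F).symm.trans ?_
  congr 1
  apply HomologicalComplex.from_single_hom_ext
  rw [← cancel_epi (HomologicalComplex.singleObjXSelf (ComplexShape.up ℤ) 0 P).inv]
  change _ = p
  rw [← ht']
  simp [F, CochainComplex.singleFunctor, CochainComplex.singleFunctors, HomologicalComplex.single_map_f_self]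

end Stalk
end

noncomputable section

/-! ### Projective modules as stalk complexes: length, idempotents and Fitting's lemma. -/

section ProjectiveModules

variable {A : Type u} [Ring A]

/-- A linear map as a morphism of projective modules. -/
def projHom {P Q : ProjCat A} (f : P.obj →ₗ[Aᵐᵒᵖ] Q.obj) : P ⟶ Q :=
  ObjectProperty.homMk (ModuleCat.ofHom f)

/-- A linear map as a morphism of stalk complexes. -/
def stalkHom {P Q : ProjCat A} (f : P.obj →ₗ[Aᵐᵒᵖ] Q.obj) : stalk P ⟶ stalk Q :=
  (stalkFunctor A).map (projHom f)

lemma stalkHom_surjective {P Q : ProjCat A} (f : stalk P ⟶ stalk Q) :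
    ∃ g : P.obj →ₗ[Aᵐᵒᵖ] Q.obj, f = stalkHom g := by
  obtain ⟨g, rfl⟩ := (stalkFunctor A).map_surjective f
  exact ⟨g.hom.hom, rfl⟩

lemma stalkHom_injective {P Q : ProjCat A} {f g : P.obj →ₗ[Aᵐᵒᵖ] Q.obj}
    (h : stalkHom f = stalkHom g) : f = g := by
  have := (stalkFunctor A).map_injective h
  exact congrArg (fun k => k.hom.hom) this

lemma stalkHom_comp {P Q R : ProjCat A} (f : P.obj →ₗ[Aᵐᵒᵖ] Q.obj) (g : Q.obj →ₗ[Aᵐᵒᵖ] R.obj) :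
    stalkHom f ≫ stalkHom g = stalkHom (g ∘ₗ f) :=
  ((stalkFunctor A).map_comp _ _).symm

lemma stalkHom_id (P : ProjCat A) : stalkHom (LinearMap.id : P.obj →ₗ[Aᵐᵒᵖ] P.obj) = 𝟙 (stalk P) :=
  (stalkFunctor A).map_id P

lemma stalkHom_add {P Q : ProjCat A} (f g : P.obj →ₗ[Aᵐᵒᵖ] Q.obj) :
    stalkHom (f + g) = stalkHom f + stalkHom g := by
  have h : projHom (f + g) = projHom f + projHom g :=
    ObjectProperty.hom_ext _ (ModuleCat.hom_ext rfl)
  rw [stalkHom, h]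
  exact (stalkFunctor A).map_add

lemma stalkHom_zero (P Q : ProjCat A) : stalkHom (0 : P.obj →ₗ[Aᵐᵒᵖ] Q.obj) = 0 :=
  (stalkFunctor A).map_zero P Q

lemma stalkHom_sub {P Q : ProjCat A} (f g : P.obj →ₗ[Aᵐᵒᵖ] Q.obj) :
    stalkHom (f - g) = stalkHom f - stalkHom g := by
  rw [eq_sub_iff_add_eq, ← stalkHom_add, sub_add_cancel]

lemma stalkHom_sum {P Q : ProjCat A} {ι : Type*} (s : Finset ι) (f : ι → (P.obj →ₗ[Aᵐᵒᵖ] Q.obj)) :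
    stalkHom (∑ i ∈ s, f i) = ∑ i ∈ s, stalkHom (f i) := by
  classical
  induction s using Finset.induction_on with
  | empty => simp [stalkHom_zero]
  | insert a s ha ih => rw [Finset.sum_insert ha, Finset.sum_insert ha, stalkHom_add, ih]

/-- Every finitely generated projective module is a summand of a free module of finite rank. -/
lemma exists_sum_eq_id_regularObj (Q : ProjCat A) :
    ∃ (n : ℕ) (a : Fin n → (stalk Q ⟶ regularObj A)) (b : Fin n → (regularObj A ⟶ stalk Q)),
      ∑ j, a j ≫ b j = 𝟙 (stalk Q) := by
  have := Q.property.1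
  have := Q.property.2
  obtain ⟨n, s, hs⟩ := Module.Finite.exists_fin' Aᵐᵒᵖ Q.obj
  obtain ⟨t, ht⟩ := Module.projective_lifting_property s LinearMap.id hs
  let l : A ≃ₗ[Aᵐᵒᵖ] Aᵐᵒᵖ := { MulOpposite.opAddEquiv with map_smul' := fun _ _ => rfl }
  let R : ProjCat A := ⟨ModuleCat.of Aᵐᵒᵖ A, isFGProjective_self A⟩
  refine ⟨n, fun j => stalkHom (P := Q) (Q := R) (l.symm.toLinearMap ∘ₗ LinearMap.proj j ∘ₗ t),
    fun j => stalkHom (P := R) (Q := Q)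
      (s ∘ₗ LinearMap.single Aᵐᵒᵖ (fun _ => Aᵐᵒᵖ) j ∘ₗ l.toLinearMap), ?_⟩
  refine (Finset.sum_congr rfl fun j _ => stalkHom_comp (P := Q) (Q := R) (R := Q) _ _).trans ?_
  rw [← stalkHom_sum, ← stalkHom_id, ← ht]
  congr 1
  ext x
  have h1 : t x = ∑ j, Pi.single j (t x j) := (Finset.univ_sum_single _).symm
  conv_rhs => rw [LinearMap.comp_apply, h1, map_sum]
  simp only [LinearMap.sum_apply]
  rfl

/-- The length of the underlying module. -/
def projLength (Q : ProjCat A) : ℕ := (Module.length Aᵐᵒᵖ Q.obj).toNat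

variable [IsArtinianRing Aᵐᵒᵖ]

/-- Full faithfulness turns the isomorphism into one of modules, where length is additive. Length is
the measure behind the minimality arguments below, in place of Krull–Schmidt. -/
lemma projLength_add {X Y Z : ProjCat A} (e : stalk X ≅ stalk Y ⊞ stalk Z) :
    projLength X = projLength Y + projLength Z := by
  have := X.property.1
  have := Y.property.1
  have := Z.property.1
  obtain ⟨f, hf⟩ := stalkHom_surjective (e.hom ≫ biprod.fst)
  obtain ⟨g, hg⟩ := stalkHom_surjective (e.hom ≫ biprod.snd)
  obtain ⟨f', hf'⟩ := stalkHom_surjective (biprod.inl ≫ e.inv)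
  obtain ⟨g', hg'⟩ := stalkHom_surjective (biprod.inr ≫ e.inv)
  have h1 : f ∘ₗ f' = LinearMap.id := stalkHom_injective (by
    rw [← stalkHom_comp, ← hf, ← hf', stalkHom_id]; simp)
  have h2 : g ∘ₗ g' = LinearMap.id := stalkHom_injective (by
    rw [← stalkHom_comp, ← hg, ← hg', stalkHom_id]; simp)
  have h3 : g ∘ₗ f' = 0 := stalkHom_injective (by
    rw [← stalkHom_comp, ← hg, ← hf', stalkHom_zero]; simp)
  have h4 : f ∘ₗ g' = 0 := stalkHom_injective (by
    rw [← stalkHom_comp, ← hf, ← hg', stalkHom_zero]; simp)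
  have h5 : f' ∘ₗ f + g' ∘ₗ g = LinearMap.id := stalkHom_injective (by
    rw [stalkHom_add, ← stalkHom_comp, ← stalkHom_comp, ← hf, ← hf', ← hg, ← hg', stalkHom_id]
    have : e.hom ≫ (biprod.fst ≫ biprod.inl + biprod.snd ≫ biprod.inr) ≫ e.inv = 𝟙 _ := by
      rw [biprod.total]; simp
    rw [← this]
    simp only [Preadditive.add_comp, Preadditive.comp_add, Category.assoc])
  let E : X.obj ≃ₗ[Aᵐᵒᵖ] Y.obj × Z.obj := LinearEquiv.ofLinearMap (f.prod g) (f'.coprod g')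
    (by
      apply LinearMap.prod_ext
      · ext x
        · exact LinearMap.congr_fun h1 x |> fun h => by simpa using h
        · exact LinearMap.congr_fun h3 x |> fun h => by simpa using h
      · ext x
        · exact LinearMap.congr_fun h4 x |> fun h => by simpa using h
        · exact LinearMap.congr_fun h2 x |> fun h => by simpa using h)
    (by
      ext x
      exact LinearMap.congr_fun h5 x |> fun h => by simpa using h)
  rw [projLength, E.length_eq, Module.length_prod, ENat.toNat_add Module.length_ne_top
    Module.length_ne_top]
  rfl

lemma isZero_of_projLength_eq_zero {X : ProjCat A} (h : projLength X = 0) : IsZero (stalk X) := by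
  have := X.property.1
  have h1 : Module.length Aᵐᵒᵖ X.obj = 0 := by
    rw [projLength, ENat.toNat_eq_zero] at h
    exact h.resolve_right Module.length_ne_top
  rw [Module.length_eq_zero_iff] at h1
  rw [IsZero.iff_id_eq_zero, ← stalkHom_id, ← stalkHom_zero]
  congr 1
  ext x
  exact Subsingleton.elim _ _

omit [IsArtinianRing Aᵐᵒᵖ] in
/-- Idempotents split. -/
lemma exists_split_idempotent {Q : ProjCat A} (q : stalk Q ⟶ stalk Q) (hq : q ≫ q = q) :
    ∃ (R : ProjCat A) (i : stalk R ⟶ stalk Q) (r : stalk Q ⟶ stalk R),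
      i ≫ r = 𝟙 _ ∧ r ≫ i = q := by
  obtain ⟨f, rfl⟩ := stalkHom_surjective q
  rw [stalkHom_comp] at hq
  have hf := stalkHom_injective hq
  have := Q.property.1
  have := Q.property.2
  have hr : f.rangeRestrict ∘ₗ (LinearMap.range f).subtype = LinearMap.id := by
    ext ⟨_, x, rfl⟩
    exact LinearMap.congr_fun hf x
  let R : ProjCat A := ⟨ModuleCat.of Aᵐᵒᵖ (LinearMap.range f),
    inferInstanceAs (Module.Finite Aᵐᵒᵖ (LinearMap.range f)),
    Module.Projective.of_split (LinearMap.range f).subtype f.rangeRestrict hr⟩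
  refine ⟨R, stalkHom (P := R) (Q := Q) (LinearMap.range f).subtype,
    stalkHom (P := Q) (Q := R) f.rangeRestrict, ?_, ?_⟩
  · rw [stalkHom_comp, ← stalkHom_id]
    exact congrArg _ hr
  · rw [stalkHom_comp]
    rfl

/-- Fitting's lemma. -/
lemma Module.End.exists_fitting {R M : Type*} [Ring R] [AddCommGroup M] [Module R M]
    [IsArtinian R M] [IsNoetherian R M] (f : Module.End R M) :
    ∃ (n : ℕ) (p : Module.End R M), p * p = p ∧ p * f ^ n = f ^ n ∧ f ^ n * p = f ^ n ∧
      (p = 1 → IsUnit f) := by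
  obtain ⟨n, hn⟩ := Filter.eventually_atTop.1 f.eventually_isCompl_ker_pow_range_pow
  -- A positive exponent is taken so that surjectivity of the power passes to `f`.
  specialize hn (n + 1) (by omega)
  set F := f ^ (n + 1) with hF
  let p := (LinearMap.range F).projection (LinearMap.ker F) hn.symm
  have hp : ∀ x ∈ LinearMap.range F, p x = x := fun x hx =>
    Submodule.projection_apply_of_mem_left hn.symm hx
  have hmem : ∀ x, p x ∈ LinearMap.range F := Submodule.projection_apply_mem hn.symm
  refine ⟨n + 1, p, LinearMap.ext fun x => hp _ (hmem x), LinearMap.ext fun x => hp _ ⟨x, rfl⟩,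
    LinearMap.ext fun x => ?_, fun h => ?_⟩
  · have : x - p x ∈ LinearMap.ker F := by
      rw [← Submodule.projection_apply_eq_zero_iff hn.symm, map_sub]
      exact sub_eq_zero.2 (hp _ (hmem x)).symm
    rw [LinearMap.mem_ker, map_sub, sub_eq_zero] at this
    exact this.symm
  · have hr : LinearMap.range F = ⊤ := by
      rw [eq_top_iff]
      intro x _
      have := hmem x
      rwa [h] at this
    have hs : Function.Surjective f := by
      intro x
      obtain ⟨y, hy⟩ := LinearMap.range_eq_top.1 hr x
      exact ⟨(f ^ n) y, by rw [← hy, hF, pow_succ']; rfl⟩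
    exact (Module.End.isUnit_iff f).2 (IsNoetherian.bijective_of_surjective_endomorphism f hs)

/-- Fitting's lemma for stalk complexes. -/
lemma exists_fitting {Q : ProjCat A} (h : stalk Q ⟶ stalk Q) :
    ∃ p : stalk Q ⟶ stalk Q, p ≫ p = p ∧
      (∀ (X : PerfCat A) (f : X ⟶ stalk Q), f ≫ h = f → f ≫ p = f) ∧
      (∀ (X : PerfCat A) (f : stalk Q ⟶ X), h ≫ f = f → p ≫ f = f) ∧
      (p = 𝟙 _ → IsIso h) ∧ (p = 0 → IsIso (𝟙 _ - h)) := by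
  have := Q.property.1
  obtain ⟨f, rfl⟩ := stalkHom_surjective h
  have hiso : ∀ f : Module.End Aᵐᵒᵖ Q.obj, IsUnit f → IsIso (stalkHom (P := Q) (Q := Q) f) := by
    rintro _ ⟨u, rfl⟩
    refine ⟨stalkHom (P := Q) (Q := Q) (↑u⁻¹ : Module.End Aᵐᵒᵖ Q.obj), ?_, ?_⟩
    · rw [stalkHom_comp, ← stalkHom_id]
      exact congrArg stalkHom u.inv_mul
    · rw [stalkHom_comp, ← stalkHom_id]
      exact congrArg stalkHom u.mul_inv
  obtain ⟨n, p, h1, h2, h3, h4⟩ := Module.End.exists_fitting f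
  -- A morphism fixed by `f` is fixed by `f ^ n`, and the Fitting idempotent absorbs `f ^ n` on
  -- either side.
  have hl : ∀ (X : PerfCat A) (g : X ⟶ stalk Q), g ≫ stalkHom f = g → ∀ n : ℕ,
      g ≫ stalkHom (P := Q) (Q := Q) (f ^ n) = g := by
    intro X g hg n
    induction n with
    | zero => exact (congrArg (g ≫ ·) (stalkHom_id Q)).trans (Category.comp_id g)
    | succ n ih =>
      rw [pow_succ]
      refine (congrArg (g ≫ ·) (stalkHom_comp f (f ^ n)).symm).trans ?_
      rw [← Category.assoc, hg, ih]
  have hr : ∀ (X : PerfCat A) (g : stalk Q ⟶ X), stalkHom f ≫ g = g → ∀ n : ℕ,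
      stalkHom (P := Q) (Q := Q) (f ^ n) ≫ g = g := by
    intro X g hg n
    induction n with
    | zero => exact (congrArg (· ≫ g) (stalkHom_id Q)).trans (Category.id_comp g)
    | succ n ih =>
      rw [pow_succ]
      refine (congrArg (· ≫ g) (stalkHom_comp f (f ^ n)).symm).trans ?_
      rw [Category.assoc, ih, hg]
  refine ⟨stalkHom (P := Q) (Q := Q) p, ?_, fun X g hg => ?_, fun X g hg => ?_, fun hp => ?_,
    fun hp => ?_⟩
  · rw [stalkHom_comp]
    exact congrArg stalkHom h1
  · have h5 := hl X g hg n
    rw [← h5, Category.assoc, stalkHom_comp]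
    exact congrArg (fun k => g ≫ stalkHom k) h2
  · have h5 := hr X g hg n
    rw [← h5, ← Category.assoc, stalkHom_comp]
    exact congrArg (fun k => stalkHom k ≫ g) h3
  · rw [← stalkHom_id] at hp
    exact hiso f (h4 (stalkHom_injective hp))
  · rw [← stalkHom_zero] at hp
    have hp0 := stalkHom_injective hp
    -- A zero Fitting idempotent means that `f` is nilpotent.
    rw [hp0, zero_mul] at h2
    rw [← stalkHom_id, ← stalkHom_sub]
    exact hiso _ (IsNilpotent.isUnit_one_sub ⟨n, h2.symm⟩)

/-- An object with local endomorphism ring. -/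
def HasLocalEnd {C : Type*} [Category* C] [Preadditive C] (P : C) : Prop :=
  ¬ IsZero P ∧ ∀ a b : P ⟶ P, a + b = 𝟙 P → IsIso a ∨ IsIso b

/-- The projective module of a primitive idempotent has a local endomorphism ring. -/
lemma hasLocalEnd_idempotentObj {e : A} (he : IsPrimitiveIdempotent e) :
    HasLocalEnd (idempotentObj e he.1) := by
  let E : Submodule Aᵐᵒᵖ A := Submodule.span Aᵐᵒᵖ {e}
  let P : ProjCat A := ⟨ModuleCat.of Aᵐᵒᵖ E, isFGProjective_span he.1⟩
  let e' : E := ⟨e, Submodule.mem_span_singleton_self e⟩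
  have hE : ∀ x : E, e * (x : A) = x ∧ x = MulOpposite.op (x : A) • e' := by
    intro x
    obtain ⟨a, ha⟩ := Submodule.mem_span_singleton.1 x.2
    have : e * (x : A) = x := by
      rw [← ha]
      change e * (e * a.unop) = e * a.unop
      rw [← mul_assoc, he.1.eq]
    exact ⟨this, Subtype.ext this.symm⟩
  have hext : ∀ f g : E →ₗ[Aᵐᵒᵖ] E, f e' = g e' → f = g := by
    intro f g h
    ext x
    rw [(hE x).2, map_smul, map_smul, h]
  -- An idempotent endomorphism `q` of `eA` is left multiplication by the idempotent `q e` of `eAe`,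
  -- and primitivity leaves only `0` and `e`.
  have hidem : ∀ q : E →ₗ[Aᵐᵒᵖ] E, q ∘ₗ q = q → q = 0 ∨ q = LinearMap.id := by
    intro q hq
    have happ : ∀ (r : E →ₗ[Aᵐᵒᵖ] E) (x : E), ((r e' : E) : A) * (x : A) = r x := by
      intro r x
      conv_rhs => rw [(hE x).2, map_smul]
      rfl
    have h1 : ((q e' : E) : A) * (q e' : E) = (q e' : E) := by
      rw [happ]
      exact congrArg Subtype.val (LinearMap.congr_fun hq e')
    have h2 : ((q e' : E) : A) * e = (q e' : E) := happ q e'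
    have h3 := (hE (q e')).1
    rcases he.2.2 (q e' : E) (e - (q e' : E)) h1
      (by
        change _ * _ = _
        rw [sub_mul, mul_sub, mul_sub, h1, h2, h3, he.1.eq, sub_self, sub_zero])
      (by rw [mul_sub, h1, h2, sub_self]) (by rw [sub_mul, h1, h3, sub_self])
      (by rw [add_sub_cancel]) with h | h
    · left
      exact hext _ _ (Subtype.ext h)
    · right
      exact hext _ _ (Subtype.ext (sub_eq_zero.1 h).symm)
  refine ⟨fun h => ?_, fun a b hab => ?_⟩
  · have h1 := (IsZero.iff_id_eq_zero _).1 h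
    have h2 : stalkHom (P := P) (Q := P) LinearMap.id = stalkHom (P := P) (Q := P) 0 := by
      rw [stalkHom_zero, stalkHom_id]
      exact h1
    have h3 := stalkHom_injective h2
    exact he.2.1 (congrArg Subtype.val (LinearMap.congr_fun h3 e'))
  -- The Fitting idempotent of `a` is `0` or the identity: then `b = 1 - a`, respectively `a`, is
  -- invertible.
  · obtain ⟨p, hp, -, -, h1, h2⟩ := exists_fitting (Q := P) a
    obtain ⟨q, rfl⟩ := stalkHom_surjective p
    rw [stalkHom_comp] at hp
    rcases hidem q (stalkHom_injective hp) with rfl | rfl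
    · right
      rw [eq_sub_iff_add_eq'.2 hab]
      exact h2 (stalkHom_zero _ _)
    · left
      exact h1 (stalkHom_id _)

end ProjectiveModules

/-! ### Finite generation of morphism spaces. -/

section FiniteHom

/-- Morphisms between projective modules are generated by finitely many, both over the
endomorphisms of the source and over those of the target. -/
lemma exists_hom_generators {A : Type u} [Ring A] (K : Type v) [Field K] [Algebra K A]
    [FiniteDimensional K A] (P Q : ProjCat A) :
    ∃ (n : ℕ) (f : Fin n → (stalk P ⟶ stalk Q)), ∀ g : stalk P ⟶ stalk Q,
      (∃ c : Fin n → (stalk P ⟶ stalk P), g = ∑ i, c i ≫ f i) ∧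
      (∃ c : Fin n → (stalk Q ⟶ stalk Q), g = ∑ i, f i ≫ c i) := by
  have := P.property.1
  have := Q.property.1
  let _ : Module K P.obj := Module.compHom _ (algebraMap K Aᵐᵒᵖ)
  let _ : Module K Q.obj := Module.compHom _ (algebraMap K Aᵐᵒᵖ)
  have : IsScalarTower K Aᵐᵒᵖ P.obj := .of_algebraMap_smul fun r x => rfl
  have : IsScalarTower K Aᵐᵒᵖ Q.obj := .of_algebraMap_smul fun r x => rfl
  have : SMulCommClass Aᵐᵒᵖ K P.obj := IsScalarTower.to_smulCommClass'
  have : SMulCommClass Aᵐᵒᵖ K Q.obj := IsScalarTower.to_smulCommClass'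
  have : Module.Finite K Aᵐᵒᵖ := Module.Finite.equiv (MulOpposite.opLinearEquiv K)
  have : Module.Finite K P.obj := Module.Finite.trans Aᵐᵒᵖ P.obj
  have : Module.Finite K Q.obj := Module.Finite.trans Aᵐᵒᵖ Q.obj
  have : Module.Finite K (P.obj →ₗ[Aᵐᵒᵖ] Q.obj) :=
    Module.Finite.of_injective (LinearMap.restrictScalarsₗ K Aᵐᵒᵖ P.obj Q.obj K)
      (LinearMap.restrictScalars_injective K)
  -- One spanning family over `K` serves both sides, because scalars act through endomorphisms of
  -- the source as well as of the target.
  obtain ⟨n, s, hs⟩ := Module.Finite.exists_fin' K (P.obj →ₗ[Aᵐᵒᵖ] Q.obj)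
  refine ⟨n, fun i => stalkHom (s (Pi.single i 1)), fun g => ?_⟩
  obtain ⟨g, rfl⟩ := stalkHom_surjective g
  obtain ⟨c, rfl⟩ := hs g
  have h1 : s c = ∑ i, c i • s (Pi.single i 1) := by
    conv_lhs => rw [← Finset.univ_sum_single c, map_sum]
    refine Finset.sum_congr rfl fun i _ => ?_
    rw [← map_smul, ← Pi.single_smul, smul_eq_mul, mul_one]
  constructor
  · refine ⟨fun i => stalkHom (c i • LinearMap.id), ?_⟩
    simp_rw [stalkHom_comp]
    rw [← stalkHom_sum, h1]
    congr 1
    refine Finset.sum_congr rfl fun i _ => ?_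
    ext x
    exact (LinearMap.map_smul_of_tower (s (Pi.single i 1)) (c i) x).symm
  · refine ⟨fun i => stalkHom (c i • LinearMap.id), ?_⟩
    simp_rw [stalkHom_comp]
    rw [← stalkHom_sum, h1]
    congr 1

end FiniteHom
end

noncomputable section

/-! ### Objects with local endomorphism ring. -/

section LocalEnd

variable {C : Type u} [Category.{v} C] [Preadditive C]

/-- Composing with the inverse of the sum writes the identity as a sum of two endomorphisms, so
locality peels off one term at a time; the empty sum would force `P` to be zero. -/
lemma HasLocalEnd.exists_isIso_of_isIso_sum {P : C} (hP : HasLocalEnd P) {ι : Type*}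
    (s : Finset ι) (f : ι → (P ⟶ P)) (h : IsIso (∑ i ∈ s, f i)) : ∃ i ∈ s, IsIso (f i) := by
  classical
  induction s using Finset.induction_on with
  | empty =>
    rw [Finset.sum_empty] at h
    refine absurd ?_ hP.1
    rw [IsZero.iff_id_eq_zero, ← IsIso.hom_inv_id (0 : P ⟶ P), zero_comp]
  | insert a s ha ih =>
    rw [Finset.sum_insert ha] at h
    have h1 : f a ≫ inv (f a + ∑ i ∈ s, f i) + (∑ i ∈ s, f i) ≫ inv (f a + ∑ i ∈ s, f i) = 𝟙 P := by
      rw [← Preadditive.add_comp, IsIso.hom_inv_id]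
    rcases hP.2 _ _ h1 with h2 | h2
    · exact ⟨a, Finset.mem_insert_self _ _, IsIso.of_isIso_comp_right _ (inv (f a + ∑ i ∈ s, f i))⟩
    · have h3 : IsIso (∑ i ∈ s, f i) :=
        IsIso.of_isIso_comp_right _ (inv (f a + ∑ i ∈ s, f i))
      obtain ⟨i, hi, hi'⟩ := ih h3
      exact ⟨i, Finset.mem_insert_of_mem hi, hi'⟩

lemma HasLocalEnd.isIso_or_isIso_one_sub {P : C} (hP : HasLocalEnd P) (a : P ⟶ P) :
    IsIso a ∨ IsIso (𝟙 P - a) :=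
  hP.2 _ _ (add_sub_cancel _ _)

/-- The inverse is `1 + a(1 - ba)⁻¹b`, as for Jacobson radicals. -/
lemma isIso_one_sub_comp_swap {X Y : C} (a : X ⟶ Y) (b : Y ⟶ X) (h : IsIso (𝟙 Y - b ≫ a)) :
    IsIso (𝟙 X - a ≫ b) := by
  obtain ⟨t, h1, h2⟩ := h.out
  simp only [Preadditive.sub_comp, Preadditive.comp_sub, Category.id_comp, Category.comp_id,
    Category.assoc] at h1 h2
  have h1' : b ≫ a ≫ t = t - 𝟙 Y := by rw [← h1]; abel
  have h2' : t ≫ b ≫ a = t - 𝟙 Y := by rw [← h2]; abel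
  refine ⟨𝟙 X + a ≫ t ≫ b, ?_, ?_⟩
  · simp only [Preadditive.sub_comp, Preadditive.comp_add, Category.id_comp, Category.comp_id,
      Category.assoc]
    have : a ≫ b ≫ a ≫ t ≫ b = a ≫ (t - 𝟙 Y) ≫ b := by rw [← h1']; simp
    rw [this]
    simp only [Preadditive.sub_comp, Preadditive.comp_sub, Category.id_comp]
    abel
  · simp only [Preadditive.add_comp, Preadditive.comp_sub, Category.id_comp, Category.comp_id,
      Category.assoc]
    have : a ≫ t ≫ b ≫ a ≫ b = a ≫ (t - 𝟙 Y) ≫ b := by rw [← h2']; simp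
    rw [this]
    simp only [Preadditive.sub_comp, Preadditive.comp_sub, Category.id_comp]
    abel

/-- If `P` is not a summand of `X`, endomorphisms of `X` that factor through copies of `P` are
radical. The induction extracts the invertible factor `1 - S`; swapping the factors of the remaining
term moves the question to `End P`. -/
lemma HasLocalEnd.isIso_one_sub_sum {P X : C} (hP : HasLocalEnd P)
    (h : ∀ (i : P ⟶ X) (r : X ⟶ P), ¬ IsIso (i ≫ r)) {ι : Type*} (s : Finset ι)
    (a : ι → (X ⟶ P)) (b : ι → (P ⟶ X)) : IsIso (𝟙 X - ∑ j ∈ s, a j ≫ b j) := by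
  classical
  induction s using Finset.induction_on with
  | empty =>
    rw [Finset.sum_empty, sub_zero]
    infer_instance
  | insert k s hk ih =>
    rw [Finset.sum_insert hk]
    set S := ∑ j ∈ s, a j ≫ b j with hS
    have h1 : IsIso (𝟙 X - (inv (𝟙 X - S) ≫ a k) ≫ b k) :=
      isIso_one_sub_comp_swap _ _
        ((hP.isIso_or_isIso_one_sub (b k ≫ inv (𝟙 X - S) ≫ a k)).resolve_left (h _ _))
    have h2 : 𝟙 X - (a k ≫ b k + S) = (𝟙 X - S) ≫ (𝟙 X - (inv (𝟙 X - S) ≫ a k) ≫ b k) := by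
      rw [Preadditive.comp_sub, Category.comp_id, Category.assoc, IsIso.hom_inv_id_assoc]
      abel
    rw [h2]
    infer_instance

end LocalEnd

/-! ### The additive closure of an object. -/

section AddClosure

variable {C : Type u} [Category.{v} C] [HasZeroObject C] [HasShift C ℤ] [Preadditive C]
  [∀ n : ℤ, (shiftFunctor C n).Additive] [Pretriangulated C]

/-- A split monomorphism has a complement: the connecting morphism of its triangle is killed by the
split monomorphism `i[1]`, hence vanishes, and the triangle splits. -/
lemma exists_iso_biprod_of_retract {X Z : C} (i : X ⟶ Z) (r : Z ⟶ X) (h : i ≫ r = 𝟙 X) :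
    ∃ (Y : C) (e : Z ≅ X ⊞ Y), i ≫ e.hom = biprod.inl := by
  obtain ⟨Y, g, d, hT⟩ := distinguished_cocone_triangle i
  have hd : d = 0 := by
    have h1 : d ≫ i⟦(1 : ℤ)⟧' = 0 := comp_distTriang_mor_zero₃₁ _ hT
    have h2 : i⟦(1 : ℤ)⟧' ≫ r⟦(1 : ℤ)⟧' = 𝟙 _ := by
      rw [← Functor.map_comp, h, CategoryTheory.Functor.map_id]
    rw [← Category.comp_id d, ← h2, reassoc_of% h1, zero_comp]
  obtain ⟨e, he, -⟩ := exists_iso_binaryBiproduct_of_distTriang _ hT hd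
  exact ⟨Y, e, he⟩

lemma addClosure_of_sum {M X : C} {ι : Type} [Fintype ι] (a : ι → (X ⟶ M))
    (b : ι → (M ⟶ X)) (h : ∑ j, a j ≫ b j = 𝟙 X) : addClosure M X := by
  let e := Fintype.equivFin ι
  obtain ⟨Y, f, -⟩ := exists_iso_biprod_of_retract
    (biproduct.lift fun j : Fin (Fintype.card ι) => a (e.symm j))
    (biproduct.desc fun j => b (e.symm j))
    (by rw [biproduct.lift_desc, ← h]; exact Equiv.sum_comp e.symm (fun j => a j ≫ b j))
  exact ⟨_, Y, ⟨f.symm⟩⟩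

/-- This form involves only sums of composites, so additive functors of either variance preserve it.
-/
lemma addClosure_iff (M X : C) : addClosure M X ↔ ∃ (n : ℕ) (a : Fin n → (X ⟶ M))
    (b : Fin n → (M ⟶ X)), ∑ j, a j ≫ b j = 𝟙 X := by
  constructor
  · rintro ⟨n, Y, ⟨e⟩⟩
    refine ⟨n, fun j => biprod.inl ≫ e.hom ≫ biproduct.π _ j,
      fun j => biproduct.ι (fun _ : Fin n => M) j ≫ e.inv ≫ biprod.fst, ?_⟩
    have h : biprod.inl ≫ e.hom ≫ (∑ j, biproduct.π (fun _ : Fin n => M) j ≫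
        biproduct.ι (fun _ : Fin n => M) j) ≫ e.inv ≫ biprod.fst = 𝟙 X := by
      rw [biproduct.total]; simp
    rw [← h]
    simp only [Preadditive.comp_sum, Preadditive.sum_comp, Category.assoc]
  · rintro ⟨n, a, b, h⟩
    exact addClosure_of_sum a b h

lemma addClosure_self (M : C) : addClosure M M :=
  addClosure_of_sum (ι := Unit) (fun _ => 𝟙 M) (fun _ => 𝟙 M) (by simp)

lemma addClosure_of_retract {M X Y : C} (i : X ⟶ Y) (r : Y ⟶ X) (h : i ≫ r = 𝟙 X)
    (hY : addClosure M Y) : addClosure M X := by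
  obtain ⟨n, a, b, hab⟩ := (addClosure_iff _ _).1 hY
  refine addClosure_of_sum (fun j => i ≫ a j) (fun j => b j ≫ r) ?_
  have : i ≫ (∑ j, a j ≫ b j) ≫ r = 𝟙 X := by rw [hab, Category.id_comp, h]
  rw [← this]
  simp [Preadditive.comp_sum, Preadditive.sum_comp]

lemma addClosure_of_iso {M X Y : C} (e : X ≅ Y) (hY : addClosure M Y) : addClosure M X :=
  addClosure_of_retract e.hom e.inv e.hom_inv_id hY

lemma addClosure_trans {M N X : C} (hX : addClosure N X) (hN : addClosure M N) :
    addClosure M X := by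
  obtain ⟨n, a, b, hab⟩ := (addClosure_iff _ _).1 hX
  obtain ⟨m, c, d, hcd⟩ := (addClosure_iff _ _).1 hN
  refine addClosure_of_sum (ι := Fin n × Fin m) (fun j => a j.1 ≫ c j.2)
    (fun j => d j.2 ≫ b j.1) ?_
  rw [← hab, Fintype.sum_prod_type]
  refine Finset.sum_congr rfl fun j _ => ?_
  rw [← Category.id_comp (b j), ← hcd]
  simp [Preadditive.comp_sum, Preadditive.sum_comp]

lemma addClosure_biprod_left (M N : C) : addClosure (M ⊞ N) M :=
  addClosure_of_retract biprod.inl biprod.fst (by simp) (addClosure_self _)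

lemma addClosure_biprod_right (M N : C) : addClosure (M ⊞ N) N :=
  addClosure_of_retract biprod.inr biprod.snd (by simp) (addClosure_self _)

lemma addClosure_biprod {B M N : C} (hM : addClosure B M) (hN : addClosure B N) :
    addClosure B (M ⊞ N) := by
  obtain ⟨n, a, b, hab⟩ := (addClosure_iff _ _).1 hM
  obtain ⟨m, c, d, hcd⟩ := (addClosure_iff _ _).1 hN
  refine addClosure_of_sum (ι := Fin n ⊕ Fin m)
    (Sum.elim (fun j => biprod.fst ≫ a j) (fun j => biprod.snd ≫ c j))
    (Sum.elim (fun j => b j ≫ biprod.inl) (fun j => d j ≫ biprod.inr)) ?_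
  have : biprod.fst ≫ (∑ j, a j ≫ b j) ≫ biprod.inl +
      biprod.snd ≫ (∑ j, c j ≫ d j) ≫ biprod.inr = 𝟙 (M ⊞ N) := by
    rw [hab, hcd]; simp
  rw [← this]
  simp [Preadditive.comp_sum, Preadditive.sum_comp]

/-- Expanding the identity of `N` through copies of `M` makes an isomorphism of `P` a finite sum; by
locality one term is already invertible. -/
lemma HasLocalEnd.exists_retract_of_addClosure {P M N : C} (hP : HasLocalEnd P)
    (hN : addClosure M N) (i : P ⟶ N) (r : N ⟶ P) (h : IsIso (i ≫ r)) :
    ∃ (i' : P ⟶ M) (r' : M ⟶ P), i' ≫ r' = 𝟙 P := by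
  obtain ⟨n, a, b, hab⟩ := (addClosure_iff _ _).1 hN
  have h1 : ∑ j, (i ≫ a j) ≫ (b j ≫ r) = i ≫ r := by
    have h0 : i ≫ (∑ j, a j ≫ b j) ≫ r = i ≫ r := by rw [hab, Category.id_comp]
    rw [← h0]
    simp only [Preadditive.comp_sum, Preadditive.sum_comp, Category.assoc]
  obtain ⟨j, -, hj⟩ := hP.exists_isIso_of_isIso_sum Finset.univ
    (fun j => (i ≫ a j) ≫ (b j ≫ r)) (by rw [h1]; exact h)
  exact ⟨i ≫ a j, (b j ≫ r) ≫ inv ((i ≫ a j) ≫ (b j ≫ r)), by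
    rw [← Category.assoc, IsIso.hom_inv_id]⟩

/-- In a basic object `P ⊞ M`, the summand `P` does not occur in `add M`. -/
lemma HasLocalEnd.not_isIso_of_isBasic {B P M N : C} (hP : HasLocalEnd P) (hB : IsBasic B)
    (e : B ≅ P ⊞ M) (hN : addClosure M N) (i : P ⟶ N) (r : N ⟶ P) : ¬ IsIso (i ≫ r) := by
  intro h
  obtain ⟨i', r', h'⟩ := hP.exists_retract_of_addClosure hN i r h
  obtain ⟨Y, f, -⟩ := exists_iso_biprod_of_retract i' r' h'
  exact hP.1 (hB P Y ⟨e ≪≫ biprod.mapIso (Iso.refl P) f ≪≫ (biprod.associator P P Y).symm⟩)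

/-- An object of `add (P ⊞ M)` has `P` as a summand, or lies in `add M`. -/
lemma HasLocalEnd.exists_retract_or_addClosure {B P M X : C} (hP : HasLocalEnd P)
    (e : B ≅ P ⊞ M) (hX : addClosure B X) :
    (∃ (i : P ⟶ X) (r : X ⟶ P), i ≫ r = 𝟙 P) ∨ addClosure M X := by
  by_cases h : ∀ (i : P ⟶ X) (r : X ⟶ P), ¬ IsIso (i ≫ r)
  · right
    obtain ⟨n, a, b, hab⟩ := (addClosure_iff _ _).1 hX
    -- The part of the identity of `X` that passes through `P` is radical, so the part through `M`
    -- is invertible and exhibits `X` in `add M`.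
    have h1 := hP.isIso_one_sub_sum h Finset.univ (fun j => a j ≫ e.hom ≫ biprod.fst)
      (fun j => biprod.inl ≫ e.inv ≫ b j)
    have h2 : 𝟙 X - ∑ j, (a j ≫ e.hom ≫ biprod.fst) ≫ (biprod.inl ≫ e.inv ≫ b j) =
        ∑ j, (a j ≫ e.hom ≫ biprod.snd) ≫ (biprod.inr ≫ e.inv ≫ b j) := by
      rw [sub_eq_iff_eq_add, ← Finset.sum_add_distrib, ← hab]
      refine Finset.sum_congr rfl fun j _ => ?_
      have h3 : a j ≫ e.hom ≫ (biprod.fst ≫ biprod.inl + biprod.snd ≫ biprod.inr) ≫ e.inv ≫ b j =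
          a j ≫ b j := by
        rw [biprod.total]; simp
      rw [← h3]
      simp only [Preadditive.add_comp, Preadditive.comp_add, Category.assoc]
      abel
    rw [h2] at h1
    refine addClosure_of_sum (fun j => a j ≫ e.hom ≫ biprod.snd)
      (fun j => (biprod.inr ≫ e.inv ≫ b j) ≫
        inv (∑ j, (a j ≫ e.hom ≫ biprod.snd) ≫ (biprod.inr ≫ e.inv ≫ b j))) ?_
    simp_rw [← Category.assoc]
    rw [← Preadditive.sum_comp]
    simp_rw [Category.assoc] at h1 ⊢
    exact IsIso.hom_inv_id _
  · left
    push Not at h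
    obtain ⟨i, r, h⟩ := h
    exact ⟨i, r ≫ inv (i ≫ r), by rw [← Category.assoc, IsIso.hom_inv_id]⟩

end AddClosure

/-! ### The additive closure of the regular module. -/

section Stalk

variable {A : Type u} [Ring A]

lemma addClosure_regularObj_stalk (Q : ProjCat A) : addClosure (regularObj A) (stalk Q) := by
  obtain ⟨n, a, b, h⟩ := exists_sum_eq_id_regularObj Q
  exact addClosure_of_sum a b h

/-- The idempotent `r ≫ i` already splits among projective modules, and two splittings of one
idempotent are isomorphic. -/
lemma exists_iso_stalk_of_retract {X : PerfCat A} {Q : ProjCat A} (i : X ⟶ stalk Q)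
    (r : stalk Q ⟶ X) (h : i ≫ r = 𝟙 X) : ∃ R : ProjCat A, Nonempty (X ≅ stalk R) := by
  obtain ⟨R, j, s, h1, h2⟩ := exists_split_idempotent (r ≫ i) (by simp [reassoc_of% h])
  refine ⟨R, ⟨⟨i ≫ s, j ≫ r, ?_, ?_⟩⟩⟩
  · rw [Category.assoc, reassoc_of% h2, h, Category.comp_id, h]
  · rw [Category.assoc, ← Category.assoc r, ← h2, Category.assoc, h1, Category.comp_id, h1]

/-- The additive closure of `A` consists of the stalk complexes. -/
lemma addClosure_regularObj_iff (X : PerfCat A) :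
    addClosure (regularObj A) X ↔ ∃ Q : ProjCat A, Nonempty (X ≅ stalk Q) := by
  constructor
  · intro h
    obtain ⟨n, a, b, hab⟩ := (addClosure_iff _ _).1 h
    let l : A ≃ₗ[Aᵐᵒᵖ] Aᵐᵒᵖ := { MulOpposite.opAddEquiv with map_smul' := fun _ _ => rfl }
    let R : ProjCat A := ⟨ModuleCat.of Aᵐᵒᵖ A, isFGProjective_self A⟩
    let c : Fin n → (regularObj A ⟶ stalk (freeProj A n)) := fun j =>
      stalkHom (P := R) (Q := freeProj A n)
        (LinearMap.single Aᵐᵒᵖ (fun _ => Aᵐᵒᵖ) j ∘ₗ l.toLinearMap)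
    let d : Fin n → (stalk (freeProj A n) ⟶ regularObj A) := fun j =>
      stalkHom (P := freeProj A n) (Q := R) (l.symm.toLinearMap ∘ₗ LinearMap.proj j)
    have hcd : ∀ j k, c j ≫ d k = if j = k then 𝟙 _ else 0 := by
      intro j k
      refine (stalkHom_comp (P := R) (Q := freeProj A n) (R := R) _ _).trans ?_
      split_ifs with hjk
      · subst hjk
        refine Eq.trans (congrArg stalkHom ?_) (stalkHom_id R)
        refine LinearMap.ext fun x => ?_
        change l.symm ((Pi.single j (l x) : Fin n → Aᵐᵒᵖ) j) = x
        rw [Pi.single_eq_same, LinearEquiv.symm_apply_apply]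
      · refine Eq.trans (congrArg stalkHom ?_) (stalkHom_zero R R)
        refine LinearMap.ext fun x => ?_
        change l.symm ((Pi.single j (l x) : Fin n → Aᵐᵒᵖ) k) = 0
        rw [Pi.single_eq_of_ne (Ne.symm hjk), map_zero]
    refine exists_iso_stalk_of_retract (∑ j, a j ≫ c j) (∑ j, d j ≫ b j) ?_
    rw [Preadditive.sum_comp]
    simp_rw [Preadditive.comp_sum, Category.assoc]
    rw [← hab]
    refine Finset.sum_congr rfl fun j _ => ?_
    rw [Finset.sum_eq_single j]
    · rw [← Category.assoc (c j), hcd, if_pos rfl, Category.id_comp]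
    · intro k _ hk
      rw [← Category.assoc (c j), hcd, if_neg (Ne.symm hk), zero_comp, comp_zero]
    · simp
  · rintro ⟨Q, ⟨e⟩⟩
    exact addClosure_of_iso e (addClosure_regularObj_stalk Q)

end Stalk
end

noncomputable section

/-! ### Shifts, the silting order and exactness of triangles. -/

section Shift

variable {C : Type u} [Category.{v} C] [HasShift C ℤ]

lemma exists_iso_shift (n : ℤ) (N : C) : ∃ N' : C, Nonempty (N'⟦n⟧ ≅ N) :=
  ⟨_, ⟨(shiftFunctor C n).objObjPreimageIso N⟩⟩

variable [Preadditive C]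

lemma siltingGE_shift_one_iff {X Y : C} :
    SiltingGE X (Y⟦(1 : ℤ)⟧) ↔ ∀ i : ℤ, 1 < i → ∀ f : X ⟶ Y⟦i⟧, f = 0 := by
  constructor
  · intro H i hi f
    have h1 := H (i - 1) (by omega) (f ≫ (shiftFunctorAdd' C 1 (i - 1) i (by omega)).hom.app Y)
    rwa [Preadditive.IsIso.comp_right_eq_zero] at h1
  · intro H i hi f
    have h1 := H (1 + i) (by omega) (f ≫ (shiftFunctorAdd' C 1 i (1 + i) rfl).inv.app Y)
    rwa [Preadditive.IsIso.comp_right_eq_zero] at h1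

variable [∀ n : ℤ, (shiftFunctor C n).Additive]

lemma forall_hom_shift_eq_zero_iff {X Y : C} {i n k : ℤ} (h : i + n = k) :
    (∀ f : X ⟶ Y⟦i⟧, f = 0) ↔ ∀ f : X⟦n⟧ ⟶ Y⟦k⟧, f = 0 := by
  constructor
  · intro H f
    obtain ⟨g, hg⟩ := (shiftFunctor C n).map_surjective
      (f ≫ (shiftFunctorAdd' C i n k h).hom.app Y)
    rw [H g, Functor.map_zero] at hg
    rwa [eq_comm, Preadditive.IsIso.comp_right_eq_zero] at hg
  · intro H f
    have h1 := H (f⟦n⟧' ≫ (shiftFunctorAdd' C i n k h).inv.app Y)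
    rw [Preadditive.IsIso.comp_right_eq_zero] at h1
    exact (shiftFunctor C n).map_injective (h1.trans (Functor.map_zero _ _ _).symm)

lemma siltingGE_shift_shift_iff {X Y : C} (n : ℤ) :
    SiltingGE (X⟦n⟧) (Y⟦n⟧) ↔ SiltingGE X Y := by
  have key : ∀ i : ℤ, (∀ f : X⟦n⟧ ⟶ (Y⟦n⟧)⟦i⟧, f = 0) ↔ ∀ f : X ⟶ Y⟦i⟧, f = 0 := by
    intro i
    rw [forall_hom_shift_eq_zero_iff (X := X) (Y := Y) (show i + n = n + i from add_comm _ _)]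
    constructor
    · intro H f
      have h1 := H (f ≫ (shiftFunctorAdd' C n i (n + i) rfl).hom.app Y)
      rwa [Preadditive.IsIso.comp_right_eq_zero] at h1
    · intro H f
      have h1 := H (f ≫ (shiftFunctorAdd' C n i (n + i) rfl).inv.app Y)
      rwa [Preadditive.IsIso.comp_right_eq_zero] at h1
  exact forall_congr' fun i => imp_congr_right fun _ => key i

variable [HasZeroObject C] [Pretriangulated C]

lemma SiltingGE.of_addClosure_left {M N X : C} (h : SiltingGE M X) (hN : addClosure M N) :
    SiltingGE N X := by
  intro i hi f
  obtain ⟨n, a, b, hab⟩ := (addClosure_iff _ _).1 hN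
  rw [← Category.id_comp f, ← hab, Preadditive.sum_comp]
  exact Finset.sum_eq_zero fun j _ => by rw [Category.assoc]; exact (congrArg _ (h i hi (b j ≫ f))).trans comp_zero

lemma hom_shift_eq_zero_of_addClosure {M N X : C} {i : ℤ} (h : ∀ f : X ⟶ M⟦i⟧, f = 0)
    (hN : addClosure M N) (f : X ⟶ N⟦i⟧) : f = 0 := by
  obtain ⟨n, a, b, hab⟩ := (addClosure_iff _ _).1 hN
  rw [← Category.comp_id f, ← CategoryTheory.Functor.map_id, ← hab, Functor.map_sum,
    Preadditive.comp_sum]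
  exact Finset.sum_eq_zero fun j _ => by
    rw [Functor.map_comp, ← Category.assoc, h (f ≫ (a j)⟦i⟧'), zero_comp]

lemma SiltingGE.of_addClosure_right {M N X : C} (h : SiltingGE X M) (hN : addClosure M N) :
    SiltingGE X N :=
  fun i hi => hom_shift_eq_zero_of_addClosure (h i hi) hN

lemma SiltingGE.biprod_left {M N X : C} (hM : SiltingGE M X) (hN : SiltingGE N X) :
    SiltingGE (M ⊞ N) X := fun i hi f =>
  biprod.hom_ext' _ _ (by rw [hM i hi (biprod.inl ≫ f), comp_zero])
    (by rw [hN i hi (biprod.inr ≫ f), comp_zero])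

lemma SiltingGE.biprod_right {M N X : C} (hM : SiltingGE X M) (hN : SiltingGE X N) :
    SiltingGE X (M ⊞ N) := by
  intro i hi f
  have h : f ≫ (biprod.fst ≫ biprod.inl + biprod.snd ≫ biprod.inr : M ⊞ N ⟶ _)⟦i⟧' = f := by
    rw [biprod.total, CategoryTheory.Functor.map_id, Category.comp_id]
  rw [← h, Functor.map_add, Preadditive.comp_add, Functor.map_comp, Functor.map_comp,
    ← Category.assoc, ← Category.assoc, hM i hi (f ≫ _), hN i hi (f ≫ _), zero_comp, zero_comp,
    add_zero]

lemma addClosure_shift {M N : C} (n : ℤ) (h : addClosure M N) :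
    addClosure (M⟦n⟧) (N⟦n⟧) := by
  obtain ⟨m, a, b, hab⟩ := (addClosure_iff _ _).1 h
  refine addClosure_of_sum (fun j => (a j)⟦n⟧') (fun j => (b j)⟦n⟧') ?_
  rw [← CategoryTheory.Functor.map_id, ← hab, Functor.map_sum]
  simp_rw [Functor.map_comp]

lemma addClosure_of_shift {M N : C} (n : ℤ) (h : addClosure (M⟦n⟧) (N⟦n⟧)) :
    addClosure M N := by
  obtain ⟨m, a, b, hab⟩ := (addClosure_iff _ _).1 h
  choose a' ha using fun j => (shiftFunctor C n).map_surjective (a j)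
  choose b' hb using fun j => (shiftFunctor C n).map_surjective (b j)
  refine addClosure_of_sum a' b' ((shiftFunctor C n).map_injective ?_)
  rw [CategoryTheory.Functor.map_id, ← hab, Functor.map_sum]
  simp_rw [Functor.map_comp, ha, hb]

lemma exists_of_addClosure_shift {M N : C} (n : ℤ) (h : addClosure (M⟦n⟧) N) :
    ∃ N' : C, addClosure M N' ∧ Nonempty (N'⟦n⟧ ≅ N) := by
  obtain ⟨N', ⟨e⟩⟩ := exists_iso_shift n N
  exact ⟨N', addClosure_of_shift n (addClosure_of_iso e h), ⟨e⟩⟩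

variable {X Y Z W : C} {f : X ⟶ Y} {g : Y ⟶ Z} {h : Z ⟶ X⟦(1 : ℤ)⟧}

lemma distTriang_comp₁₂ (hT : Triangle.mk f g h ∈ distTriang C) : f ≫ g = 0 :=
  comp_distTriang_mor_zero₁₂ _ hT

lemma distTriang_comp₂₃ (hT : Triangle.mk f g h ∈ distTriang C) : g ≫ h = 0 :=
  comp_distTriang_mor_zero₂₃ _ hT

lemma distTriang_comp₃₁ (hT : Triangle.mk f g h ∈ distTriang C) : h ≫ f⟦(1 : ℤ)⟧' = 0 :=
  comp_distTriang_mor_zero₃₁ _ hT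

lemma distTriang_lift₁ (hT : Triangle.mk f g h ∈ distTriang C) (k : W ⟶ Y) (hk : k ≫ g = 0) :
    ∃ l : W ⟶ X, k = l ≫ f :=
  Triangle.coyoneda_exact₂ _ hT k hk

lemma distTriang_lift₂ (hT : Triangle.mk f g h ∈ distTriang C) (k : W ⟶ Z) (hk : k ≫ h = 0) :
    ∃ l : W ⟶ Y, k = l ≫ g :=
  Triangle.coyoneda_exact₃ _ hT k hk

lemma distTriang_lift₃ (hT : Triangle.mk f g h ∈ distTriang C) (k : W ⟶ X⟦(1 : ℤ)⟧)
    (hk : k ≫ f⟦(1 : ℤ)⟧' = 0) : ∃ l : W ⟶ Z, k = l ≫ h :=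
  Triangle.coyoneda_exact₁ _ hT k hk

lemma distTriang_desc₃ (hT : Triangle.mk f g h ∈ distTriang C) (k : Z ⟶ W) (hk : g ≫ k = 0) :
    ∃ l : X⟦(1 : ℤ)⟧ ⟶ W, k = h ≫ l :=
  Triangle.yoneda_exact₃ _ hT k hk

lemma distTriang_desc₁ (hT : Triangle.mk f g h ∈ distTriang C) (k : X⟦(1 : ℤ)⟧ ⟶ W)
    (hk : h ≫ k = 0) : ∃ l : Y⟦(1 : ℤ)⟧ ⟶ W, k = f⟦(1 : ℤ)⟧' ≫ l := by
  obtain ⟨l, hl⟩ := Triangle.yoneda_exact₃ _ (rot_of_distTriang _ hT) k hk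
  -- Rotation introduces `-f[1]`; the sign is absorbed into the extension.
  exact ⟨-l, hl.trans ((Preadditive.neg_comp _ _).trans (Preadditive.comp_neg _ _).symm)⟩

/-- The test object is shifted back instead of the triangle forward, which avoids the signs of
shifted triangles. -/
lemma distTriang_lift₂_shift (hT : Triangle.mk f g h ∈ distTriang C) (n : ℤ)
    (k : W ⟶ Z⟦n⟧) (hk : k ≫ h⟦n⟧' = 0) : ∃ l : W ⟶ Y⟦n⟧, k = l ≫ g⟦n⟧' := by
  obtain ⟨W', ⟨e⟩⟩ := exists_iso_shift n W
  obtain ⟨k', hk'⟩ := (shiftFunctor C n).map_surjective (e.hom ≫ k)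
  have h1 : k' ≫ h = 0 := by
    apply (shiftFunctor C n).map_injective
    rw [Functor.map_comp, hk', Category.assoc, hk, comp_zero, Functor.map_zero]
  obtain ⟨l, hl⟩ := distTriang_lift₂ hT k' h1
  refine ⟨e.inv ≫ l⟦n⟧', ?_⟩
  rw [Category.assoc, ← Functor.map_comp, ← hl, hk', Iso.inv_hom_id_assoc]

lemma distTriang_lift₃_shift (hT : Triangle.mk f g h ∈ distTriang C) (n : ℤ)
    (k : W ⟶ (X⟦(1 : ℤ)⟧)⟦n⟧) (hk : k ≫ (f⟦(1 : ℤ)⟧')⟦n⟧' = 0) : ∃ l : W ⟶ Z⟦n⟧, k = l ≫ h⟦n⟧' := by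
  obtain ⟨W', ⟨e⟩⟩ := exists_iso_shift n W
  obtain ⟨k', hk'⟩ := (shiftFunctor C n).map_surjective (e.hom ≫ k)
  have h1 : k' ≫ f⟦(1 : ℤ)⟧' = 0 := by
    apply (shiftFunctor C n).map_injective
    rw [Functor.map_comp, hk', Category.assoc, hk, comp_zero, Functor.map_zero]
  obtain ⟨l, hl⟩ := distTriang_lift₃ hT k' h1
  refine ⟨e.inv ≫ l⟦n⟧', ?_⟩
  rw [Category.assoc, ← Functor.map_comp, ← hl, hk', Iso.inv_hom_id_assoc]

end Shift

/-! ### Minimal projective presentations of two-term objects. -/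

section Presentation

variable {A : Type u} [Ring A]

lemma stalk_siltingGE_of_regularObj {X : PerfCat A} (h : SiltingGE (regularObj A) X)
    (P : ProjCat A) : SiltingGE (stalk P) X :=
  h.of_addClosure_left (addClosure_regularObj_stalk P)

lemma hom_eq_zero_of_addClosure_regularObj {X Y : PerfCat A} (hX : addClosure (regularObj A) X)
    (hY : addClosure (regularObj A) Y) {i : ℤ} (hi : i ≠ 0) (f : X ⟶ Y⟦i⟧) : f = 0 := by
  refine hom_shift_eq_zero_of_addClosure (fun f => ?_) hY f
  obtain ⟨n, a, b, hab⟩ := (addClosure_iff _ _).1 hX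
  rw [← Category.id_comp f, ← hab, Preadditive.sum_comp]
  exact Finset.sum_eq_zero fun j _ => by
    rw [Category.assoc]
    exact (congrArg _ (stalk_hom_shift_eq_zero _ _ i hi (b j ≫ f))).trans comp_zero

/-- If `f : stalk P ⟶ X` is a right approximation, its cocone is below `A` when `X` is. -/
lemma siltingGE_cocone {X Y : PerfCat A} {P : ProjCat A} {d : Y ⟶ stalk P} {f : stalk P ⟶ X}
    {δ : X ⟶ Y⟦(1 : ℤ)⟧} (hT : Triangle.mk d f δ ∈ distTriang (PerfCat A))
    (hf : ∀ (Q : ProjCat A) (g : stalk Q ⟶ X), ∃ h : stalk Q ⟶ stalk P, h ≫ f = g)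
    (hX : SiltingGE (regularObj A) X) : SiltingGE (regularObj A) Y := by
  intro i hi g
  have hreg := addClosure_self (regularObj A)
  have h0 : g ≫ d⟦i⟧' = 0 :=
    hom_eq_zero_of_addClosure_regularObj hreg (addClosure_regularObj_stalk P) hi.ne' _
  -- Since `g` dies in `P[i]`, it comes from a morphism to `X[i - 1]`. For `i = 1` this morphism
  -- factors through the approximation `f`, and `f ≫ δ = 0`.
  by_cases h1 : i = 1
  · subst h1
    obtain ⟨k, hk⟩ := distTriang_lift₃ hT g h0
    obtain ⟨l, hl⟩ := hf _ k
    have h2 : l ≫ f ≫ δ = 0 := by rw [distTriang_comp₂₃ hT, comp_zero]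
    rw [hk]
    refine Eq.trans ?_ h2
    rw [← Category.assoc, hl]
    rfl
  -- For `i > 1` the morphism to `X[i - 1]` is zero because `A ≥ X`.
  · let e := shiftFunctorAdd' (PerfCat A) 1 (i - 1) i (by omega)
    have h2 : (g ≫ e.hom.app Y) ≫ (d⟦(1 : ℤ)⟧')⟦i - 1⟧' = 0 := by
      have h3 : d⟦i⟧' ≫ e.hom.app (stalk P) = e.hom.app Y ≫ (d⟦(1 : ℤ)⟧')⟦i - 1⟧' :=
        e.hom.naturality d
      rw [Category.assoc, ← h3, reassoc_of% h0, zero_comp]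
    obtain ⟨k, hk⟩ := distTriang_lift₃_shift hT (i - 1) _ h2
    have hk0 : k = 0 := hX (i - 1) (by omega) k
    rw [hk0, zero_comp] at hk
    rwa [Preadditive.IsIso.comp_right_eq_zero] at hk

variable [IsArtinianRing Aᵐᵒᵖ]

/-- Dimension shifting: with `Y` the cocone of a projective approximation of `X`, `Hom(Q, P[n]) = 0`
embeds `Hom(Q, X[n])` into `Hom(Q, Y[n + 1])`, and again `A ≥ Y`. After finitely many steps the
shift exceeds a bound that depends only on `Q`. -/
lemma hom_eq_zero_of_siltingGE_regularObj {Q X : PerfCat A} (hQ : SiltingGE Q (regularObj A))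
    (hX : SiltingGE (regularObj A) X) : SiltingGE Q X := by
  obtain ⟨N, hN⟩ := exists_forall_hom_shift_eq_zero Q
  have key : ∀ (k : ℕ) (X : PerfCat A), SiltingGE (regularObj A) X → ∀ n : ℤ, 0 < n →
      N - k ≤ n → ∀ f : Q ⟶ X⟦n⟧, f = 0 := by
    intro k
    induction k with
    | zero =>
      intro X hX n _ hn f
      exact hN X (fun P => stalk_siltingGE_of_regularObj hX P) n (by simpa using hn) f
    | succ k ih =>
      intro X hX n hn hnk g
      obtain ⟨P, f, hf⟩ := exists_right_approx X
      obtain ⟨Y, d, δ, hT⟩ := distinguished_cocone_triangle₁ f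
      have hY := siltingGE_cocone hT hf hX
      have h1 : g ≫ δ⟦n⟧' = 0 := by
        have := ih Y hY (1 + n) (by omega) (by push_cast at hnk; omega)
          (g ≫ δ⟦n⟧' ≫ (shiftFunctorAdd' (PerfCat A) 1 n (1 + n) rfl).inv.app Y)
        rw [← Category.assoc] at this
        rwa [Preadditive.IsIso.comp_right_eq_zero] at this
      obtain ⟨g', hg'⟩ := distTriang_lift₂_shift hT n g h1
      have h2 : g' = 0 := hQ.of_addClosure_right (addClosure_regularObj_stalk P) n hn g'
      rw [hg', h2, zero_comp]
  intro n hn f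
  exact key (N - n).toNat X hX n hn (by omega) f

/-- A projective approximation of `Q` splits, since its connecting morphism lies in a vanishing Hom
space; so `Q` is a retract of a stalk complex. -/
lemma exists_iso_stalk {Q : PerfCat A} (h1 : SiltingGE Q (regularObj A))
    (h2 : SiltingGE (regularObj A) Q) : ∃ R : ProjCat A, Nonempty (Q ≅ stalk R) := by
  obtain ⟨P, f, hf⟩ := exists_right_approx Q
  obtain ⟨Y, d, δ, hT⟩ := distinguished_cocone_triangle₁ f
  have h3 : δ = 0 := hom_eq_zero_of_siltingGE_regularObj h1 (siltingGE_cocone hT hf h2) 1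
    one_pos δ
  obtain ⟨s, hs⟩ := distTriang_lift₂ hT (𝟙 Q) (by
    rw [h3, comp_zero])
  exact exists_iso_stalk_of_retract s f hs.symm

lemma projLength_lt_of_split {Q R : ProjCat A} {p : stalk Q ⟶ stalk Q} (hp : p ≠ 𝟙 _)
    {i : stalk R ⟶ stalk Q} {r : stalk Q ⟶ stalk R} (h1 : i ≫ r = 𝟙 _) (h2 : r ≫ i = p) :
    projLength R < projLength Q := by
  obtain ⟨Y, e, he1⟩ := exists_iso_biprod_of_retract i r h1
  have he3 : i = biprod.inl ≫ e.inv := by rw [← he1, Category.assoc, e.hom_inv_id, Category.comp_id]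
  obtain ⟨R', ⟨e'⟩⟩ := exists_iso_stalk_of_retract (X := Y) (Q := Q) (biprod.inr ≫ e.inv)
    (e.hom ≫ biprod.snd) (by simp)
  have h5 := projLength_add (e ≪≫ biprod.mapIso (Iso.refl _) e')
  rw [h5]
  by_contra h6
  have h7 : projLength R' = 0 := by omega
  have h8 : IsZero Y := (isZero_of_projLength_eq_zero h7).of_iso e'
  apply hp
  have h9 : 𝟙 (stalk Q) = (e.hom ≫ biprod.fst) ≫ i := by
    have : e.hom ≫ (biprod.fst ≫ biprod.inl + biprod.snd ≫ biprod.inr) ≫ e.inv = 𝟙 _ := by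
      rw [biprod.total]; simp
    rw [← this, Preadditive.add_comp, Preadditive.comp_add, he3,
      h8.eq_of_tgt (biprod.snd : stalk R ⊞ Y ⟶ Y) 0]
    simp
  rw [← h2, ← Category.id_comp (r ≫ i), h9, Category.assoc, reassoc_of% h1]

/-- If a non-isomorphism fixes `f`, so does its Fitting idempotent, which is not the identity. Hence
`f` factors through a proper summand, and the length drops. -/
lemma exists_minimal_right {X : PerfCat A} {Q : ProjCat A} (f : stalk Q ⟶ X) :
    ∃ (R : ProjCat A) (g : stalk R ⟶ X) (i : stalk R ⟶ stalk Q) (r : stalk Q ⟶ stalk R),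
      i ≫ r = 𝟙 _ ∧ r ≫ g = f ∧ i ≫ f = g ∧ ∀ h : stalk R ⟶ stalk R, h ≫ g = g → IsIso h := by
  induction hn : projLength Q using Nat.strong_induction_on generalizing Q with
  | _ n ih =>
    by_cases H : ∀ h : stalk Q ⟶ stalk Q, h ≫ f = f → IsIso h
    · exact ⟨Q, f, 𝟙 _, 𝟙 _, by simp, by simp, by simp, H⟩
    · push Not at H
      obtain ⟨h, hf, hh⟩ := H
      obtain ⟨p, hp, -, hr, h1, -⟩ := exists_fitting h
      obtain ⟨R, i, r, hir, hri⟩ := exists_split_idempotent p hp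
      have hlt := projLength_lt_of_split (fun hp1 => hh (h1 hp1)) hir hri
      obtain ⟨R', g, i', r', h2, h3, h4, h5⟩ := ih _ (hn ▸ hlt) (i ≫ f) rfl
      refine ⟨R', g, i' ≫ i, r ≫ r', ?_, ?_, ?_, h5⟩
      · rw [Category.assoc, reassoc_of% hir, h2]
      · rw [Category.assoc, h3, ← Category.assoc, hri, hr _ _ hf]
      · rw [Category.assoc, h4]

lemma exists_minimal_left {X : PerfCat A} {Q : ProjCat A} (f : X ⟶ stalk Q) :
    ∃ (R : ProjCat A) (g : X ⟶ stalk R) (i : stalk R ⟶ stalk Q) (r : stalk Q ⟶ stalk R),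
      i ≫ r = 𝟙 _ ∧ g ≫ i = f ∧ f ≫ r = g ∧ ∀ h : stalk R ⟶ stalk R, g ≫ h = g → IsIso h := by
  induction hn : projLength Q using Nat.strong_induction_on generalizing Q with
  | _ n ih =>
    by_cases H : ∀ h : stalk Q ⟶ stalk Q, f ≫ h = f → IsIso h
    · exact ⟨Q, f, 𝟙 _, 𝟙 _, by simp, by simp, by simp, H⟩
    · push Not at H
      obtain ⟨h, hf, hh⟩ := H
      obtain ⟨p, hp, hl, -, h1, -⟩ := exists_fitting h
      obtain ⟨R, i, r, hir, hri⟩ := exists_split_idempotent p hp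
      have hlt := projLength_lt_of_split (fun hp1 => hh (h1 hp1)) hir hri
      obtain ⟨R', g, i', r', h2, h3, h4, h5⟩ := ih _ (hn ▸ hlt) (f ≫ r) rfl
      refine ⟨R', g, i' ≫ i, r ≫ r', ?_, ?_, ?_, h5⟩
      · rw [Category.assoc, reassoc_of% hir, h2]
      · rw [← Category.assoc, h3, Category.assoc, hri, hl _ _ hf]
      · rw [← Category.assoc, h4]

/-- Two-term objects have minimal projective presentations. -/
lemma exists_presentation {T : PerfCat A} (h1 : SiltingGE (regularObj A) T)
    (h2 : SiltingGE T ((regularObj A)⟦(1 : ℤ)⟧)) :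
    ∃ (P₁ P₀ : ProjCat A) (d : stalk P₁ ⟶ stalk P₀) (f : stalk P₀ ⟶ T)
      (δ : T ⟶ (stalk P₁)⟦(1 : ℤ)⟧), Triangle.mk d f δ ∈ distTriang (PerfCat A) ∧
        ∀ h : stalk P₀ ⟶ stalk P₀, h ≫ f = f → IsIso h := by
  obtain ⟨P, f₀, hf₀⟩ := exists_right_approx T
  obtain ⟨P₀, f, i, r, -, hrf, -, hmin⟩ := exists_minimal_right f₀
  have hf : ∀ (Q : ProjCat A) (g : stalk Q ⟶ T), ∃ h : stalk Q ⟶ stalk P₀, h ≫ f = g := by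
    intro Q g
    obtain ⟨h, hh⟩ := hf₀ Q g
    exact ⟨h ≫ r, by rw [Category.assoc, hrf, hh]⟩
  obtain ⟨Y, d, δ, hT⟩ := distinguished_cocone_triangle₁ f
  -- `Hom(Y, A[i])` lies between `Hom(P₀, A[i])` and `Hom(T, A[i + 1])`, both zero for `i > 0`.
  -- Together with `A ≥ Y` this makes `Y` a projective in degree zero.
  have hY : SiltingGE Y (regularObj A) := by
    intro i hi g
    have h3 : g⟦(1 : ℤ)⟧' ≫ (shiftFunctorAdd' (PerfCat A) i 1 (i + 1) rfl).inv.app (regularObj A)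
        = 0 := by
      obtain ⟨k, hk⟩ := distTriang_desc₁ hT (g⟦(1 : ℤ)⟧' ≫
        (shiftFunctorAdd' (PerfCat A) i 1 (i + 1) rfl).inv.app (regularObj A))
        (siltingGE_shift_one_iff.1 h2 _ (by omega) _)
      have hk0 : k = 0 := (forall_hom_shift_eq_zero_iff (rfl : i + 1 = i + 1)).1
        (fun f => hom_eq_zero_of_addClosure_regularObj (addClosure_regularObj_stalk P₀)
          (addClosure_self _) hi.ne' f) k
      rw [hk, hk0, comp_zero]
    rw [Preadditive.IsIso.comp_right_eq_zero] at h3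
    exact (shiftFunctor (PerfCat A) (1 : ℤ)).map_injective (h3.trans (Functor.map_zero _ _ _).symm)
  obtain ⟨P₁, ⟨e⟩⟩ := exists_iso_stalk hY (siltingGE_cocone hT hf h1)
  refine ⟨P₁, P₀, e.inv ≫ d, f, δ ≫ e.hom⟦(1 : ℤ)⟧', ?_, hmin⟩
  refine isomorphic_distinguished _ hT _ (Triangle.isoMk _ _ e.symm (Iso.refl _) (Iso.refl _) ?_ ?_ ?_)
  · change (e.inv ≫ d) ≫ 𝟙 _ = e.inv ≫ d
    rw [Category.comp_id]
  · change f ≫ 𝟙 _ = 𝟙 _ ≫ f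
    rw [Category.comp_id, Category.id_comp]
  · change (δ ≫ e.hom⟦(1 : ℤ)⟧') ≫ e.inv⟦(1 : ℤ)⟧' = 𝟙 _ ≫ δ
    rw [Category.assoc, ← Functor.map_comp, e.hom_inv_id, CategoryTheory.Functor.map_id,
      Category.comp_id, Category.id_comp]

end Presentation
end

noncomputable section

/-! ### Testing membership in thick subcategories by morphisms to a module. -/

section SimpleTest

variable {A : Type u} [Ring A]

/-- Perfect complexes as complexes of modules up to homotopy. -/
def perfInclusion (A : Type u) [Ring A] :
    PerfCat A ⥤ HomotopyCategory (ModuleCat.{u} Aᵐᵒᵖ) (ComplexShape.up ℤ) :=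
  (isBoundedComplex (ProjCat A)).ι ⋙ (isFGProjective A).ι.mapHomotopyCategory (ComplexShape.up ℤ)

instance : (perfInclusion A).CommShift ℤ := by
  unfold perfInclusion
  infer_instance

instance : (perfInclusion A).IsTriangulated := by
  unfold perfInclusion
  infer_instance

/-- The shifts of a module. -/
def shiftsOfModule (S : ModuleCat.{u} Aᵐᵒᵖ) :
    ObjectProperty (HomotopyCategory (ModuleCat.{u} Aᵐᵒᵖ) (ComplexShape.up ℤ)) :=
  fun Y => ∃ n : ℤ, Nonempty (Y ≅ (HomotopyCategory.quotient _ _).obj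
    (((CochainComplex.singleFunctor _ 0).obj S)⟦n⟧))

instance (S : ModuleCat.{u} Aᵐᵒᵖ) : (shiftsOfModule S).IsStableUnderShift ℤ where
  isStableUnderShiftBy m :=
    { le_shift Y hY := by
        obtain ⟨n, ⟨e⟩⟩ := hY
        exact ⟨n + m, ⟨(shiftFunctor _ m).mapIso e ≪≫
          (((HomotopyCategory.quotient _ _).commShiftIso m).app _).symm ≪≫
            (HomotopyCategory.quotient _ _).mapIso
              ((shiftFunctorAdd (CochainComplex (ModuleCat.{u} Aᵐᵒᵖ) ℤ) n m).symm.app _)⟩⟩ }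

/-- The perfect complexes without morphisms to shifts of `S`. -/
def orthogonalTo (S : ModuleCat.{u} Aᵐᵒᵖ) : ObjectProperty (PerfCat A) :=
  (shiftsOfModule S).leftOrthogonal.inverseImage (perfInclusion A)

instance (S : ModuleCat.{u} Aᵐᵒᵖ) : (orthogonalTo S).IsTriangulated := by
  unfold orthogonalTo
  infer_instance

instance (S : ModuleCat.{u} Aᵐᵒᵖ) : (orthogonalTo S).IsStableUnderRetracts where
  of_retract {X Y} r hY Z f hZ := by
    have h1 := hY ((perfInclusion A).map r.r ≫ f) hZ
    rw [← Category.id_comp f, ← CategoryTheory.Functor.map_id, ← r.retract, Functor.map_comp,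
      Category.assoc, h1, comp_zero]

/-- Complexes in single, different degrees have no nonzero morphisms, so only the unshifted `S`
gives a condition. -/
lemma orthogonalTo_stalk_iff (S : ModuleCat.{u} Aᵐᵒᵖ) (Q : ProjCat A) :
    orthogonalTo S (stalk Q) ↔ ∀ f : Q.obj →ₗ[Aᵐᵒᵖ] S, f = 0 := by
  let e : (perfInclusion A).obj (stalk Q) ≅ (HomotopyCategory.quotient _ _).obj
      ((CochainComplex.singleFunctor (ModuleCat.{u} Aᵐᵒᵖ) 0).obj Q.obj) :=
    (HomotopyCategory.quotient _ _).mapIso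
      ((HomologicalComplex.singleMapHomologicalComplex (isFGProjective A).ι
        (ComplexShape.up ℤ) 0).app Q)
  have h1 : orthogonalTo S (stalk Q) ↔ ∀ n : ℤ,
      ∀ f : (HomotopyCategory.quotient _ _).obj
        ((CochainComplex.singleFunctor (ModuleCat.{u} Aᵐᵒᵖ) 0).obj Q.obj) ⟶
        (HomotopyCategory.quotient _ _).obj
        (((CochainComplex.singleFunctor (ModuleCat.{u} Aᵐᵒᵖ) 0).obj S)⟦n⟧), f = 0 := by
    constructor
    · intro H n f
      have h2 := H (e.hom ≫ f) ⟨n, ⟨Iso.refl _⟩⟩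
      rwa [Preadditive.IsIso.comp_left_eq_zero] at h2
    · rintro H Y f ⟨n, ⟨e'⟩⟩
      have h2 := H n (e.inv ≫ f ≫ e'.hom)
      rwa [Preadditive.IsIso.comp_left_eq_zero, Preadditive.IsIso.comp_right_eq_zero] at h2
  rw [h1]
  constructor
  · intro H f
    have h2 := (single_hom_eq_zero_iff Q.obj ((CochainComplex.singleFunctor _ 0).obj S) 0 1 (-1)
      rfl rfl).1 (H 0) (ModuleCat.ofHom f ≫
        (HomologicalComplex.singleObjXSelf (ComplexShape.up ℤ) 0 S).inv) (by
          rw [CochainComplex.singleFunctor_obj_d, comp_zero])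
    obtain ⟨g, hg⟩ := h2
    rw [CochainComplex.singleFunctor_obj_d, comp_zero] at hg
    have h3 := (Preadditive.IsIso.comp_right_eq_zero (ModuleCat.ofHom f)
      (HomologicalComplex.singleObjXSelf (ComplexShape.up ℤ) 0 S).inv).1 hg.symm
    exact congrArg ModuleCat.Hom.hom h3
  · intro H n
    rw [single_hom_eq_zero_iff Q.obj ((CochainComplex.singleFunctor _ 0).obj S) n (n + 1) (n - 1)
      rfl (by omega)]
    intro g _
    refine ⟨0, ?_⟩
    rw [zero_comp]
    by_cases hn : n = 0
    · subst hn
      have h3 : g ≫ (HomologicalComplex.singleObjXSelf (ComplexShape.up ℤ) 0 S).hom = 0 :=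
        ModuleCat.hom_ext (H _)
      have aux : ∀ {Y Z : ModuleCat.{u} Aᵐᵒᵖ} (e : Y ≅ Z) (k : Q.obj ⟶ Y), k ≫ e.hom = 0 → 0 = k :=
        fun e k hk => ((Preadditive.IsIso.comp_right_eq_zero k e.hom).1 hk).symm
      exact aux _ g h3
    · exact (HomologicalComplex.isZero_single_obj_X _ _ _ _ hn).eq_of_tgt _ _

/-- A projective module outside `add M` is not in the thick subcategory generated by `M`. -/
lemma not_triangEnvelope_of_not_addClosure {P M : ProjCat A} {T : PerfCat A}
    (h : ¬ addClosure (stalk M) (stalk P))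
    (hT : ∀ Q : ObjectProperty (PerfCat A), Q.IsTriangulated → Q.IsStableUnderRetracts →
      Q (stalk M) → Q T) : ¬ (ObjectProperty.singleton T).triangEnvelope (stalk P) := by
  have := P.property.1
  have := P.property.2
  have := M.property.2
  -- `tr` is the trace of `M` in `P`, and `S = P / tr`. Maps `M ⟶ S` lift to `P` and land in the
  -- trace, so `M` is orthogonal to `S`. If `T` generated `P`, the quotient map would vanish, and
  -- `P` would be a quotient of a power of `M`, hence a summand of it.
  let tr : Submodule Aᵐᵒᵖ P.obj := ⨆ f : M.obj →ₗ[Aᵐᵒᵖ] P.obj, LinearMap.range f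
  let S : ModuleCat.{u} Aᵐᵒᵖ := ModuleCat.of Aᵐᵒᵖ (P.obj ⧸ tr)
  intro hP
  have hM : orthogonalTo S (stalk M) := by
    rw [orthogonalTo_stalk_iff]
    intro f
    obtain ⟨g, hg⟩ := Module.projective_lifting_property tr.mkQ f tr.mkQ_surjective
    rw [← hg]
    ext x
    exact (Submodule.Quotient.mk_eq_zero tr).2 (Submodule.mem_iSup_of_mem g ⟨x, rfl⟩)
  have h1 : (ObjectProperty.singleton T).triangEnvelope ≤ orthogonalTo S := by
    rw [ObjectProperty.triangEnvelope_le_iff]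
    intro X hX
    obtain rfl : T = X := by simpa using hX
    exact hT _ inferInstance inferInstance hM
  have h2 := (orthogonalTo_stalk_iff S P).1 (h1 _ hP) tr.mkQ
  have h3 : tr = ⊤ := by rw [← tr.ker_mkQ, LinearMap.ker_eq_top]; exact h2
  apply h
  obtain ⟨n, t, ht⟩ : ∃ (n : ℕ) (t : Fin n → (M.obj →ₗ[Aᵐᵒᵖ] P.obj)),
      ⨆ j, LinearMap.range (t j) = ⊤ := by
    have h4 : IsCompactElement (⊤ : Submodule Aᵐᵒᵖ P.obj) := by
      rw [← Submodule.fg_iff_compact]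
      exact Module.Finite.fg_top
    obtain ⟨s, hs⟩ := (CompleteLattice.isCompactElement_iff_exists_le_iSup_of_le_iSup _).1 h4 _
      (fun f : M.obj →ₗ[Aᵐᵒᵖ] P.obj => LinearMap.range f) h3.ge
    refine ⟨s.card, fun j => (s.equivFin.symm j : M.obj →ₗ[Aᵐᵒᵖ] P.obj), top_le_iff.1 (hs.trans ?_)⟩
    refine Finset.sup_le fun f hf => ?_
    refine le_trans (le_of_eq ?_) (le_iSup _ (s.equivFin ⟨f, hf⟩))
    simp
  let q : (Fin n → M.obj) →ₗ[Aᵐᵒᵖ] P.obj := LinearMap.lsum Aᵐᵒᵖ (fun _ => M.obj) ℕ t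
  have hq : Function.Surjective q := by
    rw [← LinearMap.range_eq_top, ← top_le_iff, ← ht]
    refine iSup_le fun j => ?_
    rintro _ ⟨x, rfl⟩
    refine ⟨Pi.single j x, ?_⟩
    simp only [q, LinearMap.lsum_apply, LinearMap.sum_apply, LinearMap.comp_apply,
      LinearMap.proj_apply]
    rw [Finset.sum_eq_single j (fun k _ hk => by rw [Pi.single_eq_of_ne hk, map_zero]) (by simp),
      Pi.single_eq_same]
  obtain ⟨s, hs⟩ := Module.projective_lifting_property q LinearMap.id hq
  refine addClosure_of_sum (fun j => stalkHom (P := P) (Q := M) (LinearMap.proj j ∘ₗ s))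
    (fun j => stalkHom (t j)) ?_
  simp_rw [stalkHom_comp]
  rw [← stalkHom_sum, ← stalkHom_id, ← hs]
  congr 1
  ext x
  simp [q]

end SimpleTest
end

noncomputable section

/-! ### Factorisation conditions and summands of the presentation. -/

section Bisection

lemma prop_of_addClosure {C : Type u} [Category.{v} C] [HasZeroObject C] [HasShift C ℤ]
    [Preadditive C] [∀ n : ℤ, (shiftFunctor C n).Additive] [Pretriangulated C]
    {Q : ObjectProperty C} [hQ : Q.IsTriangulated] [hQ' : Q.IsStableUnderRetracts] {M N : C}
    (hM : Q M) (hN : addClosure M N) : Q N := by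
  obtain ⟨n, Y, ⟨e⟩⟩ := hN
  exact Q.prop_of_retract (⟨biprod.inl ≫ e.hom, e.inv ≫ biprod.fst, by simp⟩ : Retract N _)
    (Q.prop_of_iso (biproduct.isoProduct _).symm (Q.prop_product fun _ => hM))

variable {A : Type u} [Ring A]

/-- `P ⊞ M` is a basic version of `A`. -/
def IsComplement (P M : PerfCat A) : Prop :=
  ∃ B : PerfCat A, IsBasicVersion B (regularObj A) ∧ Nonempty (B ≅ P ⊞ M)

/-- Every morphism `P ⟶ T` factors through `add M`. -/
def LeftFactors (P M T : PerfCat A) : Prop :=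
  ∀ u : P ⟶ T, ∃ N : PerfCat A, addClosure M N ∧ ∃ (a : P ⟶ N) (b : N ⟶ T), u = a ≫ b

/-- Every morphism `T ⟶ P[1]` factors through `(add M)[1]`. -/
def RightFactors (P M T : PerfCat A) : Prop :=
  ∀ u : T ⟶ P⟦(1 : ℤ)⟧, ∃ N : PerfCat A, addClosure M N ∧
    ∃ (a : T ⟶ N⟦(1 : ℤ)⟧) (b : N ⟶ P), u = a ≫ b⟦(1 : ℤ)⟧'

namespace IsComplement

variable {P M N : PerfCat A}

lemma addClosure_regularObj (h : IsComplement P M) (hN : addClosure M N) :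
    addClosure (regularObj A) N := by
  obtain ⟨B, hB, ⟨e⟩⟩ := h
  rw [← hB.2]
  exact addClosure_trans hN (addClosure_of_retract (biprod.inr ≫ e.inv) (e.hom ≫ biprod.snd)
    (by simp) (addClosure_self B))

lemma exists_retract_or (h : IsComplement P M) (hP : HasLocalEnd P)
    (hN : addClosure (regularObj A) N) :
    (∃ (i : P ⟶ N) (r : N ⟶ P), i ≫ r = 𝟙 P) ∨ addClosure M N := by
  obtain ⟨B, hB, ⟨e⟩⟩ := h
  rw [← hB.2] at hN
  exact hP.exists_retract_or_addClosure e hN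

lemma not_isIso (h : IsComplement P M) (hP : HasLocalEnd P)
    (hN : addClosure M N) (i : P ⟶ N) (r : N ⟶ P) : ¬ IsIso (i ≫ r) := by
  obtain ⟨B, hB, ⟨e⟩⟩ := h
  exact hP.not_isIso_of_isBasic hB.1 e hN i r

end IsComplement

variable {P : PerfCat A} (hP : HasLocalEnd P) {M T : PerfCat A} (hM : IsComplement P M)
  {P₁ P₀ : ProjCat A} {d : stalk P₁ ⟶ stalk P₀} {f : stalk P₀ ⟶ T}
  {δ : T ⟶ (stalk P₁)⟦(1 : ℤ)⟧} (hT : Triangle.mk d f δ ∈ distTriang (PerfCat A))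
  (hmin : ∀ h : stalk P₀ ⟶ stalk P₀, h ≫ f = f → IsIso h)

include hP hT hmin in
/-- The differential of a minimal presentation has no invertible component. -/
lemma not_isIso_of_minimal (i : P ⟶ stalk P₁) (r : stalk P₀ ⟶ P) : ¬ IsIso (i ≫ d ≫ r) := by
  intro h
  -- This endomorphism fixes `f` because `d ≫ f = 0`, so minimality makes it invertible; yet it
  -- kills `i ≫ d`, which would then be zero.
  have h1 : IsIso (𝟙 (stalk P₀) - r ≫ inv (i ≫ d ≫ r) ≫ i ≫ d) := by
    apply hmin
    rw [Preadditive.sub_comp, Category.id_comp, Category.assoc, Category.assoc, Category.assoc,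
      distTriang_comp₁₂ hT]
    simp
  have h2 : (i ≫ d) ≫ (𝟙 (stalk P₀) - r ≫ inv (i ≫ d ≫ r) ≫ i ≫ d) = 0 := by
    rw [Preadditive.comp_sub, Category.comp_id, Category.assoc i d (r ≫ _)]
    have : i ≫ d ≫ r ≫ inv (i ≫ d ≫ r) ≫ i ≫ d =
        ((i ≫ d ≫ r) ≫ inv (i ≫ d ≫ r)) ≫ i ≫ d := by simp only [Category.assoc]
    rw [this, IsIso.hom_inv_id, Category.id_comp, sub_self]
  rw [Preadditive.IsIso.comp_right_eq_zero] at h2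
  rw [← Category.assoc, h2, zero_comp] at h
  exact hP.1 ((IsZero.iff_id_eq_zero _).2 (by rw [← IsIso.hom_inv_id (0 : P ⟶ P), zero_comp]))

include hM in
lemma addClosure_regularObj_of_isComplement : addClosure (regularObj A) P := by
  obtain ⟨B, hB, ⟨e⟩⟩ := hM
  rw [← hB.2]
  exact addClosure_of_retract (biprod.inl ≫ e.inv) (e.hom ≫ biprod.fst) (by simp)
    (addClosure_self B)

include hT in
lemma lift_presentation {N : PerfCat A} (hN : addClosure (regularObj A) N) (b : N ⟶ T) :
    ∃ g : N ⟶ stalk P₀, b = g ≫ f :=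
  distTriang_lift₂ hT b (hom_eq_zero_of_addClosure_regularObj hN (addClosure_regularObj_stalk P₁)
    one_ne_zero _)

include hT in
lemma desc_presentation {N : PerfCat A} (hN : addClosure (regularObj A) N)
    (a : T ⟶ N⟦(1 : ℤ)⟧) : ∃ g : stalk P₁ ⟶ N, a = δ ≫ g⟦(1 : ℤ)⟧' := by
  obtain ⟨g, hg⟩ := distTriang_desc₃ hT a
    (hom_eq_zero_of_addClosure_regularObj (addClosure_regularObj_stalk P₀) hN one_ne_zero _)
  obtain ⟨g, rfl⟩ := (shiftFunctor (PerfCat A) (1 : ℤ)).map_surjective g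
  exact ⟨g, hg⟩

include hP hM hT hmin in
-- If `P` were a summand of `P₀` and `P ⟶ P₀ ⟶ T` factored through `add M`, lifting to `P₀` would
-- write the identity of `P` as a map through `add M` plus a map through `d`. Neither is invertible:
-- the first since `P ⊞ M` is basic, the second by minimality.
lemma leftFactors_iff : LeftFactors P M T ↔ addClosure M (stalk P₀) := by
  constructor
  · intro H
    refine (hM.exists_retract_or hP (addClosure_regularObj_stalk P₀)).resolve_left ?_
    rintro ⟨i, r, hir⟩
    obtain ⟨N, hN, a, b, hab⟩ := H (i ≫ f)
    obtain ⟨g, rfl⟩ := lift_presentation hT (hM.addClosure_regularObj hN) b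
    obtain ⟨w, hw⟩ := distTriang_lift₁ hT (i - a ≫ g)
      (by rw [Preadditive.sub_comp, hab, Category.assoc, sub_self])
    have h1 : a ≫ g ≫ r + w ≫ d ≫ r = 𝟙 P := by
      rw [← Category.assoc w, ← hw, Preadditive.sub_comp, hir, Category.assoc, add_sub_cancel]
    rcases hP.2 _ _ h1 with h2 | h2
    · exact hM.not_isIso hP hN a (g ≫ r) h2
    · exact not_isIso_of_minimal hP hT hmin w r h2
  · intro H u
    obtain ⟨g, hg⟩ := lift_presentation hT (addClosure_regularObj_of_isComplement hM) u
    exact ⟨_, H, g, f, hg⟩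

include hP hM hT hmin in
-- The dual argument at `P₁`. Minimality of `P₀ ⟶ T` suffices here too, since it excludes every
-- invertible component of `d` at `P`.
lemma rightFactors_iff : RightFactors P M T ↔ addClosure M (stalk P₁) := by
  constructor
  · intro H
    refine (hM.exists_retract_or hP (addClosure_regularObj_stalk P₁)).resolve_left ?_
    rintro ⟨i, r, hir⟩
    obtain ⟨N, hN, a, b, hab⟩ := H (δ ≫ r⟦(1 : ℤ)⟧')
    obtain ⟨g, rfl⟩ := desc_presentation hT (hM.addClosure_regularObj hN) a
    obtain ⟨w, hw⟩ := distTriang_desc₁ hT ((r - g ≫ b)⟦(1 : ℤ)⟧') (by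
      rw [Functor.map_sub, Functor.map_comp, Preadditive.comp_sub, hab, Category.assoc, sub_self])
    obtain ⟨w, rfl⟩ := (shiftFunctor (PerfCat A) (1 : ℤ)).map_surjective w
    rw [← Functor.map_comp] at hw
    have hw := (shiftFunctor (PerfCat A) (1 : ℤ)).map_injective hw
    have h1 : (i ≫ g) ≫ b + i ≫ d ≫ w = 𝟙 P := by
      rw [← hw, Preadditive.comp_sub, hir, Category.assoc, add_sub_cancel]
    rcases hP.2 _ _ h1 with h2 | h2
    · exact hM.not_isIso hP hN (i ≫ g) b h2
    · exact not_isIso_of_minimal hP hT hmin i w h2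
  · intro H u
    obtain ⟨g, hg⟩ := desc_presentation hT (addClosure_regularObj_of_isComplement hM) u
    exact ⟨_, H, δ, g, hg⟩

include hP hM hT hmin in
-- If `P` were a summand of both terms, `P₁ ⟶ P ⟶ P₀` would induce a morphism `T ⟶ T[1]`. Its
-- vanishing gives `r₁ ≫ i₀ = d ≫ h + w ≫ d`; restricted to `P`, the identity becomes a sum of two
-- maps through `d`, contradicting locality and minimality.
lemma addClosure_or_addClosure (hTT : SiltingGE T T) :
    addClosure M (stalk P₀) ∨ addClosure M (stalk P₁) := by
  rcases hM.exists_retract_or hP (addClosure_regularObj_stalk P₀) with ⟨i₀, r₀, h₀⟩ | h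
  · rcases hM.exists_retract_or hP (addClosure_regularObj_stalk P₁) with ⟨i₁, r₁, h₁⟩ | h
    · exfalso
      obtain ⟨k, hk⟩ := distTriang_desc₁ hT ((r₁ ≫ i₀ ≫ f)⟦(1 : ℤ)⟧') (hTT 1 one_pos _)
      obtain ⟨k, rfl⟩ := (shiftFunctor (PerfCat A) (1 : ℤ)).map_surjective k
      rw [← Functor.map_comp] at hk
      have hk := (shiftFunctor (PerfCat A) (1 : ℤ)).map_injective hk
      obtain ⟨h, rfl⟩ := lift_presentation hT (addClosure_regularObj_stalk P₀) k
      obtain ⟨w, hw⟩ := distTriang_lift₁ hT (r₁ ≫ i₀ - d ≫ h)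
        (by rw [Preadditive.sub_comp, Category.assoc, Category.assoc, hk, sub_self])
      have h2 : i₁ ≫ d ≫ (h ≫ r₀) + (i₁ ≫ w) ≫ d ≫ r₀ = 𝟙 P := by
        have h3 : i₁ ≫ (r₁ ≫ i₀) ≫ r₀ = 𝟙 P := by
          rw [Category.assoc, reassoc_of% h₁, h₀]
        rw [← h3, eq_add_of_sub_eq hw]
        simp only [Preadditive.add_comp, Preadditive.comp_add, Category.assoc]
        abel
      rcases hP.2 _ _ h2 with h3 | h3
      · exact not_isIso_of_minimal hP hT hmin _ _ h3
      · exact not_isIso_of_minimal hP hT hmin _ _ h3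
    · exact .inr h
  · exact .inl h

include hP hM hT in
-- If both terms lie in `add M`, then `T` and everything it generates lie in the thick subcategory
-- of `M`, which does not contain `P`.
lemma not_addClosure_and_addClosure (hTT : (ObjectProperty.singleton T).triangEnvelope = ⊤)
    (h₀ : addClosure M (stalk P₀)) (h₁ : addClosure M (stalk P₁)) : False := by
  obtain ⟨M', ⟨eM⟩⟩ := (addClosure_regularObj_iff M).1
    (hM.addClosure_regularObj (addClosure_self M))
  obtain ⟨P', ⟨eP⟩⟩ := (addClosure_regularObj_iff P).1 (addClosure_regularObj_of_isComplement hM)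
  refine not_triangEnvelope_of_not_addClosure (P := P') (M := M') (T := T) (fun h => ?_)
    (fun Q hQ hQ' hQM => ?_) (by rw [hTT]; trivial)
  · have h1 : addClosure M (stalk P') := addClosure_trans h (addClosure_of_iso eM.symm (addClosure_self M))
    exact hM.not_isIso hP h1 eP.hom eP.inv (by rw [eP.hom_inv_id]; infer_instance)
  · have hQM' : Q M := Q.prop_of_iso eM.symm hQM
    exact Q.ext_of_isTriangulatedClosed₃ _ hT (prop_of_addClosure hQM' h₁)
      (prop_of_addClosure hQM' h₀)

/-- Factoring through the complement of `P` does not depend on the complement. -/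
lemma addClosure_of_isComplement (hP : HasLocalEnd P) {M M' N : PerfCat A} (hM : IsComplement P M)
    (hM' : IsComplement P M') (hN : addClosure M N) : addClosure M' N := by
  refine (hM'.exists_retract_or hP (hM.addClosure_regularObj hN)).resolve_left ?_
  rintro ⟨i, r, h⟩
  exact hM.not_isIso hP hN i r (by rw [h]; infer_instance)

lemma LeftFactors.of_isComplement (hP : HasLocalEnd P) {M M' T : PerfCat A} (hM : IsComplement P M)
    (hM' : IsComplement P M') (h : LeftFactors P M T) : LeftFactors P M' T := fun u => by
  obtain ⟨N, hN, a, b, hab⟩ := h u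
  exact ⟨N, addClosure_of_isComplement hP hM hM' hN, a, b, hab⟩

lemma RightFactors.of_isComplement (hP : HasLocalEnd P) {M M' T : PerfCat A}
    (hM : IsComplement P M) (hM' : IsComplement P M') (h : RightFactors P M T) :
    RightFactors P M' T := fun u => by
  obtain ⟨N, hN, a, b, hab⟩ := h u
  exact ⟨N, addClosure_of_isComplement hP hM hM' hN, a, b, hab⟩

end Bisection
end

noncomputable section

/-! ### Approximations and basic versions under shift. -/

section Approximations

variable {C : Type u} [Category.{v} C] [HasZeroObject C] [HasShift C ℤ] [Preadditive C]
  [∀ n : ℤ, (shiftFunctor C n).Additive] [Pretriangulated C]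

lemma addClosure_biproduct (M : C) (n : ℕ) : addClosure M (⨁ fun _ : Fin n => M) :=
  addClosure_of_sum (fun j => biproduct.π (fun _ : Fin n => M) j)
    (fun j => biproduct.ι (fun _ : Fin n => M) j) biproduct.total

/-- Shifts commute with biproducts. -/
def shiftBiprodIso (X Y : C) (n : ℤ) : (X ⊞ Y)⟦n⟧ ≅ X⟦n⟧ ⊞ Y⟦n⟧ :=
  haveI : PreservesBinaryBiproducts (shiftFunctor C n) :=
    preservesBinaryBiproducts_of_preservesBiproducts _
  (shiftFunctor C n).mapBiprod X Y

/-- Generators of the morphisms `P ⟶ M` give a left `add M`-approximation. -/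
lemma factors_lift {P M N : C} {n : ℕ} (f : Fin n → (P ⟶ M))
    (hf : ∀ g : P ⟶ M, ∃ c : Fin n → (M ⟶ M), g = ∑ i, f i ≫ c i) (hN : addClosure M N)
    (g : P ⟶ N) : ∃ h : (⨁ fun _ : Fin n => M) ⟶ N, biproduct.lift f ≫ h = g := by
  obtain ⟨m, a, b, hab⟩ := (addClosure_iff _ _).1 hN
  choose c hc using fun j => hf (g ≫ a j)
  refine ⟨biproduct.desc fun i => ∑ j, c j i ≫ b j, ?_⟩
  rw [biproduct.lift_desc, ← Category.comp_id g, ← hab]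
  simp only [Preadditive.comp_sum]
  rw [Finset.sum_comm]
  refine Finset.sum_congr rfl fun j _ => ?_
  rw [← Category.assoc g, hc j, Preadditive.sum_comp]
  simp only [Category.assoc]

/-- Generators of the morphisms `M ⟶ P` give a right `add M`-approximation. -/
lemma factors_desc {P M N : C} {n : ℕ} (f : Fin n → (M ⟶ P))
    (hf : ∀ g : M ⟶ P, ∃ c : Fin n → (M ⟶ M), g = ∑ i, c i ≫ f i) (hN : addClosure M N)
    (g : N ⟶ P) : ∃ h : N ⟶ (⨁ fun _ : Fin n => M), h ≫ biproduct.desc f = g := by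
  obtain ⟨m, a, b, hab⟩ := (addClosure_iff _ _).1 hN
  choose c hc using fun j => hf (b j ≫ g)
  refine ⟨biproduct.lift fun i => ∑ j, a j ≫ c j i, ?_⟩
  rw [biproduct.lift_desc, ← Category.id_comp g, ← hab]
  simp only [Preadditive.sum_comp]
  rw [Finset.sum_comm]
  refine Finset.sum_congr rfl fun j _ => ?_
  rw [Category.assoc (a j), hc j, Preadditive.comp_sum]
  simp only [Category.assoc]

lemma IsMinRightApprox.shift {M N X : C} {f : N ⟶ X} (hf : IsMinRightApprox M f) (n : ℤ) :
    IsMinRightApprox (M⟦n⟧) (f⟦n⟧') where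
  mem := addClosure_shift n hf.mem
  factors N' g hN' := by
    obtain ⟨N'', hN'', ⟨e⟩⟩ := exists_of_addClosure_shift n hN'
    obtain ⟨g', hg'⟩ := (shiftFunctor C n).map_surjective (e.hom ≫ g)
    obtain ⟨h, rfl⟩ := hf.factors N'' g' hN''
    exact ⟨e.inv ≫ h⟦n⟧', by rw [Category.assoc, ← Functor.map_comp, hg', Iso.inv_hom_id_assoc]⟩
  minimal h hh := by
    obtain ⟨h, rfl⟩ := (shiftFunctor C n).map_surjective h
    rw [← Functor.map_comp] at hh
    have := hf.minimal h ((shiftFunctor C n).map_injective hh)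
    infer_instance

lemma IsBasic.of_shift {X : C} (n : ℤ) (h : IsBasic (X⟦n⟧)) : IsBasic X := by
  rintro Y Z ⟨e⟩
  have h1 := h (Y⟦n⟧) (Z⟦n⟧) ⟨(shiftFunctor C n).mapIso e ≪≫ shiftBiprodIso _ _ n ≪≫
    biprod.mapIso (shiftBiprodIso _ _ n) (Iso.refl _)⟩
  exact (IsZero.iff_id_eq_zero _).2 ((shiftFunctor C n).map_injective (h1.eq_of_src _ _))

lemma IsBasic.of_iso {X Y : C} (e : X ≅ Y) (h : IsBasic X) : IsBasic Y :=
  fun Z W ⟨f⟩ => h Z W ⟨e ≪≫ f⟩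

lemma IsBasic.shift {X : C} (n : ℤ) (h : IsBasic X) : IsBasic (X⟦n⟧) :=
  IsBasic.of_shift (-n) (h.of_iso (shiftShiftNeg X n).symm)

lemma addClosure_congr {M N : C} (e : M ≅ N) : addClosure M = addClosure N := by
  ext X
  exact ⟨fun h => addClosure_trans h (addClosure_of_iso e (addClosure_self N)),
    fun h => addClosure_trans h (addClosure_of_iso e.symm (addClosure_self M))⟩

lemma addClosure_shift_iff {M X : C} (n : ℤ) : addClosure (M⟦n⟧) (X⟦n⟧) ↔ addClosure M X :=
  ⟨addClosure_of_shift n, addClosure_shift n⟩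

lemma IsBasicVersion.shift {B X : C} (n : ℤ) (h : IsBasicVersion B X) :
    IsBasicVersion (B⟦n⟧) (X⟦n⟧) := by
  refine ⟨h.1.shift n, ?_⟩
  ext Y
  obtain ⟨Y', ⟨e⟩⟩ := exists_iso_shift n Y
  have key : ∀ M : C, addClosure (M⟦n⟧) Y ↔ addClosure M Y' := fun M =>
    ⟨fun h => addClosure_of_shift n (addClosure_of_iso e h),
      fun h => addClosure_of_iso e.symm (addClosure_shift n h)⟩
  rw [key, key, h.2]

lemma IsBasicVersion.of_shift {B X : C} (n : ℤ) (h : IsBasicVersion (B⟦n⟧) (X⟦n⟧)) :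
    IsBasicVersion B X := by
  refine ⟨h.1.of_shift, ?_⟩
  ext Y
  rw [← addClosure_shift_iff n, h.2, addClosure_shift_iff n]

lemma IsBasicVersion.of_iso {B B' X : C} (e : B ≅ B') (h : IsBasicVersion B X) :
    IsBasicVersion B' X :=
  ⟨h.1.of_iso e, (addClosure_congr e).symm.trans h.2⟩

end Approximations

/-! ### Mutations in terms of factorisations, and the bisection. -/

section Mutation

variable {A : Type u} [Ring A] {P M T U : PerfCat A}

/-- The objects below the left mutation of `P ⊞ M` at `P`. -/
lemma siltingGE_cone_iff {N Y : PerfCat A} {f : P ⟶ N} {g : N ⟶ Y} {h : Y ⟶ P⟦(1 : ℤ)⟧}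
    (hP : addClosure (regularObj A) P) (hM : addClosure (regularObj A) M)
    (hf : IsMinLeftApprox M f) (hT : Triangle.mk f g h ∈ distTriang (PerfCat A))
    (hAT : SiltingGE (regularObj A) T) : SiltingGE (Y ⊞ M) T ↔ LeftFactors P M T := by
  have hPT := hAT.of_addClosure_left hP
  have hMT := hAT.of_addClosure_left hM
  constructor
  · intro H u
    have hY : SiltingGE Y T := H.of_addClosure_left (addClosure_biprod_left Y M)
    -- The composite `Y ⟶ P[1] ⟶ T[1]` vanishes, so `u` extends along `f` to `N`.
    obtain ⟨l, hl⟩ := distTriang_desc₁ hT (u⟦(1 : ℤ)⟧') (hY 1 one_pos _)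
    obtain ⟨l, rfl⟩ := (shiftFunctor (PerfCat A) (1 : ℤ)).map_surjective l
    rw [← Functor.map_comp] at hl
    exact ⟨N, hf.mem, f, l, (shiftFunctor (PerfCat A) (1 : ℤ)).map_injective hl⟩
  · intro H
    refine SiltingGE.biprod_left (fun i hi u => ?_) hMT
    obtain ⟨v, rfl⟩ := distTriang_desc₃ hT u (hMT.of_addClosure_left hf.mem i hi _)
    -- Only `i = 1` uses the factorisation; for larger `i`, `Hom(P[1], T[i])` is zero because `A ≥
    -- T`.
    rcases eq_or_lt_of_le (show 1 ≤ i from hi) with rfl | hi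
    · obtain ⟨v, rfl⟩ := (shiftFunctor (PerfCat A) (1 : ℤ)).map_surjective v
      obtain ⟨N', hN', a, b, rfl⟩ := H v
      obtain ⟨w, rfl⟩ := hf.factors N' a hN'
      rw [Functor.map_comp, Functor.map_comp, Category.assoc, reassoc_of% distTriang_comp₃₁ hT, zero_comp]
    · rw [(forall_hom_shift_eq_zero_iff (show i - 1 + 1 = i by omega)).1
        (hPT (i - 1) (by omega)) v, comp_zero]

/-- The objects above the right mutation of `(P ⊞ M)[1]` at `P[1]`. -/
lemma siltingGE_cocone_iff {N Y : PerfCat A} {g : Y ⟶ N} {f : N ⟶ P⟦(1 : ℤ)⟧}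
    {h : P⟦(1 : ℤ)⟧ ⟶ Y⟦(1 : ℤ)⟧}
    (hP : addClosure (regularObj A) P) (hM : addClosure (regularObj A) M)
    (hf : IsMinRightApprox (M⟦(1 : ℤ)⟧) f) (hT : Triangle.mk g f h ∈ distTriang (PerfCat A))
    (hTA : SiltingGE T ((regularObj A)⟦(1 : ℤ)⟧)) :
    SiltingGE T (Y ⊞ M⟦(1 : ℤ)⟧) ↔ RightFactors P M T := by
  have hTP := hTA.of_addClosure_right (addClosure_shift 1 hP)
  have hTM := hTA.of_addClosure_right (addClosure_shift 1 hM)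
  constructor
  · intro H u
    have hY : SiltingGE T Y := H.of_addClosure_right (addClosure_biprod_left Y _)
    obtain ⟨l, rfl⟩ := distTriang_lift₂ hT u (hY 1 one_pos _)
    obtain ⟨N', hN', ⟨e⟩⟩ := exists_of_addClosure_shift 1 hf.mem
    obtain ⟨f', hf'⟩ := (shiftFunctor (PerfCat A) (1 : ℤ)).map_surjective (e.hom ≫ f)
    exact ⟨N', hN', l ≫ e.inv, f', by rw [hf', Category.assoc, Iso.inv_hom_id_assoc]⟩
  · intro H
    refine SiltingGE.biprod_right (fun i hi u => ?_) hTM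
    -- Writing `Y[i]` as `Y[1][j]` brings in `h : P[1] ⟶ Y[1]`. The case `j = 0` uses the
    -- factorisation; `j > 0` follows from `T ≥ A[1]`.
    obtain ⟨j, rfl⟩ : ∃ j, i = 1 + j := ⟨i - 1, by omega⟩
    have hj : ∀ v : T ⟶ Y⟦(1 : ℤ)⟧⟦j⟧, v ≫ (g⟦(1 : ℤ)⟧')⟦j⟧' = 0 := by
      intro v
      have h1 := hTM.of_addClosure_right hf.mem (1 + j) hi
        ((v ≫ (g⟦(1 : ℤ)⟧')⟦j⟧') ≫ (shiftFunctorAdd' (PerfCat A) 1 j (1 + j) rfl).inv.app N)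
      rwa [Preadditive.IsIso.comp_right_eq_zero] at h1
    have key : ∀ v : T ⟶ Y⟦(1 : ℤ)⟧⟦j⟧, v = 0 := by
      intro v
      obtain ⟨w, rfl⟩ := distTriang_lift₃_shift hT j v (hj v)
      rcases eq_or_lt_of_le (show 0 ≤ j by omega) with rfl | hj'
      · obtain ⟨N', hN', a, b, hab⟩ := H (w ≫ (shiftFunctorZero (PerfCat A) ℤ).hom.app _)
        obtain ⟨c, hc⟩ := hf.factors _ (b⟦(1 : ℤ)⟧') (addClosure_shift 1 hN')
        have hw : w = (a ≫ c ≫ f) ≫ (shiftFunctorZero (PerfCat A) ℤ).inv.app _ := by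
          rw [hc, ← hab, Category.assoc, Iso.hom_inv_id_app]
          exact (Category.comp_id _).symm
        have h2 := (shiftFunctorZero (PerfCat A) ℤ).inv.naturality h
        have h3 : f ≫ h = 0 := distTriang_comp₂₃ hT
        rw [hw, Category.assoc, ← h2]
        simp only [Functor.id_map, Category.assoc]
        rw [reassoc_of% h3, zero_comp, comp_zero, comp_zero]
      · rw [hTP j hj' w, zero_comp]
    have h1 := key (u ≫ (shiftFunctorAdd' (PerfCat A) 1 j (1 + j) rfl).hom.app Y)
    rwa [Preadditive.IsIso.comp_right_eq_zero] at h1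

variable (K : Type v) [Field K] [Algebra K A] [FiniteDimensional K A]

include K in
-- Finitely many generators of `Hom(P, M)` over `End M` give an approximation by a power of `M`,
-- from which a minimal summand is split off.
lemma exists_isMinLeftApprox [IsArtinianRing Aᵐᵒᵖ] (hP : addClosure (regularObj A) P)
    (hM : addClosure (regularObj A) M) : ∃ (N : PerfCat A) (f : P ⟶ N), IsMinLeftApprox M f := by
  obtain ⟨P', ⟨eP⟩⟩ := (addClosure_regularObj_iff P).1 hP
  obtain ⟨M', ⟨eM⟩⟩ := (addClosure_regularObj_iff M).1 hM
  obtain ⟨n, f, hf⟩ := exists_hom_generators K P' M'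
  obtain ⟨Q, ⟨eQ⟩⟩ := (addClosure_regularObj_iff _).1
    (addClosure_trans (addClosure_biproduct (stalk M') n) (addClosure_regularObj_stalk M'))
  obtain ⟨R, g, i, r, hir, hi, hr, hmin⟩ := exists_minimal_left (biproduct.lift f ≫ eQ.hom)
  refine ⟨_, eP.hom ≫ g, ?_, fun N' k hN' => ?_, fun k hk => hmin k ?_⟩
  · rw [addClosure_congr eM]
    exact addClosure_trans (addClosure_of_retract i r hir (addClosure_of_iso eQ.symm
      (addClosure_self _))) (addClosure_biproduct (stalk M') n)
  · rw [addClosure_congr eM] at hN'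
    obtain ⟨l, hl⟩ := factors_lift f (fun g => (hf g).2) hN' (eP.inv ≫ k)
    refine ⟨i ≫ eQ.inv ≫ l, ?_⟩
    rw [Category.assoc, reassoc_of% hi, Iso.hom_inv_id_assoc, hl,
      Iso.hom_inv_id_assoc]
  · rwa [Category.assoc, cancel_epi] at hk

include K in
lemma exists_isMinRightApprox [IsArtinianRing Aᵐᵒᵖ] (hP : addClosure (regularObj A) P)
    (hM : addClosure (regularObj A) M) : ∃ (N : PerfCat A) (f : N ⟶ P), IsMinRightApprox M f := by
  obtain ⟨P', ⟨eP⟩⟩ := (addClosure_regularObj_iff P).1 hP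
  obtain ⟨M', ⟨eM⟩⟩ := (addClosure_regularObj_iff M).1 hM
  obtain ⟨n, f, hf⟩ := exists_hom_generators K M' P'
  obtain ⟨Q, ⟨eQ⟩⟩ := (addClosure_regularObj_iff _).1
    (addClosure_trans (addClosure_biproduct (stalk M') n) (addClosure_regularObj_stalk M'))
  obtain ⟨R, g, i, r, hir, hr, hi, hmin⟩ := exists_minimal_right (eQ.inv ≫ biproduct.desc f)
  refine ⟨_, g ≫ eP.inv, ?_, fun N' k hN' => ?_, fun k hk => hmin k ?_⟩
  · rw [addClosure_congr eM]
    exact addClosure_trans (addClosure_of_retract i r hir (addClosure_of_iso eQ.symm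
      (addClosure_self _))) (addClosure_biproduct (stalk M') n)
  · rw [addClosure_congr eM] at hN'
    obtain ⟨l, hl⟩ := factors_desc f (fun g => (hf g).1) hN' (k ≫ eP.hom)
    refine ⟨l ≫ eQ.hom ≫ r, ?_⟩
    rw [Category.assoc, Category.assoc, reassoc_of% hr, Iso.hom_inv_id_assoc, reassoc_of% hl,
      Iso.hom_inv_id, Category.comp_id]
  · rwa [← Category.assoc, cancel_mono] at hk

/-- An indecomposable projective module has a complement in a basic version of `A`. -/
lemma exists_isComplement [IsArtinianRing Aᵐᵒᵖ] (hP : HasLocalEnd P)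
    (hPA : addClosure (regularObj A) P) : ∃ M : PerfCat A, IsComplement P M := by
  obtain ⟨P', ⟨eP⟩⟩ := (addClosure_regularObj_iff P).1 hPA
  -- `M` is chosen of least length with `A` in `add (P ⊞ M)`; minimality will give basicness.
  have hex : ∃ n : ℕ, ∃ M : ProjCat A, projLength M = n ∧
      addClosure (P ⊞ stalk M) (regularObj A) :=
    ⟨_, _, rfl, addClosure_biprod_right P (regularObj A)⟩
  classical
  obtain ⟨M, hMn, hM⟩ := Nat.find_spec hex
  have hmin : ∀ M' : ProjCat A, addClosure (P ⊞ stalk M') (regularObj A) →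
      projLength M ≤ projLength M' := fun M' h => by
    rw [hMn]
    exact Nat.find_min' hex ⟨M', rfl, h⟩
  have hPM : addClosure (regularObj A) (P ⊞ stalk M) :=
    addClosure_biprod hPA (addClosure_regularObj_stalk M)
  refine ⟨stalk M, P ⊞ stalk M, ⟨?_, ?_⟩, ⟨Iso.refl _⟩⟩
  · rintro X Y ⟨e⟩
    have hXXY : addClosure (regularObj A) ((X ⊞ X) ⊞ Y) := addClosure_of_iso e.symm hPM
    have hX : addClosure (regularObj A) X :=
      addClosure_of_retract (biprod.inl ≫ biprod.inl) (biprod.fst ≫ biprod.fst) (by simp) hXXY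
    have hY : addClosure (regularObj A) Y := addClosure_of_retract biprod.inr biprod.snd (by simp) hXXY
    -- By locality `P` splits off one copy of `X`, or off the other copy together with `Y`; in both
    -- cases it splits off `X ⊞ Y`.
    have hret : ∃ (i : P ⟶ X ⊞ Y) (r : X ⊞ Y ⟶ P), i ≫ r = 𝟙 P := by
      let j : P ⟶ (X ⊞ X) ⊞ Y := biprod.inl ≫ e.hom
      let q : (X ⊞ X) ⊞ Y ⟶ P := e.inv ≫ biprod.fst
      have h1 : (j ≫ biprod.fst ≫ biprod.fst) ≫ (biprod.inl ≫ biprod.inl ≫ q) +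
          (j ≫ biprod.lift (biprod.fst ≫ biprod.snd) biprod.snd) ≫
            biprod.desc (biprod.inr ≫ biprod.inl) biprod.inr ≫ q = 𝟙 P := by
        have h2 : (biprod.fst ≫ biprod.fst) ≫ (biprod.inl ≫ biprod.inl) +
          (biprod.lift (biprod.fst ≫ biprod.snd) biprod.snd) ≫
            biprod.desc (biprod.inr ≫ biprod.inl) biprod.inr = 𝟙 ((X ⊞ X) ⊞ Y) := by
          calc _ = biprod.fst ≫ (biprod.fst ≫ biprod.inl + biprod.snd ≫ biprod.inr) ≫ biprod.inl +
                biprod.snd ≫ biprod.inr := by simp [add_assoc, -biprod.total]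
            _ = _ := by rw [biprod.total, Category.id_comp, biprod.total]
        calc _ = j ≫ ((biprod.fst ≫ biprod.fst) ≫ (biprod.inl ≫ biprod.inl) +
          (biprod.lift (biprod.fst ≫ biprod.snd) biprod.snd) ≫
            biprod.desc (biprod.inr ≫ biprod.inl) biprod.inr) ≫ q := by
              simp only [Preadditive.comp_add, Preadditive.add_comp, Category.assoc]
          _ = 𝟙 P := by rw [h2]; simp [j, q]
      rcases hP.2 _ _ h1 with h | h
      · exact ⟨(j ≫ biprod.fst ≫ biprod.fst) ≫ biprod.inl,
          biprod.fst ≫ (biprod.inl ≫ biprod.inl ≫ q) ≫ inv ((j ≫ biprod.fst ≫ biprod.fst) ≫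
            (biprod.inl ≫ biprod.inl ≫ q)), by
          rw [Category.assoc, biprod.inl_fst_assoc, ← Category.assoc, IsIso.hom_inv_id]⟩
      · exact ⟨_, _, (Category.assoc _ _ _).symm.trans (IsIso.hom_inv_id (f := (j ≫ biprod.lift
          (biprod.fst ≫ biprod.snd) biprod.snd) ≫
            biprod.desc (biprod.inr ≫ biprod.inl) biprod.inr ≫ q))⟩
    obtain ⟨i, r, hir⟩ := hret
    obtain ⟨Z, eZ, -⟩ := exists_iso_biprod_of_retract i r hir
    have hZ : addClosure (regularObj A) Z := addClosure_trans (addClosure_biprod_right P Z)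
      (addClosure_of_iso eZ.symm (addClosure_biprod hX hY))
    obtain ⟨X', ⟨eX⟩⟩ := (addClosure_regularObj_iff X).1 hX
    obtain ⟨Z', ⟨eZ'⟩⟩ := (addClosure_regularObj_iff Z).1 hZ
    obtain ⟨V, ⟨eV⟩⟩ := (addClosure_regularObj_iff (X ⊞ Y)).1 (addClosure_biprod hX hY)
    obtain ⟨W, ⟨eW⟩⟩ := (addClosure_regularObj_iff (P ⊞ stalk M)).1 hPM
    -- With `X ⊞ Y ≅ P ⊞ Z`, the length of `M` is that of `X` plus that of `Z`. As `P ⊞ Z` still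
    -- generates `A` additively, minimality forces `X` to have length zero.
    have l1 := projLength_add (eW.symm ≪≫ biprod.mapIso eP (Iso.refl _))
    have l2 := projLength_add (eV.symm ≪≫ eZ ≪≫ biprod.mapIso eP eZ')
    have l3 := projLength_add (eW.symm ≪≫ e ≪≫ biprod.associator X X Y ≪≫ biprod.mapIso eX eV)
    have l4 := hmin Z' (by
      have h1 : addClosure (P ⊞ stalk Z') (X ⊞ Y) :=
        addClosure_of_iso (eZ ≪≫ biprod.mapIso (Iso.refl P) eZ') (addClosure_self _)
      refine addClosure_trans (addClosure_trans hM (addClosure_of_iso e (addClosure_self _))) ?_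
      have hX1 := addClosure_trans (addClosure_biprod_left X Y) h1
      exact addClosure_biprod (addClosure_biprod hX1 hX1)
        (addClosure_trans (addClosure_biprod_right X Y) h1))
    exact (isZero_of_projLength_eq_zero (X := X') (by omega)).of_iso eX
  · ext X
    exact ⟨fun h => addClosure_trans h hPM, fun h => addClosure_trans h hM⟩

section

variable [IsArtinianRing Aᵐᵒᵖ]

include K in
-- The choices of basic version, complement and approximation disappear: each yields the same
-- factorisation condition, and at least one choice exists.
lemma mem_twoSiltMinus_iff (hP : HasLocalEnd P) (hM : IsComplement P M) :
    isoClass T ∈ twoSiltMinus P ↔ isoClass T ∈ twoSilt A ∧ LeftFactors P M T := by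
  refine and_congr_right fun hT => ?_
  have hAT : SiltingGE (regularObj A) T := hT.2.1
  have hPA := addClosure_regularObj_of_isComplement hM
  constructor
  · rintro ⟨B, U, hB, ⟨M', eB, N, Y, f, g, h, hf, hd, ⟨eU⟩⟩, hUT⟩
    have hM' : IsComplement P M' := ⟨B, hB, eB⟩
    exact LeftFactors.of_isComplement hP hM' hM ((siltingGE_cone_iff hPA
      (hM'.addClosure_regularObj (addClosure_self _)) hf hd hAT).1
        (SiltingGE.of_iso eU (Iso.refl _) hUT))
  · intro H
    have hMA := hM.addClosure_regularObj (addClosure_self _)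
    obtain ⟨B, hB, eB⟩ := hM
    obtain ⟨N, f, hf⟩ := exists_isMinLeftApprox K hPA hMA
    obtain ⟨Y, g, h, hd⟩ := distinguished_cocone_triangle f
    exact ⟨B, Y ⊞ M, hB, ⟨M, eB, N, Y, f, g, h, hf, hd, ⟨Iso.refl _⟩⟩,
      (siltingGE_cone_iff hPA hMA hf hd hAT).2 H⟩

include K in
-- As for the lower half, after noting that complements of `P[1]` in `A[1]` are shifts of
-- complements of `P`.
lemma mem_twoSiltPlus_iff (hP : HasLocalEnd P) (hM : IsComplement P M) :
    isoClass T ∈ twoSiltPlus P ↔ isoClass T ∈ twoSilt A ∧ RightFactors P M T := by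
  refine and_congr_right fun hT => ?_
  have hTA : SiltingGE T ((regularObj A)⟦(1 : ℤ)⟧) := hT.2.2
  have hPA := addClosure_regularObj_of_isComplement hM
  constructor
  · rintro ⟨B, U, hB, ⟨M', ⟨eB⟩, N, Y, g, f, h, hf, hd, ⟨eU⟩⟩, hTU⟩
    obtain ⟨M'', ⟨eM⟩⟩ := exists_iso_shift (1 : ℤ) M'
    have hM' : IsComplement P M'' := ⟨P ⊞ M'', IsBasicVersion.of_shift 1 (hB.of_iso (eB ≪≫
      biprod.mapIso (Iso.refl _) eM.symm ≪≫
        (shiftBiprodIso P M'' 1).symm)), ⟨Iso.refl _⟩⟩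
    have hf' : IsMinRightApprox (M''⟦(1 : ℤ)⟧) f := by
      have h1 := addClosure_congr eM
      exact ⟨by rw [h1]; exact hf.mem, fun N' g hN' => hf.factors N' g (by rwa [← h1]), hf.minimal⟩
    exact RightFactors.of_isComplement hP hM' hM ((siltingGE_cocone_iff hPA
      (hM'.addClosure_regularObj (addClosure_self _)) hf' hd hTA).1
        (SiltingGE.of_iso (Iso.refl _) (eU ≪≫ biprod.mapIso (Iso.refl _) eM.symm) hTU))
  · intro H
    have hMA := hM.addClosure_regularObj (addClosure_self _)
    obtain ⟨B, hB, ⟨eB⟩⟩ := hM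
    obtain ⟨N, f, hf⟩ := exists_isMinRightApprox K hPA hMA
    obtain ⟨Y, g, h, hd⟩ := distinguished_cocone_triangle₁ (f⟦(1 : ℤ)⟧')
    exact ⟨B⟦(1 : ℤ)⟧, Y ⊞ M⟦(1 : ℤ)⟧, hB.shift 1,
      ⟨_, ⟨(shiftFunctor (PerfCat A) (1 : ℤ)).mapIso eB ≪≫
        shiftBiprodIso P M 1⟩, _, Y, g, _, h, hf.shift 1, hd,
        ⟨Iso.refl _⟩⟩, (siltingGE_cocone_iff hPA hMA (hf.shift 1) hd hTA).2 H⟩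

/-- The bisection of the two-term silting objects at an indecomposable projective module. -/
lemma leftFactors_or_rightFactors (hP : HasLocalEnd P) (hM : IsComplement P M)
    (hT : IsSilting T) (h1 : SiltingGE (regularObj A) T)
    (h2 : SiltingGE T ((regularObj A)⟦(1 : ℤ)⟧)) :
    LeftFactors P M T ∨ RightFactors P M T := by
  obtain ⟨P₁, P₀, d, f, δ, hd, hmin⟩ := exists_presentation h1 h2
  rw [leftFactors_iff hP hM hd hmin, rightFactors_iff hP hM hd hmin]
  exact addClosure_or_addClosure hP hM hd hmin hT.1

lemma not_leftFactors_and_rightFactors (hP : HasLocalEnd P) (hM : IsComplement P M)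
    (hT : IsSilting T) (h1 : SiltingGE (regularObj A) T)
    (h2 : SiltingGE T ((regularObj A)⟦(1 : ℤ)⟧)) :
    ¬ (LeftFactors P M T ∧ RightFactors P M T) := by
  obtain ⟨P₁, P₀, d, f, δ, hd, hmin⟩ := exists_presentation h1 h2
  rw [leftFactors_iff hP hM hd hmin, rightFactors_iff hP hM hd hmin]
  exact fun h => not_addClosure_and_addClosure hP hM hd hT.2 h.1 h.2

end

end Mutation

end

noncomputable section

/-! ### Dualities on complexes and on the homotopy category. -/

section ComplexDuality

variable {C : Type u} [Category.{v} C] [Preadditive C] (F : Cᵒᵖ ⥤ C) [F.Additive]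

/-- The contravariant functor on cochain complexes induced by a contravariant functor. -/
def complexDual : (CochainComplex C ℤ)ᵒᵖ ⥤ CochainComplex C ℤ :=
  (CochainComplex.opEquivalence C).functor ⋙ F.mapHomologicalComplex (ComplexShape.up ℤ)

/-- The contravariant functor on the homotopy category induced by a contravariant functor. -/
def homotopyDual :
    (HomotopyCategory C (ComplexShape.up ℤ))ᵒᵖ ⥤ HomotopyCategory C (ComplexShape.up ℤ) :=
  (CategoryTheory.Quotient.lift _
    ((complexDual F).rightOp ⋙ (HomotopyCategory.quotient C (ComplexShape.up ℤ)).op)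
    (fun _ _ _ _ ⟨h⟩ => congrArg Quiver.Hom.op (HomotopyCategory.eq_of_homotopy _ _
      (F.mapHomotopy (CochainComplex.homotopyOp h)))) :
    HomotopyCategory C (ComplexShape.up ℤ) ⥤ (HomotopyCategory C (ComplexShape.up ℤ))ᵒᵖ).leftOp

instance : (homotopyDual F).Additive where
  map_add {X Y f g} := by
    obtain ⟨f, rfl⟩ : ∃ f', f = Quiver.Hom.op f' := ⟨f.unop, rfl⟩
    obtain ⟨g, rfl⟩ : ∃ g', g = Quiver.Hom.op g' := ⟨g.unop, rfl⟩
    obtain ⟨f, rfl⟩ := (HomotopyCategory.quotient _ _).map_surjective f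
    obtain ⟨g, rfl⟩ := (HomotopyCategory.quotient _ _).map_surjective g
    have : (complexDual F).map (f + g).op = (complexDual F).map f.op + (complexDual F).map g.op := by
      ext i
      exact F.map_add
    refine Eq.trans ?_ ((congrArg (HomotopyCategory.quotient _ _).map this).trans
      (Functor.map_add _))
    exact congrArg (fun k => (homotopyDual F).map (Quiver.Hom.op k)) 
      (Functor.map_add (HomotopyCategory.quotient C (ComplexShape.up ℤ))).symm

instance [F.Full] [F.Faithful] : (complexDual F).Full := by
  unfold complexDual; infer_instance

instance [F.Full] [F.Faithful] : (homotopyDual F).Full where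
  map_surjective {X Y} g := by
    obtain ⟨g : (complexDual F).obj (Opposite.op X.unop.as) ⟶
      (complexDual F).obj (Opposite.op Y.unop.as), rfl⟩ :=
        (HomotopyCategory.quotient _ _).map_surjective g
    obtain ⟨f, rfl⟩ := (complexDual F).map_surjective g
    exact ⟨((HomotopyCategory.quotient _ _).map f.unop).op, rfl⟩

instance [F.Full] [F.Faithful] : (homotopyDual F).Faithful where
  map_injective {X Y f g} h := by
    obtain ⟨f, rfl⟩ : ∃ f', f = Quiver.Hom.op f' := ⟨f.unop, rfl⟩
    obtain ⟨g, rfl⟩ : ∃ g', g = Quiver.Hom.op g' := ⟨g.unop, rfl⟩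
    obtain ⟨f, rfl⟩ := (HomotopyCategory.quotient _ _).map_surjective f
    obtain ⟨g, rfl⟩ := (HomotopyCategory.quotient _ _).map_surjective g
    exact congrArg Quiver.Hom.op (HomotopyCategory.eq_of_homotopy _ _
      (CochainComplex.homotopyUnop (F.preimageHomotopy (HomotopyCategory.homotopyOfEq _ _ h))))

/-- Dualising a complex reverses shifts. -/
def complexDualShiftIso (X : CochainComplex C ℤ) (n : ℤ) :
    (complexDual F).obj (Opposite.op (X⟦n⟧)) ≅ ((complexDual F).obj (Opposite.op X))⟦-n⟧ :=
  HomologicalComplex.Hom.isoOfComponents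
    (fun i => F.mapIso (X.XIsoOfEq (show -(i + -n) = -i + n by ring)).op) (by
      intro i j _
      have key : ∀ {a b a' b' : ℤ} (ha : a' = a) (hb : b' = b),
          F.map (X.XIsoOfEq hb).hom.op ≫ F.map (X.d a' b').op =
            F.map (X.d a b).op ≫ F.map (X.XIsoOfEq ha).hom.op := by
        rintro a b _ _ rfl rfl
        rw [← F.map_comp, ← F.map_comp, ← op_comp, ← op_comp]
        simp
      have hF : ∀ {a b : C} (u : ℤˣ) (f : a ⟶ b), F.map (u • f).op = u • F.map f.op := by
        intro a b u f
        rcases Int.units_eq_one_or u with rfl | rfl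
        · rw [one_smul, one_smul]
        · rw [Units.neg_smul, Units.neg_smul, one_smul, one_smul, op_neg, Functor.map_neg]
      have hcomp : ∀ {a b c d : C} (u : ℤˣ) (f : a ⟶ b) (g : b ⟶ d) (h : a ⟶ c) (k : c ⟶ d),
          f ≫ g = h ≫ k → f ≫ (u • g) = (u • h) ≫ k := by
        intro a b c d u f g h k hfg
        rw [Linear.comp_units_smul, Linear.units_smul_comp, hfg]
      have h1 : ((complexDual F).obj (Opposite.op (X⟦n⟧))).d i j =
          n.negOnePow • F.map (X.d (-j + n) (-i + n)).op := hF _ _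
      -- The signs of the shifts by `n` and by `-n` agree, so the comparison needs no sign.
      have h2 : (((complexDual F).obj (Opposite.op X))⟦-n⟧).d i j =
          n.negOnePow • F.map (X.d (-(j + -n)) (-(i + -n))).op :=
        congrArg (· • F.map (X.d (-(j + -n)) (-(i + -n))).op) (Int.negOnePow_neg n)
      rw [h1, h2]
      exact hcomp _ _ _ _ _ (key _ _))

/-- The dual of a distinguished triangle. -/
lemma exists_distTriang_homotopyDual [HasZeroObject C] [HasBinaryBiproducts C]
    {T : Triangle (HomotopyCategory C (ComplexShape.up ℤ))} (hT : T ∈ distTriang _) :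
    ∃ T' ∈ distTriang (HomotopyCategory C (ComplexShape.up ℤ)),
      Nonempty (T'.obj₁ ≅ (homotopyDual F).obj (Opposite.op T.obj₃)) ∧
      Nonempty (T'.obj₂ ≅ (homotopyDual F).obj (Opposite.op T.obj₂)) ∧
      Nonempty (T'.obj₃ ≅ (homotopyDual F).obj (Opposite.op T.obj₁)) := by
  -- Distinguished triangles come from degreewise split sequences, and additive functors preserve
  -- splittings. Comparing objects alone avoids tracking the connecting morphism.
  obtain ⟨S, σ, ⟨e⟩⟩ := (HomotopyCategory.distinguished_iff_iso_trianglehOfDegreewiseSplit T).1 hT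
  have : (complexDual F).PreservesZeroMorphisms := by unfold complexDual; infer_instance
  let S' : ShortComplex (CochainComplex C ℤ) := S.op.map (complexDual F)
  let σ' : ∀ n, (S'.map (HomologicalComplex.eval C _ n)).Splitting := fun n =>
    (σ (-n)).op.map F
  refine ⟨CochainComplex.trianglehOfDegreewiseSplit S' σ',
    (HomotopyCategory.distinguished_iff_iso_trianglehOfDegreewiseSplit _).2 ⟨S', σ', ⟨Iso.refl _⟩⟩,
    ⟨?_⟩, ⟨?_⟩, ⟨?_⟩⟩
  · exact (homotopyDual F).mapIso (Triangle.π₃.mapIso e).op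
  · exact (homotopyDual F).mapIso (Triangle.π₂.mapIso e).op
  · exact (homotopyDual F).mapIso (Triangle.π₁.mapIso e).op

end ComplexDuality

end

noncomputable section

/-! ### Dualities on perfect complexes. -/

section PerfectDuality

variable {A : Type u} [Ring A] (F : (ProjCat A)ᵒᵖ ⥤ ProjCat A) [F.Additive]

/-- The contravariant functor on perfect complexes induced by a contravariant functor on
projective modules. -/
def perfDual : (PerfCat A)ᵒᵖ ⥤ PerfCat A :=
  (isBoundedComplex (ProjCat A)).lift ((isBoundedComplex (ProjCat A)).ι.op ⋙ homotopyDual F) (by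
    intro X
    obtain ⟨a, b, h⟩ := X.unop.property
    refine ⟨-b, -a, fun i hi => ?_⟩
    exact Functor.map_isZero F (h (-i) (by omega)).op)

instance : (perfDual F).Additive where
  map_add {_ _ f g} := ObjectProperty.hom_ext _ ((homotopyDual F).map_add (f := f.unop.hom.op)
    (g := g.unop.hom.op))

instance [F.Full] [F.Faithful] : (perfDual F).Full := by
  unfold perfDual; infer_instance

instance [F.Full] [F.Faithful] : (perfDual F).Faithful := by
  unfold perfDual; infer_instance

lemma perfDual_shift (X : PerfCat A) (n : ℤ) :
    Nonempty ((perfDual F).obj (Opposite.op (X⟦n⟧)) ≅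
      ((perfDual F).obj (Opposite.op X))⟦-n⟧) :=
  ⟨(isBoundedComplex (ProjCat A)).ι.preimageIso
    ((homotopyDual F).mapIso (shiftObjIso X n).symm.op ≪≫
      (HomotopyCategory.quotient _ _).mapIso (complexDualShiftIso F X.obj.as n) ≪≫
        (shiftObjIso ((perfDual F).obj (Opposite.op X)) (-n)).symm)⟩

/-- The first morphism of the dual triangle descends by fullness of the inclusion, and a cone is
determined up to isomorphism. -/
lemma exists_distTriang_perfDual {T : Triangle (PerfCat A)} (hT : T ∈ distTriang (PerfCat A)) :
    ∃ T' ∈ distTriang (PerfCat A),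
      Nonempty (T'.obj₁ ≅ (perfDual F).obj (Opposite.op T.obj₃)) ∧
      Nonempty (T'.obj₂ ≅ (perfDual F).obj (Opposite.op T.obj₂)) ∧
      Nonempty (T'.obj₃ ≅ (perfDual F).obj (Opposite.op T.obj₁)) := by
  let ι := (isBoundedComplex (ProjCat A)).ι
  obtain ⟨T', hT', ⟨e₁⟩, ⟨e₂⟩, ⟨e₃⟩⟩ :=
    exists_distTriang_homotopyDual F (ι.map_distinguished T hT)
  obtain ⟨f, hf⟩ : ∃ f : (perfDual F).obj (Opposite.op T.obj₃) ⟶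
      (perfDual F).obj (Opposite.op T.obj₂), ι.map f = e₁.inv ≫ T'.mor₁ ≫ e₂.hom :=
    ι.map_surjective _
  obtain ⟨Z, g, h, hd⟩ := distinguished_cocone_triangle f
  refine ⟨_, hd, ⟨Iso.refl _⟩, ⟨Iso.refl _⟩, ⟨ι.preimageIso (?_ ≪≫ e₃)⟩⟩
  refine Triangle.π₃.mapIso (isoTriangleOfIso₁₂ _ T' (ι.map_distinguished _ hd) hT' e₁.symm
    e₂.symm ?_)
  have : (e₁.inv ≫ T'.mor₁ ≫ e₂.hom) ≫ e₂.inv = e₁.inv ≫ T'.mor₁ := by simp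
  rw [← hf] at this
  exact this

lemma perfDual_stalk (Q : ProjCat A) :
    Nonempty ((perfDual F).obj (Opposite.op (stalk Q)) ≅ stalk (F.obj (Opposite.op Q))) := by
  let X : CochainComplex (ProjCat A) ℤ :=
    (HomologicalComplex.single (ProjCat A) (ComplexShape.up ℤ) 0).obj Q
  let Y : CochainComplex (ProjCat A) ℤ := (complexDual F).obj (Opposite.op X)
  have hY : ∀ i : ℤ, i ≠ 0 → IsZero (Y.X i) := fun i hi => Functor.map_isZero F
    (HomologicalComplex.isZero_single_obj_X (ComplexShape.up ℤ) 0 Q (-i) (by omega)).op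
  have : Y.IsStrictlyGE 0 := (Y.isStrictlyGE_iff 0).2 fun i hi => hY i hi.ne
  have : Y.IsStrictlyLE 0 := (Y.isStrictlyLE_iff 0).2 fun i hi => hY i hi.ne'
  obtain ⟨M, ⟨e⟩⟩ := Y.exists_iso_single 0
  have e₀ : ((HomologicalComplex.single (ProjCat A) (ComplexShape.up ℤ) 0).obj M).X 0 ≅ Y.X 0 :=
    (HomologicalComplex.Hom.isoApp e 0).symm
  have e' : M ≅ F.obj (Opposite.op Q) :=
    (HomologicalComplex.singleObjXSelf (ComplexShape.up ℤ) 0 M).symm ≪≫ e₀ ≪≫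
        F.mapIso (HomologicalComplex.singleObjXSelf (ComplexShape.up ℤ) 0 Q).symm.op
  exact ⟨(isBoundedComplex (ProjCat A)).ι.preimageIso ((HomotopyCategory.quotient _ _).mapIso
    (e ≪≫ (HomologicalComplex.single _ _ 0).mapIso e'))⟩

/-- Dualities of projective modules that are inverse to each other induce dualities of perfect
complexes that are inverse to each other on objects. -/
lemma perfDual_perfDual {F G : (ProjCat A)ᵒᵖ ⥤ ProjCat A} [F.Additive] [G.Additive]
    (e : F.rightOp ⋙ G ≅ 𝟭 (ProjCat A)) (X : PerfCat A) :
    Nonempty ((perfDual G).obj (Opposite.op ((perfDual F).obj (Opposite.op X))) ≅ X) := by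
  let Y : CochainComplex (ProjCat A) ℤ := X.obj.as
  refine ⟨(isBoundedComplex (ProjCat A)).ι.preimageIso ((HomotopyCategory.quotient _ _).mapIso
    (Y := Y) (HomologicalComplex.Hom.isoOfComponents
      (fun i => e.app (Y.X (- -i)) ≪≫ Y.XIsoOfEq (neg_neg i)) ?_))⟩
  intro i j _
  have h1 := e.hom.naturality (Y.d (- -i) (- -j))
  have h2 : Y.d (- -i) (- -j) ≫ (Y.XIsoOfEq (neg_neg j)).hom =
    (Y.XIsoOfEq (neg_neg i)).hom ≫ Y.d i j := by simp
  calc (e.hom.app (Y.X (- -i)) ≫ (Y.XIsoOfEq (neg_neg i)).hom) ≫ Y.d i j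
      = (e.hom.app (Y.X (- -i)) ≫ Y.d (- -i) (- -j)) ≫ (Y.XIsoOfEq (neg_neg j)).hom := by
        rw [Category.assoc, Category.assoc, h2]
    _ = _ := (congrArg (· ≫ (Y.XIsoOfEq (neg_neg j)).hom) h1.symm).trans (Category.assoc _ _ _)

end PerfectDuality

end

noncomputable section

/-! ### Biproducts and basic objects described by morphisms. -/

section Biproducts

variable {C : Type u} [Category.{v} C] [Preadditive C] [HasBinaryBiproducts C]

/-- An object with the inclusions and projections of a biproduct is a biproduct. -/
lemma iso_biprod_of_maps {X Y Z : C} (i₁ : X ⟶ Z) (i₂ : Y ⟶ Z) (r₁ : Z ⟶ X) (r₂ : Z ⟶ Y)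
    (h₁₁ : i₁ ≫ r₁ = 𝟙 X) (h₁₂ : i₁ ≫ r₂ = 0) (h₂₁ : i₂ ≫ r₁ = 0) (h₂₂ : i₂ ≫ r₂ = 𝟙 Y)
    (h : r₁ ≫ i₁ + r₂ ≫ i₂ = 𝟙 Z) : Nonempty (Z ≅ X ⊞ Y) :=
  ⟨{ hom := biprod.lift r₁ r₂
     inv := biprod.desc i₁ i₂
     hom_inv_id := by rw [biprod.lift_desc, h]
     inv_hom_id := by
       apply biprod.hom_ext' <;> apply biprod.hom_ext <;> simp [h₁₁, h₁₂, h₂₁, h₂₂] }⟩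

end Biproducts

section Basic

variable {C : Type u} [Category.{v} C] [HasZeroObject C] [HasShift C ℤ] [Preadditive C]
  [∀ n : ℤ, (shiftFunctor C n).Additive] [Pretriangulated C]

/-- The condition on inclusions and projections is self-dual, so it can be tested on duals. -/
lemma isBasic_iff (T : C) : IsBasic T ↔ ∀ (X : C) (i₁ i₂ : X ⟶ T) (r₁ r₂ : T ⟶ X),
    i₁ ≫ r₁ = 𝟙 X → i₁ ≫ r₂ = 0 → i₂ ≫ r₁ = 0 → i₂ ≫ r₂ = 𝟙 X → IsZero X := by
  constructor
  · intro h X i₁ i₂ r₁ r₂ h₁₁ h₁₂ h₂₁ h₂₂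
    obtain ⟨Y, e, -⟩ := exists_iso_biprod_of_retract (biprod.desc i₁ i₂) (biprod.lift r₁ r₂) (by
      apply biprod.hom_ext' <;> apply biprod.hom_ext <;> simp [h₁₁, h₁₂, h₂₁, h₂₂])
    exact h X Y ⟨e⟩
  · rintro h X Y ⟨e⟩
    exact h X (biprod.inl ≫ biprod.inl ≫ e.inv) (biprod.inr ≫ biprod.inl ≫ e.inv)
      (e.hom ≫ biprod.fst ≫ biprod.fst) (e.hom ≫ biprod.fst ≫ biprod.snd)
      (by simp) (by simp) (by simp) (by simp)

lemma IsSilting.shift [IsTriangulated C] {T : C} (n : ℤ) (h : IsSilting T) : IsSilting (T⟦n⟧) := by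
  refine ⟨(siltingGE_shift_shift_iff n).2 h.1, top_le_iff.1 ?_⟩
  rw [← h.2, ObjectProperty.triangEnvelope_le_iff]
  intro X hX
  obtain rfl : T = X := by simpa using hX
  let E := (ObjectProperty.singleton (T⟦n⟧)).triangEnvelope
  exact E.prop_of_iso (shiftShiftNeg T n) (E.le_shift (-n) _
    (ObjectProperty.le_triangEnvelope _ _ (by simp)))

end Basic

/-! ### Silting objects and factorisations under a duality. -/

section Duality

variable {A : Type u} [Ring A] (F : (ProjCat A)ᵒᵖ ⥤ ProjCat A) [F.Additive]

/-- The dual of a perfect complex. -/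
abbrev dualObj (X : PerfCat A) : PerfCat A := (perfDual F).obj (Opposite.op X)

/-- The dual of a morphism of perfect complexes. -/
abbrev dualMap {X Y : PerfCat A} (f : X ⟶ Y) : dualObj F Y ⟶ dualObj F X :=
  (perfDual F).map f.op

lemma dualMap_comp {X Y Z : PerfCat A} (f : X ⟶ Y) (g : Y ⟶ Z) :
    dualMap F (f ≫ g) = dualMap F g ≫ dualMap F f :=
  (perfDual F).map_comp g.op f.op

lemma dualMap_id (X : PerfCat A) : dualMap F (𝟙 X) = 𝟙 _ := (perfDual F).map_id _

lemma dualMap_zero (X Y : PerfCat A) : dualMap F (0 : X ⟶ Y) = 0 := (perfDual F).map_zero _ _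

lemma dualMap_add {X Y : PerfCat A} (f g : X ⟶ Y) :
    dualMap F (f + g) = dualMap F f + dualMap F g := (perfDual F).map_add

/-- The dual of an isomorphism. -/
abbrev dualIso {X Y : PerfCat A} (e : X ≅ Y) : dualObj F X ≅ dualObj F Y :=
  (perfDual F).mapIso e.symm.op

/-- Dualising a retract. -/
def dualRetract {X Y : PerfCat A} (r : Retract X Y) : Retract (dualObj F X) (dualObj F Y) :=
  ⟨dualMap F r.r, dualMap F r.i, by rw [← dualMap_comp, r.retract, dualMap_id]⟩

/-- The objects whose dual lies in the thick subcategory generated by the dual of `T` themselves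
form a thick subcategory containing `T`. -/
lemma triangEnvelope_dualObj {T : PerfCat A} (X : PerfCat A)
    (hT : (ObjectProperty.singleton T).triangEnvelope = ⊤) :
    (ObjectProperty.singleton (dualObj F T)).triangEnvelope (dualObj F X) := by
  let E := (ObjectProperty.singleton (dualObj F T)).triangEnvelope
  let Q : ObjectProperty (PerfCat A) := fun Y => E (dualObj F Y)
  have hQr : Q.IsStableUnderRetracts := ⟨fun r hY => E.prop_of_retract (dualRetract F r) hY⟩
  have hQ : Q.IsTriangulated :=
    { exists_zero := ⟨_, isZero_zero (PerfCat A), E.prop_of_isZero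
        (Functor.map_isZero (perfDual F) (isZero_zero (PerfCat A)).op)⟩
      isStableUnderShiftBy n := ⟨fun Y hY => by
        obtain ⟨e⟩ := perfDual_shift F Y n
        exact E.prop_of_iso e.symm (E.le_shift (-n) _ hY)⟩
      ext₂' S hS h₁ h₃ := by
        obtain ⟨S', hS', ⟨e₁⟩, ⟨e₂⟩, ⟨e₃⟩⟩ := exists_distTriang_perfDual F hS
        exact Q.le_isoClosure _ (E.prop_of_iso e₂ (E.ext_of_isTriangulatedClosed₂ S' hS'
          (E.prop_of_iso e₁.symm h₃) (E.prop_of_iso e₃.symm h₁))) }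
  have h : (ObjectProperty.singleton T).triangEnvelope ≤ Q := by
    rw [ObjectProperty.triangEnvelope_le_iff]
    intro Y hY
    obtain rfl : T = Y := by simpa using hY
    exact ObjectProperty.le_triangEnvelope _ _ (by simp)
  exact h X (by rw [hT]; trivial)

lemma addClosure_dualObj {M N : PerfCat A} (h : addClosure M N) :
    addClosure (dualObj F M) (dualObj F N) := by
  obtain ⟨n, a, b, hab⟩ := (addClosure_iff _ _).1 h
  refine addClosure_of_sum (fun j => dualMap F (b j)) (fun j => dualMap F (a j)) ?_
  rw [← dualMap_id, ← hab]
  have : ∀ s : Finset (Fin n), dualMap F (∑ j ∈ s, a j ≫ b j) =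
      ∑ j ∈ s, dualMap F (b j) ≫ dualMap F (a j) := by
    intro s
    induction s using Finset.cons_induction with
    | empty => rw [Finset.sum_empty, Finset.sum_empty, dualMap_zero]
    | cons j s hj ih => rw [Finset.sum_cons, Finset.sum_cons, dualMap_add, dualMap_comp, ih]
  exact (this _).symm

lemma dualObj_biprod (X Y : PerfCat A) :
    Nonempty (dualObj F (X ⊞ Y) ≅ dualObj F X ⊞ dualObj F Y) := by
  refine iso_biprod_of_maps (dualMap F biprod.fst) (dualMap F biprod.snd)
    (dualMap F biprod.inl) (dualMap F biprod.inr) ?_ ?_ ?_ ?_ ?_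
  · rw [← dualMap_comp, biprod.inl_fst, dualMap_id]
  · rw [← dualMap_comp, biprod.inr_fst, dualMap_zero]
  · rw [← dualMap_comp, biprod.inl_snd, dualMap_zero]
  · rw [← dualMap_comp, biprod.inr_snd, dualMap_id]
  · rw [← dualMap_comp, ← dualMap_comp, ← dualMap_add, biprod.total, dualMap_id]

lemma dualObj_dualObj {G : (ProjCat A)ᵒᵖ ⥤ ProjCat A} [G.Additive]
    (e : F.rightOp ⋙ G ≅ 𝟭 (ProjCat A)) (X : PerfCat A) :
    Nonempty (dualObj G (dualObj F X) ≅ X) :=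
  perfDual_perfDual e X

variable [F.Full] [F.Faithful]

lemma dualMap_surjective {X Y : PerfCat A} (f : dualObj F Y ⟶ dualObj F X) :
    ∃ g : X ⟶ Y, f = dualMap F g := by
  obtain ⟨g, rfl⟩ := (perfDual F).map_surjective f
  exact ⟨g.unop, rfl⟩

lemma dualMap_injective {X Y : PerfCat A} {f g : X ⟶ Y} (h : dualMap F f = dualMap F g) : f = g :=
  Quiver.Hom.op_inj ((perfDual F).map_injective h)

/-- Objects with isomorphic duals are isomorphic. -/
lemma nonempty_iso_of_dualObj {X Y : PerfCat A} (e : dualObj F X ≅ dualObj F Y) :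
    Nonempty (X ≅ Y) :=
  ⟨((perfDual F).preimageIso e.symm).unop⟩

/-- `Hom(Y*, X*[i])` is `Hom(Y*[-i], X*)`, that is `Hom((Y[i])*, X*)`, which corresponds to `Hom(X,
Y[i])`. -/
lemma siltingGE_dualObj_iff {X Y : PerfCat A} :
    SiltingGE (dualObj F Y) (dualObj F X) ↔ SiltingGE X Y := by
  refine forall_congr' fun i => imp_congr_right fun _ => ?_
  obtain ⟨e⟩ := perfDual_shift F Y i
  rw [forall_hom_shift_eq_zero_iff (show i + -i = 0 by omega)]
  let z := (shiftFunctorZero (PerfCat A) ℤ).app (dualObj F X)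
  constructor
  · intro H f
    have h1 := H (e.inv ≫ dualMap F f ≫ z.inv)
    rw [Preadditive.IsIso.comp_left_eq_zero] at h1
    exact dualMap_injective F (((Preadditive.IsIso.comp_right_eq_zero _ z.inv).1 h1).trans
      (dualMap_zero F _ _).symm)
  · intro H f
    obtain ⟨g, hg⟩ := dualMap_surjective F (e.hom ≫ f ≫ z.hom)
    rw [H g, dualMap_zero, Preadditive.IsIso.comp_left_eq_zero] at hg
    exact (Preadditive.IsIso.comp_right_eq_zero _ z.hom).1 hg

lemma IsBasic.of_dualObj {X : PerfCat A} (h : IsBasic (dualObj F X)) : IsBasic X := by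
  rw [isBasic_iff] at h ⊢
  intro Z i₁ i₂ r₁ r₂ h₁₁ h₁₂ h₂₁ h₂₂
  have h1 := h (dualObj F Z) (dualMap F r₁) (dualMap F r₂) (dualMap F i₁) (dualMap F i₂)
    (by rw [← dualMap_comp, h₁₁, dualMap_id]) (by rw [← dualMap_comp, h₂₁, dualMap_zero])
    (by rw [← dualMap_comp, h₁₂, dualMap_zero]) (by rw [← dualMap_comp, h₂₂, dualMap_id])
  exact (IsZero.iff_id_eq_zero _).2 (dualMap_injective F (h1.eq_of_src _ _))

variable {G : (ProjCat A)ᵒᵖ ⥤ ProjCat A} [G.Additive] [G.Full] [G.Faithful]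
  (e : F.rightOp ⋙ G ≅ 𝟭 (ProjCat A))

omit [F.Full] [F.Faithful] in
include e in
lemma dualObj_dualObj' (X : PerfCat A) : Nonempty (dualObj F (dualObj G X) ≅ X) :=
  nonempty_iso_of_dualObj G (dualObj_dualObj F e (dualObj G X)).some

omit [F.Full] [F.Faithful] in
include e in
lemma IsBasic.dualObj {X : PerfCat A} (h : IsBasic X) : IsBasic (dualObj F X) :=
  IsBasic.of_dualObj G (h.of_iso (dualObj_dualObj F e X).some.symm)

include e in
lemma IsSilting.dualObj {X : PerfCat A} (h : IsSilting X) : IsSilting (dualObj F X) := by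
  refine ⟨(siltingGE_dualObj_iff F).2 h.1, top_le_iff.1 fun Y _ => ?_⟩
  exact ObjectProperty.prop_of_iso _ (dualObj_dualObj' F e Y).some
    (triangEnvelope_dualObj F (_root_.dualObj G Y) h.2)

variable (hA : Nonempty (dualObj F (regularObj A) ≅ regularObj A))

omit [F.Full] [F.Faithful] in
include e hA in
lemma IsComplement.dualObj {P M : PerfCat A} (hP : Nonempty (dualObj F P ≅ P))
    (h : IsComplement P M) : IsComplement P (dualObj F M) := by
  obtain ⟨B, hB, ⟨eB⟩⟩ := h
  refine ⟨_root_.dualObj F B, ⟨hB.1.dualObj F e, ?_⟩, ⟨dualIso F eB ≪≫ (dualObj_biprod F P M).some ≪≫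
    biprod.mapIso hP.some (Iso.refl _)⟩⟩
  have key : ∀ N X : PerfCat A, addClosure (_root_.dualObj F N) X ↔
      addClosure N (_root_.dualObj G X) := by
    intro N X
    constructor
    · intro h
      rw [← addClosure_congr (dualObj_dualObj F e N).some]
      exact addClosure_dualObj G h
    · intro h
      exact addClosure_of_iso (dualObj_dualObj' F e X).some.symm (addClosure_dualObj F h)
  ext X
  rw [← addClosure_congr hA.some, key, key, hB.2]

include e in
/-- The duality exchanges the two kinds of factorisations. -/
lemma rightFactors_dualObj_iff {P M T : PerfCat A} (hP : Nonempty (dualObj F P ≅ P)) :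
    RightFactors P (dualObj F M) ((dualObj F T)⟦(1 : ℤ)⟧) ↔ LeftFactors P M T := by
  obtain ⟨eP⟩ := hP
  let S := shiftFunctor (PerfCat A) (1 : ℤ)
  constructor
  · intro H w
    obtain ⟨N, hN, a, b, hab⟩ := H (S.map (dualMap F w ≫ eP.hom))
    obtain ⟨a, rfl⟩ := S.map_surjective a
    have hab : dualMap F w ≫ eP.hom = a ≫ b := S.map_injective (hab.trans (S.map_comp _ _).symm)
    obtain ⟨eN⟩ := dualObj_dualObj' F e N
    obtain ⟨α, hα⟩ := dualMap_surjective F (a ≫ eN.inv)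
    obtain ⟨β, hβ⟩ := dualMap_surjective F (eN.hom ≫ b ≫ eP.inv)
    refine ⟨dualObj G N, ?_, β, α, dualMap_injective F ?_⟩
    · rw [← addClosure_congr (dualObj_dualObj F e M).some]
      exact addClosure_dualObj G hN
    · rw [dualMap_comp, ← hα, ← hβ, Category.assoc, Iso.inv_hom_id_assoc, ← Category.assoc, ← hab,
        Category.assoc, Iso.hom_inv_id, Category.comp_id]
  · intro H u
    obtain ⟨u, rfl⟩ := S.map_surjective u
    obtain ⟨w, hw⟩ := dualMap_surjective F (u ≫ eP.inv)
    obtain ⟨N, hN, a, b, rfl⟩ := H w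
    refine ⟨dualObj F N, addClosure_dualObj F hN, S.map (dualMap F b), dualMap F a ≫ eP.hom, ?_⟩
    refine (congrArg S.map ?_).trans (S.map_comp _ _)
    rw [← Category.assoc, ← dualMap_comp, ← hw, Category.assoc, Iso.inv_hom_id, Category.comp_id]

/-- The shifted duality on isomorphism classes. -/
def dualClass : IsoClass (PerfCat A) → IsoClass (PerfCat A) :=
  Quotient.map (fun T => (dualObj F T)⟦(1 : ℤ)⟧)
    fun _ _ ⟨f⟩ => ⟨(shiftFunctor (PerfCat A) (1 : ℤ)).mapIso (dualIso F f)⟩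

lemma classGE_dualClass_iff (c d : IsoClass (PerfCat A)) :
    ClassGE (dualClass F c) (dualClass F d) ↔ ClassGE d c := by
  induction c using Quotient.inductionOn
  induction d using Quotient.inductionOn
  exact (siltingGE_shift_shift_iff 1).trans (siltingGE_dualObj_iff F)

omit [F.Full] [F.Faithful] [G.Full] [G.Faithful] in
include e in
lemma dualClass_dualClass (c : IsoClass (PerfCat A)) : dualClass G (dualClass F c) = c := by
  induction c using Quotient.inductionOn with
  | _ T =>
    obtain ⟨f⟩ := perfDual_shift G (dualObj F T) 1
    exact Quotient.sound ⟨(shiftFunctor (PerfCat A) (1 : ℤ)).mapIso f ≪≫ shiftNegShift _ _ ≪≫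
      (dualObj_dualObj F e T).some⟩

omit [F.Full] [F.Faithful] in
include e in
lemma dualClass_dualClass' (c : IsoClass (PerfCat A)) : dualClass F (dualClass G c) = c := by
  induction c using Quotient.inductionOn with
  | _ T =>
    obtain ⟨f⟩ := perfDual_shift F (dualObj G T) 1
    exact Quotient.sound ⟨(shiftFunctor (PerfCat A) (1 : ℤ)).mapIso f ≪≫ shiftNegShift _ _ ≪≫
      (dualObj_dualObj' F e T).some⟩

include e hA in
-- The extra shift is what preserves the interval: `T ↦ T*[1]` sends `A` to `A[1]` and `A[1]` to
-- `A`.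
lemma isoClass_dualObj_mem_twoSilt {T : PerfCat A} (hT : IsSilting T) (hT' : IsBasic T)
    (h1 : SiltingGE (regularObj A) T) (h2 : SiltingGE T ((regularObj A)⟦(1 : ℤ)⟧)) :
    isoClass ((dualObj F T)⟦(1 : ℤ)⟧) ∈ twoSilt A := by
  obtain ⟨eA⟩ := hA
  refine ⟨⟨_, (hT.dualObj F e).shift 1, (hT'.dualObj F e).shift 1, rfl⟩, ?_, ?_⟩
  · have h3 := (siltingGE_shift_shift_iff 1).2 ((siltingGE_dualObj_iff F).2 h2)
    obtain ⟨f⟩ := perfDual_shift F (regularObj A) 1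
    exact h3.of_iso ((shiftFunctor (PerfCat A) (1 : ℤ)).mapIso f ≪≫ shiftNegShift _ _ ≪≫ eA)
      (Iso.refl _)
  · have h3 := (siltingGE_shift_shift_iff 1).2 ((siltingGE_dualObj_iff F).2 h1)
    exact h3.of_iso (Iso.refl _) ((shiftFunctor (PerfCat A) (1 : ℤ)).mapIso eA)

end Duality

end

noncomputable section

/-! ### The duality of projective modules given by an anti-automorphism. -/

section TwistedDual

variable {A : Type u} [Ring A]

/-- A dual basis of a finitely generated projective right module. -/
lemma exists_dualBasis (X : ModuleCat.{u} Aᵐᵒᵖ) (hX : isFGProjective A X) :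
    ∃ (n : ℕ) (x : Fin n → X) (a : Fin n → (X →ₗ[Aᵐᵒᵖ] A)),
      ∀ y : X, ∑ j, MulOpposite.op (a j y) • x j = y := by
  have := hX.1
  have := hX.2
  obtain ⟨n, f, g, -, -, h⟩ := Module.Finite.exists_comp_eq_id_of_projective Aᵐᵒᵖ X
  let u : Aᵐᵒᵖ →ₗ[Aᵐᵒᵖ] A :=
    { MulOpposite.opAddEquiv.symm with map_smul' := fun _ _ => rfl }
  refine ⟨n, fun j => f (Pi.single j 1), fun j => u ∘ₗ LinearMap.proj j ∘ₗ g, fun y => ?_⟩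
  have h1 : f (g y) = y := LinearMap.congr_fun h y
  conv_rhs => rw [← h1, ← LinearMap.sum_single_apply (fun _ : Fin n => Aᵐᵒᵖ) (g y), map_sum]
  refine Finset.sum_congr rfl fun j _ => ?_
  rw [← map_smul]
  refine congrArg f ?_
  ext i
  by_cases hij : i = j
  · subst hij
    simp [u]
  · simp [hij]

/-- Linear equivalences are isomorphisms of projective modules. -/
def projIso {X Y : ProjCat A} (e : X.obj ≃ₗ[Aᵐᵒᵖ] Y.obj) : X ≅ Y where
  hom := projHom e.toLinearMap
  inv := projHom e.symm.toLinearMap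
  hom_inv_id := ObjectProperty.hom_ext _ (ModuleCat.hom_ext (LinearMap.ext e.symm_apply_apply))
  inv_hom_id := ObjectProperty.hom_ext _ (ModuleCat.hom_ext (LinearMap.ext e.apply_symm_apply))

variable (s : Aᵐᵒᵖ ≃+* A)

/-- The dual `Hom_A(X, A)` of a right module, as a right module by means of an anti-automorphism. -/
def TwistedDual (_ : Aᵐᵒᵖ ≃+* A) (X : Type u) [AddCommGroup X] [Module Aᵐᵒᵖ X] : Type u :=
  X →ₗ[Aᵐᵒᵖ] A

namespace TwistedDual

variable (X : Type u) [AddCommGroup X] [Module Aᵐᵒᵖ X]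

instance : AddCommGroup (TwistedDual s X) := inferInstanceAs (AddCommGroup (X →ₗ[Aᵐᵒᵖ] A))

instance : FunLike (TwistedDual s X) X A := inferInstanceAs (FunLike (X →ₗ[Aᵐᵒᵖ] A) X A)

instance : LinearMapClass (TwistedDual s X) Aᵐᵒᵖ X A :=
  inferInstanceAs (LinearMapClass (X →ₗ[Aᵐᵒᵖ] A) Aᵐᵒᵖ X A)

/-- Linear forms carry a left action through their values, and `s` makes it a right action.
Recording `s` in the type separates the actions for `s` and for its inverse. -/
instance : Module Aᵐᵒᵖ (TwistedDual s X) :=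
  Module.compHom (X →ₗ[Aᵐᵒᵖ] A) (s : Aᵐᵒᵖ →+* A)

variable {s X}

lemma ext {f g : TwistedDual s X} (h : ∀ x, f x = g x) : f = g := LinearMap.ext h

lemma add_apply (f g : TwistedDual s X) (x : X) : (f + g) x = f x + g x := rfl

lemma smul_apply (m : Aᵐᵒᵖ) (f : TwistedDual s X) (x : X) : (m • f) x = s m * f x := rfl

lemma sum_apply {ι : Type*} (t : Finset ι) (f : ι → TwistedDual s X) (x : X) :
    (∑ j ∈ t, f j) x = ∑ j ∈ t, f j x :=
  LinearMap.sum_apply (σ₁₂ := RingHom.id Aᵐᵒᵖ) t f x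

lemma apply_smul (f : TwistedDual s X) (m : Aᵐᵒᵖ) (x : X) : f (m • x) = f x * m.unop :=
  map_smul f m x

/-- Expansion of a linear form in a dual basis. -/
lemma eq_sum {n : ℕ} {x : Fin n → X} {a : Fin n → (X →ₗ[Aᵐᵒᵖ] A)}
    (h : ∀ y : X, ∑ j, MulOpposite.op (a j y) • x j = y) (f : TwistedDual s X) :
    ∑ j, s.symm (f (x j)) • (show TwistedDual s X from a j) = f := by
  refine ext fun y => ?_
  conv_rhs => rw [← h y, map_sum]
  rw [sum_apply]
  refine Finset.sum_congr rfl fun j _ => ?_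
  rw [smul_apply, apply_smul, RingEquiv.apply_symm_apply]
  rfl

variable (s) in
lemma isFGProjective (X : ModuleCat.{u} Aᵐᵒᵖ) (hX : isFGProjective A X) :
    isFGProjective A (ModuleCat.of Aᵐᵒᵖ (TwistedDual s X)) := by
  obtain ⟨n, x, a, h⟩ := exists_dualBasis X hX
  let φ : TwistedDual s X →ₗ[Aᵐᵒᵖ] (Fin n → Aᵐᵒᵖ) :=
    { toFun := fun f j => s.symm (f (x j))
      map_add' := fun f g => funext fun j => by rw [add_apply, map_add]; rfl
      map_smul' := fun m f => funext fun j => by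
        rw [smul_apply, map_mul, RingEquiv.symm_apply_apply]; rfl }
  let ψ : (Fin n → Aᵐᵒᵖ) →ₗ[Aᵐᵒᵖ] TwistedDual s X :=
    Fintype.linearCombination Aᵐᵒᵖ (fun j => (show TwistedDual s X from a j))
  have hψ : ψ ∘ₗ φ = LinearMap.id := LinearMap.ext fun f => eq_sum h f
  exact ⟨Module.Finite.of_surjective ψ fun f => ⟨φ f, LinearMap.congr_fun hψ f⟩,
    Module.Projective.of_split φ ψ hψ⟩

end TwistedDual

/-- The contravariant functor `Hom_A(-, A)` on projective right modules, twisted by an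
anti-automorphism. -/
def twistedDual : (ProjCat A)ᵒᵖ ⥤ ProjCat A where
  obj X := ⟨ModuleCat.of Aᵐᵒᵖ (TwistedDual s X.unop.obj),
    TwistedDual.isFGProjective s X.unop.obj X.unop.property⟩
  map {X Y} f := projHom
    { toFun := fun g => (LinearMap.comp (show X.unop.obj →ₗ[Aᵐᵒᵖ] A from g) f.unop.hom.hom :
        Y.unop.obj →ₗ[Aᵐᵒᵖ] A)
      map_add' := fun _ _ => rfl
      map_smul' := fun _ _ => rfl }
  map_id _ := rfl
  map_comp _ _ := rfl

instance : (twistedDual s).Additive where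
  map_add {X _ f g} := ObjectProperty.hom_ext _ (ModuleCat.hom_ext (LinearMap.ext fun k =>
    TwistedDual.ext (s := s) fun y => LinearMap.map_add (show X.unop.obj →ₗ[Aᵐᵒᵖ] A from k)
      (f.unop.hom.hom y) (g.unop.hom.hom y)))

/-- The anti-automorphism inverse to a given one. -/
def inverseAntiAut : Aᵐᵒᵖ ≃+* A :=
  (RingEquiv.op s.symm).trans (RingEquiv.opOp A).symm

lemma inverseAntiAut_apply (m : Aᵐᵒᵖ) : inverseAntiAut s m = (s.symm m.unop).unop := rfl

/-- Evaluation at an element, as a linear form on the dual. -/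
def twistedEval (X : ProjCat A) (x : X.obj) :
    TwistedDual (inverseAntiAut s) (TwistedDual s X.obj) :=
  ({ toFun := fun f => (s.symm (f x)).unop
     map_add' := fun f g => by rw [TwistedDual.add_apply, map_add]; rfl
     map_smul' := fun m f => by
       rw [TwistedDual.smul_apply, map_mul, RingEquiv.symm_apply_apply]; rfl } :
    TwistedDual s X.obj →ₗ[Aᵐᵒᵖ] A)

lemma twistedEval_apply (X : ProjCat A) (x : X.obj) (f : TwistedDual s X.obj) :
    twistedEval s X x f = (s.symm (f x)).unop := rfl

/-- Evaluation: a projective module maps to its double dual. -/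
def toDoubleDual (X : ProjCat A) :
    X.obj →ₗ[Aᵐᵒᵖ] TwistedDual (inverseAntiAut s) (TwistedDual s X.obj) where
  toFun := twistedEval s X
  map_add' x y := TwistedDual.ext fun f => by
    rw [TwistedDual.add_apply, twistedEval_apply, twistedEval_apply, twistedEval_apply,
      map_add f x y, map_add, MulOpposite.unop_add]
  map_smul' m x := TwistedDual.ext fun f => by
    rw [RingHom.id_apply, TwistedDual.smul_apply, twistedEval_apply, twistedEval_apply,
      TwistedDual.apply_smul, map_mul, MulOpposite.unop_mul, inverseAntiAut_apply]

lemma toDoubleDual_apply (X : ProjCat A) (x : X.obj) (f : TwistedDual s X.obj) :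
    toDoubleDual s X x f = (s.symm (f x)).unop := rfl

/-- A vector is determined by its coordinates in a dual basis, and a form on the dual by its values
on the coordinate forms; these values prescribe the preimage. -/
lemma toDoubleDual_bijective (X : ProjCat A) : Function.Bijective (toDoubleDual s X) := by
  obtain ⟨n, x, a, h⟩ := exists_dualBasis X.obj X.property
  constructor
  · rw [injective_iff_map_eq_zero]
    intro y hy
    rw [← h y]
    refine Finset.sum_eq_zero fun j _ => ?_
    have h1 : (s.symm (a j y)).unop = 0 := congrArg (fun k : TwistedDual (inverseAntiAut s)
      (TwistedDual s X.obj) => k (show TwistedDual s X.obj from a j)) hy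
    rw [MulOpposite.unop_eq_zero_iff, EmbeddingLike.map_eq_zero_iff] at h1
    rw [h1, MulOpposite.op_zero, zero_smul]
  · intro φ
    refine ⟨∑ j, MulOpposite.op (s (MulOpposite.op (φ (show TwistedDual s X.obj from a j)))) • x j,
      TwistedDual.ext fun f => ?_⟩
    conv_rhs => rw [← TwistedDual.eq_sum h f, map_sum]
    rw [toDoubleDual_apply, map_sum, map_sum, Finset.unop_sum]
    refine Finset.sum_congr rfl fun j _ => ?_
    rw [TwistedDual.apply_smul, TwistedDual.apply_smul, map_mul, MulOpposite.unop_op,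
      RingEquiv.symm_apply_apply]
    rfl

/-- A projective module is its double dual. -/
def doubleDualIso : (twistedDual s).rightOp ⋙ twistedDual (inverseAntiAut s) ≅ 𝟭 (ProjCat A) :=
  (NatIso.ofComponents (fun X => projIso (LinearEquiv.ofBijective _ (toDoubleDual_bijective s X)))
      (fun _ => ObjectProperty.hom_ext _ (ModuleCat.hom_ext (LinearMap.ext fun _ => rfl)))).symm

instance : (twistedDual s).Faithful := by
  have : (twistedDual s).rightOp.Faithful :=
    Functor.Faithful.of_comp_iso (doubleDualIso s)
  exact ⟨fun {X Y f g} h => Quiver.Hom.unop_inj ((twistedDual s).rightOp.map_injective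
    (congrArg Quiver.Hom.op h))⟩

/-- The composite with the dual for the inverse anti-automorphism is the identity, and that second
functor is faithful and can be cancelled. -/
instance : (twistedDual s).Full := by
  have h1 : ((twistedDual s).rightOp ⋙ twistedDual (inverseAntiAut s)).Full :=
    Functor.Full.of_iso (doubleDualIso s).symm
  have : (twistedDual s).rightOp.Full :=
    Functor.Full.of_comp_faithful _ (twistedDual (inverseAntiAut s))
  exact ⟨fun {X Y} f => by
    obtain ⟨g, hg⟩ := (twistedDual s).rightOp.map_surjective f.op
    exact ⟨g.op, congrArg Quiver.Hom.unop hg⟩⟩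

/-- Evaluation at the generator of a right ideal, for an anti-automorphism. -/
def evalGenerator {X : Type u} [AddCommGroup X] [Module Aᵐᵒᵖ X] (x : X) :
    TwistedDual s X →ₗ[Aᵐᵒᵖ] A where
  toFun f := (s.symm (f x)).unop
  map_add' f g := by rw [TwistedDual.add_apply, map_add]; rfl
  map_smul' m f := by
    rw [TwistedDual.smul_apply, map_mul, RingEquiv.symm_apply_apply]; rfl

lemma evalGenerator_eq_zero_iff {X : Type u} [AddCommGroup X] [Module Aᵐᵒᵖ X] {x : X}
    (hx : ∀ y : X, ∃ m : Aᵐᵒᵖ, y = m • x) (f : TwistedDual s X) :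
    evalGenerator s x f = 0 ↔ f = 0 := by
  constructor
  · intro h
    have h1 : f x = 0 := by
      rw [← EmbeddingLike.map_eq_zero_iff (f := s.symm)]
      exact (MulOpposite.unop_eq_zero_iff _).1 h
    refine TwistedDual.ext fun y => ?_
    obtain ⟨m, rfl⟩ := hx y
    rw [TwistedDual.apply_smul, h1, zero_mul]
    rfl
  · rintro rfl
    exact map_zero _

/-- Left multiplication, as an endomorphism of the right module `A`. -/
def leftMul (c : A) : A →ₗ[Aᵐᵒᵖ] A where
  toFun z := c * z
  map_add' := mul_add c
  map_smul' m z := (mul_assoc c z m.unop).symm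

lemma nonempty_dualObj_stalk_iso {Q : ProjCat A}
    (e : TwistedDual s Q.obj ≃ₗ[Aᵐᵒᵖ] Q.obj) :
    Nonempty (dualObj (twistedDual s) (stalk Q) ≅ stalk Q) :=
  ⟨(perfDual_stalk _ _).some ≪≫ (stalkFunctor A).mapIso (projIso e)⟩

lemma dualObj_regularObj : Nonempty (dualObj (twistedDual s) (regularObj A) ≅ regularObj A) := by
  refine nonempty_dualObj_stalk_iso s (LinearEquiv.ofBijective (evalGenerator s (1 : A)) ⟨?_, ?_⟩)
  · rw [injective_iff_map_eq_zero]
    exact fun f => (evalGenerator_eq_zero_iff s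
      (fun y => ⟨MulOpposite.op y, (one_mul y).symm⟩) f).1
  · intro y
    refine ⟨leftMul (s (MulOpposite.op y)), ?_⟩
    change (s.symm (s (MulOpposite.op y) * 1)).unop = y
    rw [mul_one, RingEquiv.symm_apply_apply, MulOpposite.unop_op]

/-- Evaluation at `e` identifies `Hom_A(eA, A)` with `Ae`, and the inverse of `s` carries `Ae` to
`eA` because `e` is fixed. -/
lemma dualObj_idempotentObj {e : A} (he : IsIdempotentElem e) (hs : s (MulOpposite.op e) = e) :
    Nonempty (dualObj (twistedDual s) (idempotentObj e he) ≅ idempotentObj e he) := by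
  let I : Submodule Aᵐᵒᵖ A := Submodule.span Aᵐᵒᵖ {e}
  let g : I := ⟨e, Submodule.mem_span_singleton_self e⟩
  have hs' : s.symm e = MulOpposite.op e := by rw [← hs, RingEquiv.symm_apply_apply, hs]
  have hg : ∀ y : I, ∃ m : Aᵐᵒᵖ, y = m • g := fun y => by
    obtain ⟨m, hm⟩ := Submodule.mem_span_singleton.1 y.2
    exact ⟨m, Subtype.ext hm.symm⟩
  have hmem : ∀ f : TwistedDual s I, evalGenerator s g f ∈ I := fun f => by
    have h1 : MulOpposite.op e • g = g := Subtype.ext he.eq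
    have h2 : f g = f g * e := by
      conv_lhs => rw [← h1, TwistedDual.apply_smul, MulOpposite.unop_op]
    refine Submodule.mem_span_singleton.2 ⟨s.symm (f g), ?_⟩
    change e * (s.symm (f g)).unop = (s.symm (f g)).unop
    conv_rhs => rw [h2, map_mul, hs']
    rfl
  refine nonempty_dualObj_stalk_iso s
    (LinearEquiv.ofBijective ((evalGenerator s g).codRestrict I hmem) ⟨?_, ?_⟩)
  · rw [injective_iff_map_eq_zero]
    exact fun f hf => (evalGenerator_eq_zero_iff s hg f).1 (congrArg Subtype.val hf)
  · intro y
    refine ⟨leftMul (s (MulOpposite.op y.1)) ∘ₗ I.subtype, Subtype.ext ?_⟩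
    change (s.symm (s (MulOpposite.op y.1) * e)).unop = y.1
    rw [map_mul, RingEquiv.symm_apply_apply, hs']
    obtain ⟨m, hm⟩ := hg y
    rw [hm]
    change e * (e * m.unop) = e * m.unop
    rw [← mul_assoc, he.eq]

end TwistedDual

end

noncomputable section

/-! ### The bisection and the order-reversing bijection. -/

section BisectionTheorem

variable {A : Type u} [Ring A]

lemma dualClass_mem_twoSilt (s : Aᵐᵒᵖ ≃+* A) {c : IsoClass (PerfCat A)} (hc : c ∈ twoSilt A) :
    dualClass (twistedDual s) c ∈ twoSilt A := by
  obtain ⟨⟨T, hT, hT', rfl⟩, h1, h2⟩ := hc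
  exact isoClass_dualObj_mem_twoSilt _ (doubleDualIso s) (dualObj_regularObj s) hT hT' h1 h2

variable (K : Type v) [Field K] [Algebra K A] [FiniteDimensional K A]

include K in
lemma isArtinianRing_op : IsArtinianRing Aᵐᵒᵖ :=
  IsArtinianRing.of_finite K Aᵐᵒᵖ

variable {e : A} (he : IsPrimitiveIdempotent e)

include K in
lemma twoSiltMinus_union_twoSiltPlus :
    twoSiltMinus (idempotentObj e he.1) ∪ twoSiltPlus (idempotentObj e he.1) = twoSilt A := by
  have := isArtinianRing_op (A := A) K
  have hP := hasLocalEnd_idempotentObj he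
  obtain ⟨M, hM⟩ := exists_isComplement hP (addClosure_regularObj_stalk _)
  refine Set.Subset.antisymm (Set.union_subset (fun c hc => hc.1) fun c hc => hc.1) fun c hc => ?_
  obtain ⟨⟨T, hT, hT', rfl⟩, h1, h2⟩ := id hc
  exact (leftFactors_or_rightFactors hP hM hT h1 h2).imp
    (fun h => (mem_twoSiltMinus_iff K hP hM).2 ⟨hc, h⟩)
    (fun h => (mem_twoSiltPlus_iff K hP hM).2 ⟨hc, h⟩)

include K in
lemma disjoint_twoSiltMinus_twoSiltPlus :
    Disjoint (twoSiltMinus (idempotentObj e he.1)) (twoSiltPlus (idempotentObj e he.1)) := by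
  have := isArtinianRing_op (A := A) K
  have hP := hasLocalEnd_idempotentObj he
  obtain ⟨M, hM⟩ := exists_isComplement hP (addClosure_regularObj_stalk _)
  refine Set.disjoint_left.2 fun c hc hc' => ?_
  obtain ⟨⟨T, hT, hT', rfl⟩, h1, h2⟩ := id hc.1
  exact not_leftFactors_and_rightFactors hP hM hT h1 h2
    ⟨((mem_twoSiltMinus_iff K hP hM).1 hc).2, ((mem_twoSiltPlus_iff K hP hM).1 hc').2⟩

include K in
-- The dual of a complement of `P` is again a complement of `P`, and membership in the upper half
-- may be tested with any complement.
lemma dualClass_mem_twoSiltPlus_iff {s : Aᵐᵒᵖ ≃+* A} (hs : s (MulOpposite.op e) = e)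
    {c : IsoClass (PerfCat A)} (hc : c ∈ twoSilt A) :
    dualClass (twistedDual s) c ∈ twoSiltPlus (idempotentObj e he.1) ↔
      c ∈ twoSiltMinus (idempotentObj e he.1) := by
  have := isArtinianRing_op (A := A) K
  have hP := hasLocalEnd_idempotentObj he
  obtain ⟨M, hM⟩ := exists_isComplement hP (addClosure_regularObj_stalk _)
  have hP' := dualObj_idempotentObj s he.1 hs
  have hM' := hM.dualObj _ (doubleDualIso s) (dualObj_regularObj s) hP'
  have hd := dualClass_mem_twoSilt s hc
  obtain ⟨⟨T, hT, hT', rfl⟩, h1, h2⟩ := id hc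
  rw [mem_twoSiltMinus_iff K hP hM, ← rightFactors_dualObj_iff _ (doubleDualIso s) hP']
  exact (mem_twoSiltPlus_iff K hP hM').trans (and_congr_left' (iff_of_true hd hc))

include K in
/-- The order-reversing bijection between the two halves of the bisection. -/
lemma nonempty_relIso_twoSilt {s : Aᵐᵒᵖ ≃+* A} (hs : s (MulOpposite.op e) = e) :
    Nonempty ((fun c d : twoSiltMinus (idempotentObj e he.1) => ClassGE c.1 d.1) ≃r
      (fun c d : twoSiltPlus (idempotentObj e he.1) => ClassGE d.1 c.1)) := by
  have hinv : ∀ c, dualClass (twistedDual s) (dualClass (twistedDual (inverseAntiAut s)) c) = c :=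
    dualClass_dualClass' _ (doubleDualIso s)
  exact ⟨{
    toFun := fun c => ⟨_, (dualClass_mem_twoSiltPlus_iff K he hs c.2.1).2 c.2⟩
    invFun := fun d => ⟨dualClass (twistedDual (inverseAntiAut s)) d.1,
      (dualClass_mem_twoSiltPlus_iff K he hs (dualClass_mem_twoSilt _ d.2.1)).1
        (by rw [hinv]; exact d.2)⟩
    left_inv := fun c => Subtype.ext (dualClass_dualClass _ (doubleDualIso s) c.1)
    right_inv := fun d => Subtype.ext (hinv d.1)
    map_rel_iff' := classGE_dualClass_iff _ _ _ }⟩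

end BisectionTheorem

/-! ### The anti-automorphism and idempotents of the trivial extension. -/

section AntiAutomorphism

variable {K : Type v} [Field K] {L : Type u} [Ring L] [Algebra K L]

namespace KDual

/-- Transport of linear forms along a linear isomorphism `Lᵐᵒᵖ ≃ L`. -/
def transport (σ : Lᵐᵒᵖ ≃ₐ[K] L) : KDual K L ≃ₗ[K] KDual K L :=
  toDual ≪≫ₗ ((MulOpposite.opLinearEquiv K).trans σ.toLinearEquiv).dualMap.symm ≪≫ₗ toDual.symm

end KDual

/-- The linear isomorphism `(a, f) ↦ (σ a, f ∘ σ⁻¹)`. -/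
def trivialExtensionLinearEquiv (σ : Lᵐᵒᵖ ≃ₐ[K] L) :
    (TrivialExtension K L)ᵐᵒᵖ ≃ₗ[K] TrivialExtension K L :=
  (MulOpposite.opLinearEquiv K).symm.trans
    (LinearEquiv.prodCongr ((MulOpposite.opLinearEquiv K).trans σ.toLinearEquiv)
      (KDual.transport σ) : TrivialExtension K L ≃ₗ[K] TrivialExtension K L)

lemma trivialExtensionLinearEquiv_mul (σ : Lᵐᵒᵖ ≃ₐ[K] L) (x y : (TrivialExtension K L)ᵐᵒᵖ) :
    trivialExtensionLinearEquiv σ (x * y) =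
      trivialExtensionLinearEquiv σ x * trivialExtensionLinearEquiv σ y := by
  induction x with | _ s
  induction y with | _ t
  refine TrivSqZeroExt.ext (map_mul σ (MulOpposite.op s.fst) (MulOpposite.op t.fst))
    (KDual.ext fun x => ?_)
  -- Evaluated at `x`, the two bimodule terms of the reversed product appear in exchanged order.
  change KDual.toDual (t * s).snd (σ.symm x).unop =
    KDual.toDual t.snd (σ.symm (x * σ (MulOpposite.op s.fst))).unop +
      KDual.toDual s.snd (σ.symm (σ (MulOpposite.op t.fst) * x)).unop
  rw [TrivSqZeroExt.snd_mul, map_mul, map_mul, AlgEquiv.symm_apply_apply,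
    AlgEquiv.symm_apply_apply, add_comm]
  rfl

/-- The anti-automorphism of the trivial extension induced by an anti-automorphism. -/
def trivialExtensionAntiAut (σ : Lᵐᵒᵖ ≃ₐ[K] L) :
    (TrivialExtension K L)ᵐᵒᵖ ≃ₐ[K] TrivialExtension K L :=
  AlgEquiv.ofLinearEquiv (trivialExtensionLinearEquiv σ)
    (TrivSqZeroExt.ext (map_one σ) (map_zero (KDual.transport σ)))
    (trivialExtensionLinearEquiv_mul σ)

/-- The dual is a square-zero ideal, so an idempotent with zero first component is zero.
Decompositions of `(e, 0)` are therefore detected in the algebra itself. -/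
lemma IsPrimitiveIdempotent.inl {e : L} (he : IsPrimitiveIdempotent e) :
    IsPrimitiveIdempotent (TrivSqZeroExt.inl e : TrivialExtension K L) := by
  have key : ∀ a : TrivialExtension K L, IsIdempotentElem a → a.fst = 0 → a = 0 := by
    intro a ha h
    refine TrivSqZeroExt.ext h ?_
    rw [← ha.eq, TrivSqZeroExt.snd_mul, h, MulOpposite.op_zero, zero_smul, zero_smul, add_zero]
    rfl
  refine ⟨?_, ?_, fun a b ha hb hab hba h => ?_⟩
  · rw [IsIdempotentElem, ← TrivSqZeroExt.inl_mul, he.1.eq]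
  · exact fun h => he.2.1 (congrArg TrivSqZeroExt.fst h)
  · exact (he.2.2 a.fst b.fst (congrArg TrivSqZeroExt.fst ha.eq)
      (congrArg TrivSqZeroExt.fst hb.eq) (congrArg TrivSqZeroExt.fst hab)
      (congrArg TrivSqZeroExt.fst hba) (congrArg TrivSqZeroExt.fst h)).imp (key a ha) (key b hb)

instance [FiniteDimensional K L] : FiniteDimensional K (TrivialExtension K L) :=
  have : Module.Finite K (KDual K L) := inferInstanceAs (Module.Finite K (Module.Dual K L))
  inferInstanceAs (Module.Finite K (L × KDual K L))

end AntiAutomorphism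

end

theorem theorem2p13 {K : Type v} [Field K] [IsAlgClosed K]
    {L : Type u} [Ring L] [Algebra K L] [FiniteDimensional K L] (σ : Lᵐᵒᵖ ≃ₐ[K] L) :
    ∃ τ : (TrivialExtension K L)ᵐᵒᵖ ≃ₐ[K] TrivialExtension K L,
      (∀ t : TrivialExtension K L,
        (τ (MulOpposite.op t)).fst = σ (MulOpposite.op t.fst) ∧
        ∀ x : L, KDual.toDual (τ (MulOpposite.op t)).snd x =
          KDual.toDual t.snd (σ.symm x).unop) ∧
      ∀ e : L, IsPrimitiveIdempotent e → σ (MulOpposite.op e) = e →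
        ∃ he : IsPrimitiveIdempotent (TrivSqZeroExt.inl e : TrivialExtension K L),
          τ (MulOpposite.op (TrivSqZeroExt.inl e)) = TrivSqZeroExt.inl e ∧
          let P : PerfCat (TrivialExtension K L) := idempotentObj (TrivSqZeroExt.inl e) he.1
          twoSiltMinus P ∪ twoSiltPlus P = twoSilt (TrivialExtension K L) ∧
          Disjoint (twoSiltMinus P) (twoSiltPlus P) ∧
          Nonempty ((fun c d : twoSiltMinus P => ClassGE c.1 d.1) ≃r
            (fun c d : twoSiltPlus P => ClassGE d.1 c.1)) ∧
          Cardinal.mk (twoSilt (TrivialExtension K L)) = 2 * Cardinal.mk (twoSiltMinus P) ∧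
          Cardinal.mk (twoSilt (TrivialExtension K L)) = 2 * Cardinal.mk (twoSiltPlus P) := by
  refine ⟨trivialExtensionAntiAut σ, fun t => ⟨rfl, fun x => rfl⟩, fun e he hσ => ?_⟩
  have he' : IsPrimitiveIdempotent (TrivSqZeroExt.inl e : TrivialExtension K L) := he.inl
  have hτ : trivialExtensionAntiAut σ (MulOpposite.op (TrivSqZeroExt.inl e)) =
      TrivSqZeroExt.inl e := TrivSqZeroExt.ext hσ (map_zero (KDual.transport σ))
  have h1 := twoSiltMinus_union_twoSiltPlus K he'
  have h2 := disjoint_twoSiltMinus_twoSiltPlus K he'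
  have h3 := nonempty_relIso_twoSilt K he'
    (s := (trivialExtensionAntiAut σ).toRingEquiv) hτ
  have h4 := Cardinal.mk_union_of_disjoint h2
  have h5 := Cardinal.mk_congr h3.some.toEquiv
  rw [h1] at h4
  exact ⟨he', hτ, h1, h2, h3, by rw [h4, ← h5, two_mul], by rw [h4, h5, two_mul]⟩
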